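/- Let $n\ge 2$, let $\mathbb{B}=\{x\in\mathbb{R}^n:|x|<1\}$ be the open Euclidean unit ball with Lebesgue measure $dx$, and let Berwald's metric be \[ \mathsf{B}(x,y)=\frac{\left(\sqrt{(1-|x|^2)|y|^2+\langle x,y\rangle^2}+\langle x,y\rangle\right)^2}{(1-|x|^2)^2\sqrt{(1-|x|^2)|y|^2+\langle x,y\rangle^2}},\qquad x\in\mathbb{B},\ y\in\mathbb{R}^n\setminus\{0\},\qquad \mathsf{B}(x,0)=0. \] Definitions. A Minkowski norm on a finite-dimensional real vector space $V$ is a function $\phi:V\to[0,\infty)$ that vanishes only at $0$, satisfies $\phi(\lambda y)=\lambda\phi(y)$ for $\lambda>0$, is smooth on $V\setminus\{0\}$, and for which the Hessian of $\phi^2$ is positive definite at every $y\ne0$; then $(V,\phi)$ is called a Minkowski space. A Finsler metric on a domain $U\subset\mathbb{R}^n$ is a function $F(x,y)$, smooth on $U\times(\mathbb{R}^n\setminus\{0\})$, such that each $F(x,\cdot)$ is a Minkowski norm. Put $g_{ij}=\frac12\partial^2F^2/\partial y^i\partial y^j$, $g_y=(g_{ij}(x,y))$, and (summing over repeated indices)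 \[ G^i=\tfrac14g^{il}\left(2\frac{\partial g_{jl}}{\partial x^k}-\frac{\partial g_{jk}}{\partial x^l}\right)y^jy^k,\qquad R^i_{\,k}=2\frac{\partial G^i}{\partial x^k}-y^j\frac{\partial^2G^i}{\partial x^j\partial y^k}+2G^j\frac{\partial^2G^i}{\partial y^j\partial y^k}-\frac{\partial G^i}{\partial y^j}\frac{\partial G^j}{\partial y^k}. \] Geodesics are the smooth curves with $\ddot\gamma^i+2G^i(\gamma,\dot\gamma)=0$; $(U,F)$ is forward complete if every geodesic on $[0,1)$ extends to a geodesic on $[0,\infty)$. With $R_y(v)=(R^i_{\,k}(x,y)v^k)_i$, the flag curvature is $\mathbf K(y,v)=g_y(R_y(v),v)/\big(g_y(y,y)g_y(v,v)-g_y(y,v)^2\big)$ for linearly independent $y,v$. A Cartan--Hadamard manifold is a simply connected, forward complete Finsler manifold with $\mathbf K\le0$; it is flat if $\mathbf K\equiv0$. The reversibility of $F$ is $\sup_{x\in U}\sup_{y\neq0}F(x,-y)/F(x,y)$. The distance $d_F(a,b)$ is the infimum of $\int_0^1F(\zeta,\dot\zeta)\,dt$ over Lipschitz paths $\zeta:[0,1]\to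 U$ from $a$ to $b$. The co-metric is $F^*(x,\eta)=\sup_{y\ne0}\eta(y)/F(x,y)$, and the gradient $\nabla f(x)$ is the vector whose image under the Legendre transformation $y\mapsto g_y(y,\cdot)$ (with $0\mapsto0$) is $df(x)$. An isometric embedding of $(U,F)$ into $(V,\phi)$ is a $C^1$ embedding $f:U\to V$ with $\phi(df_x(y))=F(x,y)$ for all $x\in U$, $y\in\mathbb{R}^n$. The space $W^{1,p}_0(U,F,dx)$ consists of all (classes of almost everywhere equal) functions $u$ on $U$ with a locally integrable weak differential $du$ for which there are $u_k\in C_0^\infty(U)$ with \[ \left(\int_U|u-u_k|^p\,dx\right)^{1/p}+\left(\int_UF^{*}(x,du-du_k)^p\,dx\right)^{1/p}\longrightarrow0 . \] Theorem. $(\mathbb{B},\mathsf{B})$ is a flat Cartan--Hadamard manifold, and, with $r(x)=d_{\mathsf B}(0,x)$ and $p'=p/(p-1)$: (i) the reversibility of $\mathsf B$ is $+\infty$, and $(\mathbb{B},\mathsf{B})$ admits no isometric embedding into any Minkowski space; (ii) for every $p\in(1,\infty)$, $W^{1,p}_0(\mathbb{B},\mathsf{B},dx)$ is not a vector space, i.e.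 it is not a linear subspace of the space of (classes of) measurable functions on $\mathbb{B}$; (iii) for every $p\in(1,n)$, the numerator below is finite and the denominator is finite and positive for each $f$, and \[ \inf_{f\in C_0^\infty(\mathbb{B})\setminus\{0\}}\frac{\int_{\mathbb B}\mathsf B(x,\nabla f)^p\,dx}{\int_{\mathbb B}|f|^p\,r^{-p}\,dx}=0; \] (iv) for all real $p,s$ with $-p+1<s\le1<p<n$, the integrals below are finite and the denominator is positive for each $f$, and \[ \inf_{f\in C_0^\infty(\mathbb{B})\setminus\{0\}}\frac{\left(\int_{\mathbb B}\mathsf B(x,\nabla f)^p\,dx\right)^{1/p}\left(\int_{\mathbb B}|f|^p\,r^{p's}\,dx\right)^{1/p'}}{\int_{\mathbb B}|f|^p\,r^{s-1}\,dx}=0. \] -/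

import Mathlib

open MeasureTheory Filter Topology
open scoped ENNReal ContDiff

noncomputable section

namespace Finsler

/-! ### Minkowski norms -/

section Minkowski

variable {V : Type*} [NormedAddCommGroup V] [NormedSpace ℝ V]

/-- The bilinear form `½ D²(φ²)(y)`, whose coefficients are `½ ∂²(φ²)/∂yⁱ∂yʲ (y)`. -/
def fundTensor (φ : V → ℝ) (y : V) : V →L[ℝ] V →L[ℝ] ℝ :=
  (1 / 2 : ℝ) • fderiv ℝ (fderiv ℝ (fun w => φ w ^ 2)) y

/-- A Minkowski norm on a (finite-dimensional) real vector space; it need not be symmetric.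
The norm of `V` only serves as a carrier of the canonical topology. -/
structure IsMinkowskiNorm (φ : V → ℝ) : Prop where
  nonneg : ∀ y, 0 ≤ φ y
  eq_zero_iff : ∀ y, φ y = 0 ↔ y = 0
  pos_homogeneous : ∀ (c : ℝ) (y : V), 0 < c → φ (c • y) = c * φ y
  smooth : ContDiffOn ℝ ∞ φ {0}ᶜ
  posDef : ∀ y, y ≠ 0 → ∀ v, v ≠ 0 → 0 < fundTensor φ y v v

end Minkowski

/-! ### Finsler metrics on domains of `ℝⁿ`, in the global Cartesian chart

`F x y` is the value of the metric at the tangent vector `y` at the point `x`. -/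

/-- Euclidean `n`-space. -/
abbrev Eu (n : ℕ) := EuclideanSpace ℝ (Fin n)

variable {n : ℕ}

/-- A Finsler manifold whose underlying manifold is a domain `U` of `ℝⁿ`. -/
structure IsFinslerManifold (U : Set (Eu n)) (F : Eu n → Eu n → ℝ) : Prop where
  isOpen : IsOpen U
  isConnected : IsConnected U
  smooth : ContDiffOn ℝ ∞ (fun z : Eu n × Eu n => F z.1 z.2) (U ×ˢ {0}ᶜ)
  minkowski : ∀ x ∈ U, IsMinkowskiNorm (F x)

/-- The reversibility `sup_x sup_{y ≠ 0} F(x,-y) / F(x,y)`, with values in `[0,∞]`. -/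
def reversibility (U : Set (Eu n)) (F : Eu n → Eu n → ℝ) : ℝ≥0∞ :=
  ⨆ (x ∈ U) (y : Eu n) (_ : y ≠ 0), ENNReal.ofReal (F x (-y) / F x y)

/-- The `i`-th partial derivative of `f` at `x`. -/
def pd (i : Fin n) (f : Eu n → ℝ) (x : Eu n) : ℝ :=
  fderiv ℝ f x (EuclideanSpace.single i 1)

/-- The matrix `g_{ij}(x,y)` of the fundamental tensor. -/
def gMatrix (F : Eu n → Eu n → ℝ) (x y : Eu n) : Matrix (Fin n) (Fin n) ℝ :=
  Matrix.of fun i j =>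
    fundTensor (F x) y (EuclideanSpace.single i 1) (EuclideanSpace.single j 1)

/-- The geodesic coefficients
`Gⁱ = ¼ gⁱˡ (2 ∂g_{jl}/∂xᵏ - ∂g_{jk}/∂xˡ) yʲ yᵏ`. -/
def geodesicCoeff (F : Eu n → Eu n → ℝ) (x y : Eu n) (i : Fin n) : ℝ :=
  (1 / 4 : ℝ) * ∑ l, ∑ j, ∑ k, (gMatrix F x y)⁻¹ i l *
    (2 * pd k (fun z => gMatrix F z y j l) x - pd l (fun z => gMatrix F z y j k) x) * y j * y k

/-- `γ` is a (constant-speed) geodesic of `(U, F)` on the interval `s`; at an end point of `s`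
that belongs to `s` the derivatives are one-sided. -/
structure IsGeodesicOn (U : Set (Eu n)) (F : Eu n → Eu n → ℝ) (γ : ℝ → Eu n) (s : Set ℝ) :
    Prop where
  mapsTo : Set.MapsTo γ s U
  smooth : ContDiffOn ℝ ∞ γ s
  equation : ∀ t ∈ s, ∀ i,
    derivWithin (derivWithin γ s) s t i + 2 * geodesicCoeff F (γ t) (derivWithin γ s t) i = 0

/-- Every geodesic on `[0,1)` extends to a geodesic on `[0,∞)`. -/
def ForwardComplete (U : Set (Eu n)) (F : Eu n → Eu n → ℝ) : Prop :=
  ∀ γ : ℝ → Eu n, IsGeodesicOn U F γ (Set.Ico 0 1) →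
    ∃ γ' : ℝ → Eu n, IsGeodesicOn U F γ' (Set.Ici 0) ∧ Set.EqOn γ γ' (Set.Ico 0 1)

/-- The coefficients `Rⁱ_k(x,y)` of the Riemannian curvature. -/
def riemannCoeff (F : Eu n → Eu n → ℝ) (x y : Eu n) (i k : Fin n) : ℝ :=
  2 * pd k (fun z => geodesicCoeff F z y i) x
    - ∑ j, y j * pd j (fun z => pd k (fun w => geodesicCoeff F z w i) y) x
    + 2 * ∑ j, geodesicCoeff F x y j *
        pd j (fun w => pd k (fun w' => geodesicCoeff F x w' i) w) y
    - ∑ j, pd j (fun w => geodesicCoeff F x w i) y * pd k (fun w => geodesicCoeff F x w j) y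

/-- The linear transformation `R_y` of the tangent space at `x`, applied to `v`. -/
def riemannMap (F : Eu n → Eu n → ℝ) (x y v : Eu n) : Eu n :=
  WithLp.toLp 2 fun i => ∑ k, riemannCoeff F x y i k * v k

/-- The flag curvature `K(y, v)` at `x`, for linearly independent `y` and `v`. -/
def flagCurvature (F : Eu n → Eu n → ℝ) (x y v : Eu n) : ℝ :=
  fundTensor (F x) y (riemannMap F x y v) v /
    (fundTensor (F x) y y y * fundTensor (F x) y v v - fundTensor (F x) y y v ^ 2)

/-- A simply connected, forward complete Finsler manifold of non-positive flag curvature. -/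
structure IsCartanHadamard (U : Set (Eu n)) (F : Eu n → Eu n → ℝ) : Prop where
  finsler : IsFinslerManifold U F
  simplyConnected : SimplyConnectedSpace U
  forwardComplete : ForwardComplete U F
  flagCurvature_nonpos : ∀ x ∈ U, ∀ y v, LinearIndependent ℝ ![y, v] → flagCurvature F x y v ≤ 0

/-- The flag curvature vanishes identically. -/
def IsFlat (U : Set (Eu n)) (F : Eu n → Eu n → ℝ) : Prop :=
  ∀ x ∈ U, ∀ y v, LinearIndependent ℝ ![y, v] → flagCurvature F x y v = 0

/-- An isometric embedding of `(U, F)` into the Minkowski space `(V, φ)`: an embedding of class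
`C¹` (in particular, any smooth one) that pulls `φ` back to `F`. The differential is automatically
injective when `F` is a Finsler metric. -/
structure IsIsometricEmbedding {V : Type*} [NormedAddCommGroup V] [NormedSpace ℝ V]
    (U : Set (Eu n)) (F : Eu n → Eu n → ℝ) (φ : V → ℝ) (f : Eu n → V) : Prop where
  contDiff : ContDiffOn ℝ 1 f U
  isEmbedding : IsEmbedding (fun x : U => f x)
  isometric : ∀ x ∈ U, ∀ y, φ (fderiv ℝ f x y) = F x y

/-! ### Distance, co-metric, gradient -/

/-- The distance `d_F(a,b)`: the infimum of the lengths `∫₀¹ F(ζ, ζ') dt` of the Lipschitz paths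
`ζ : [0,1] → U` from `a` to `b`. -/
def edist (U : Set (Eu n)) (F : Eu n → Eu n → ℝ) (a b : Eu n) : ℝ≥0∞ :=
  ⨅ (ζ : ℝ → Eu n) (_ : (∃ K, LipschitzOnWith K ζ (Set.Icc 0 1)) ∧
      Set.MapsTo ζ (Set.Icc 0 1) U ∧ ζ 0 = a ∧ ζ 1 = b),
    ∫⁻ t in Set.Icc (0 : ℝ) 1, ENNReal.ofReal (F (ζ t) (deriv ζ t))

/-- The co-metric `F*(x,η) = sup_{y ≠ 0} η(y) / F(x,y)`. The supremum is non-negative, so that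
negative quotients may be replaced by `0`. -/
def coMetric (F : Eu n → Eu n → ℝ) (x : Eu n) (η : Eu n →L[ℝ] ℝ) : ℝ≥0∞ :=
  ⨆ (y : Eu n) (_ : y ≠ 0), ENNReal.ofReal (η y / F x y)

/-- The Legendre transformation `y ↦ g_y(y, ·)` at `x`; it sends `0` to `0`. -/
def legendre (F : Eu n → Eu n → ℝ) (x y : Eu n) : Eu n →L[ℝ] ℝ :=
  fundTensor (F x) y y

/-- The Finsler gradient: the preimage of `df` under the Legendre transformation. -/
def gradient (F : Eu n → Eu n → ℝ) (f : Eu n → ℝ) (x : Eu n) : Eu n :=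
  Function.invFun (legendre F x) (fderiv ℝ f x)

/-! ### Function spaces over a domain with Lebesgue measure -/

/-- `f ∈ C₀^∞(U)`. -/
structure IsTestFunction (U : Set (Eu n)) (f : Eu n → ℝ) : Prop where
  smooth : ContDiff ℝ ∞ f
  hasCompactSupport : HasCompactSupport f
  tsupport_subset : tsupport f ⊆ U

/-- The locally integrable one-form `ξ` is the weak differential of `u` in `U`. -/
structure HasWeakDifferential (U : Set (Eu n)) (u : Eu n → ℝ) (ξ : Eu n → Eu n →L[ℝ] ℝ) :
    Prop where
  locallyIntegrable : LocallyIntegrableOn u U volume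
  locallyIntegrable_differential : LocallyIntegrableOn ξ U volume
  integral_eq : ∀ φ, IsTestFunction U φ → ∀ v,
    ∫ x in U, u x * fderiv ℝ φ x v = -∫ x in U, ξ x v * φ x

/-- The pseudo-norm `(∫ |u|^p)^{1/p} + (∫ F*(ξ)^p)^{1/p}` of a function `u` with differential `ξ`. -/
def sobolevNorm (U : Set (Eu n)) (F : Eu n → Eu n → ℝ) (p : ℝ)
    (u : Eu n → ℝ) (ξ : Eu n → Eu n →L[ℝ] ℝ) : ℝ≥0∞ :=
  (∫⁻ x in U, ‖u x‖ₑ ^ p) ^ (1 / p) + (∫⁻ x in U, coMetric F x (ξ x) ^ p) ^ (1 / p)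

/-- The Sobolev space `W₀^{1,p}(U, F, 𝓛ⁿ)`, a set of almost-everywhere classes of functions: the
closure of `C₀^∞(U)` in the sense that `‖u - u_k‖ → 0` for some test functions `u_k`. -/
def sobolevSpace (U : Set (Eu n)) (F : Eu n → Eu n → ℝ) (p : ℝ) :
    Set (Eu n →ₘ[volume.restrict U] ℝ) :=
  {u | ∃ ξ, HasWeakDifferential U u ξ ∧
    ∃ u_ : ℕ → Eu n → ℝ, (∀ k, IsTestFunction U (u_ k)) ∧
      Tendsto (fun k => sobolevNorm U F p (fun x => u x - u_ k x)
        (fun x => ξ x - fderiv ℝ (u_ k) x)) atTop (𝓝 0)}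

/-- The energy `∫_U F^p(∇f) dx`. -/
def energy (U : Set (Eu n)) (F : Eu n → Eu n → ℝ) (p : ℝ) (f : Eu n → ℝ) : ℝ≥0∞ :=
  ∫⁻ x in U, ENNReal.ofReal (F x (gradient F f x)) ^ p

/-- The weighted integral `∫_U |f|^p d_F(0,x)^q dx`. -/
def weighted (U : Set (Eu n)) (F : Eu n → Eu n → ℝ) (p q : ℝ) (f : Eu n → ℝ) : ℝ≥0∞ :=
  ∫⁻ x in U, ‖f x‖ₑ ^ p * edist U F 0 x ^ q

/-! ### Berwald's metric -/

/-- The open Euclidean unit ball. -/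
abbrev unitBall (n : ℕ) : Set (Eu n) := Metric.ball 0 1

/-- Berwald's metric on the unit ball (at `y = 0` the quotient `0 / 0` has the value `0`). -/
def berwald (n : ℕ) (x y : Eu n) : ℝ :=
  (√((1 - ‖x‖ ^ 2) * ‖y‖ ^ 2 + inner ℝ x y ^ 2) + inner ℝ x y) ^ 2 /
    ((1 - ‖x‖ ^ 2) ^ 2 * √((1 - ‖x‖ ^ 2) * ‖y‖ ^ 2 + inner ℝ x y ^ 2))

end Finsler

end

/-! Everything is read off the exit point `u` of the ray from `x` in the direction `y`. The Funk
metric `Θ` is defined by `x + y/Θ = u`, `|u| = 1`. With the gap `q = 1 - ⟨x,u⟩` one gets `y = Θ(u -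
x)`, `√disc = Θq` and `B = Θ/q`. Differentiating `|u|² = 1` gives Funk's equation `Θ_x = ΘΘ_y`,
where `Θ_y(v) = ⟨u,v⟩/q`, and hence Berwald's equation `B_x = (ΘB)_y`.

Geometry. The second derivative of `B` in `y` is nonnegative by Cauchy-Schwarz and degenerates at
most along `u - x`, where `B_y` does not vanish; so `B_y² + B B_yy` is positive definite. The two
equations give `Gⁱ = Θyⁱ` (`geodesicCoeff_berwald`). Substituting this in the curvature formula and
using Funk's equation, all terms cancel (`riemannCoeff_berwald`). A geodesic satisfies `γ'' =
-2Θγ'`; along it `u` is constant and `Θ' = -Θ²`, so `γ(t) = u + (γ(0) - u)/(1 + kt)`, which never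
leaves the ball in forward time.

Analysis. All four assertions rest on one asymmetry at the boundary. Moving outwards is expensive:
`⟨x,y⟩ ≤ (1-|x|²)² B(x,y)` (`inner_le_mul_berwald`). Moving inwards is cheap: `B(x,-x) =
|x|/(1+|x|)²` stays bounded. So the reversibility is infinite, whereas that of a Minkowski norm is
finite by compactness of the sphere, and a linear differential would transport the bound.

Equally, a function that increases outwards has a tiny differential in the co-metric. For (iii) and
(iv) take a cut-off that is `-1` inside and rises to `0` in a shell of width of order `ε`. Its slope
is of order `1/ε`, but the co-metric contributes `ε²`, so `B(∇f) ≤ 8Cε`. The denominators stay above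
the volume of a half ball. In (iv) the second factor grows at most like `1/ε`, because `r ≤ 2/ε` on
the support and `s ≤ 1`; the product is then controlled by the shell volume to the power `1/p`,
which tends to `0`.

For (ii) put `ρ = 1 - |x|²` and `α = 1 - 1/p`. The function `-ρ^α` increases outwards and is a limit
of smooth truncations. Its opposite `ρ^α` has a differential of co-metric size at least `αρ^(α-1)`
near the boundary; the `p`-th power is comparable to `1/ρ`, which is not integrable, and test
functions vanish near the boundary and cannot compensate. So the space is not closed under `u ↦ -u`.
-/

noncomputable section

namespace Finsler

variable {n : ℕ}

/-! ### The Funk metric of the unit ball -/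

/-- The quadratic form under the square root in Berwald's metric. -/
def disc (x y : Eu n) : ℝ := (1 - ‖x‖ ^ 2) * ‖y‖ ^ 2 + inner ℝ x y ^ 2

/-- The Funk metric of the unit ball. -/
def funk (x y : Eu n) : ℝ := (√(disc x y) + inner ℝ x y) / (1 - ‖x‖ ^ 2)

/-- The point where the ray from `x` in the direction `y` leaves the unit ball. -/
def exitPoint (x y : Eu n) : Eu n := x + (funk x y)⁻¹ • y

/-- The weight `1 - ⟨x, u⟩` of the exit point `u`. -/
def exitGap (x y : Eu n) : ℝ := 1 - inner ℝ x (exitPoint x y)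

lemma berwald_eq_disc (x y : Eu n) :
    berwald n x y = (√(disc x y) + inner ℝ x y) ^ 2 / ((1 - ‖x‖ ^ 2) ^ 2 * √(disc x y)) := rfl

lemma one_sub_norm_sq_pos {x : Eu n} (hx : ‖x‖ < 1) : 0 < 1 - ‖x‖ ^ 2 := by
  nlinarith [norm_nonneg x]

lemma disc_pos {x y : Eu n} (hx : ‖x‖ < 1) (hy : y ≠ 0) : 0 < disc x y := by
  have h1 := one_sub_norm_sq_pos hx
  have h2 : 0 < ‖y‖ := norm_pos_iff.2 hy
  unfold disc; positivity

lemma abs_inner_lt_sqrt_disc {x y : Eu n} (hx : ‖x‖ < 1) (hy : y ≠ 0) :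
    |(inner ℝ x y : ℝ)| < √(disc x y) := by
  apply Real.lt_sqrt_of_sq_lt
  rw [sq_abs]
  have h1 := one_sub_norm_sq_pos hx
  have h2 : 0 < ‖y‖ := norm_pos_iff.2 hy
  unfold disc
  have : 0 < (1 - ‖x‖ ^ 2) * ‖y‖ ^ 2 := by positivity
  linarith

lemma funk_pos {x y : Eu n} (hx : ‖x‖ < 1) (hy : y ≠ 0) : 0 < funk x y :=
  div_pos (by linarith [(abs_lt.1 (abs_inner_lt_sqrt_disc hx hy)).1]) (one_sub_norm_sq_pos hx)

@[simp] lemma funk_zero_right (x : Eu n) : funk x 0 = 0 := by simp [funk, disc]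

lemma sqrt_disc_eq {x : Eu n} (hx : ‖x‖ < 1) (y : Eu n) :
    √(disc x y) = (1 - ‖x‖ ^ 2) * funk x y - inner ℝ x y := by
  have h1 := one_sub_norm_sq_pos hx
  unfold funk; field_simp; ring

/-- This is `|x + y/Θ|² = 1` with denominators cleared, in a form that also makes sense at `y = 0`.
-/
lemma funk_quadratic {x : Eu n} (hx : ‖x‖ < 1) (y : Eu n) :
    (1 - ‖x‖ ^ 2) * funk x y ^ 2 - 2 * inner ℝ x y * funk x y - ‖y‖ ^ 2 = 0 := by
  have h1 := one_sub_norm_sq_pos hx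
  have hD : 0 ≤ disc x y := by unfold disc; positivity
  have h2 := Real.sq_sqrt hD
  rw [sqrt_disc_eq hx] at h2
  have h3 : (1 - ‖x‖ ^ 2) *
      ((1 - ‖x‖ ^ 2) * funk x y ^ 2 - 2 * inner ℝ x y * funk x y - ‖y‖ ^ 2) = 0 := by
    unfold disc at h2; linear_combination h2
  exact (mul_eq_zero.1 h3).resolve_left h1.ne'

lemma disc_smul (x y : Eu n) (t : ℝ) : disc x (t • y) = t ^ 2 * disc x y := by
  simp only [disc, norm_smul, inner_smul_right, mul_pow, Real.norm_eq_abs, sq_abs]; ring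

lemma funk_smul (x y : Eu n) {t : ℝ} (ht : 0 ≤ t) : funk x (t • y) = t * funk x y := by
  simp only [funk, disc_smul, inner_smul_right]
  rw [Real.sqrt_mul (sq_nonneg t), Real.sqrt_sq ht]; ring

lemma exitPoint_smul (x y : Eu n) {t : ℝ} (ht : 0 < t) : exitPoint x (t • y) = exitPoint x y := by
  simp only [exitPoint, funk_smul x y ht.le, smul_smul]
  congr 2
  field_simp

lemma smul_exitPoint_sub {x y : Eu n} (hx : ‖x‖ < 1) (hy : y ≠ 0) :
    y = funk x y • (exitPoint x y - x) := by
  have := (funk_pos hx hy).ne'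
  simp [exitPoint, smul_smul, this]

lemma norm_exitPoint {x y : Eu n} (hx : ‖x‖ < 1) (hy : y ≠ 0) : ‖exitPoint x y‖ = 1 := by
  have h0 := funk_pos hx hy
  have h := funk_quadratic hx y
  have : ‖exitPoint x y‖ ^ 2 = 1 := by
    rw [exitPoint, norm_add_sq_real, inner_smul_right, norm_smul, norm_inv, Real.norm_eq_abs,
      abs_of_pos h0]
    field_simp
    linarith
  nlinarith [norm_nonneg (exitPoint x y)]

lemma exitGap_pos {x y : Eu n} (hx : ‖x‖ < 1) (hy : y ≠ 0) : 0 < exitGap x y := by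
  have := real_inner_le_norm x (exitPoint x y)
  rw [norm_exitPoint hx hy] at this
  unfold exitGap; linarith

/-- Take the inner product of `x` with `y = Θ(u - x)` in the formula for the root. Square roots
disappear from later computations through this identity. -/
lemma sqrt_disc_eq_mul {x y : Eu n} (hx : ‖x‖ < 1) (hy : y ≠ 0) :
    √(disc x y) = funk x y * exitGap x y := by
  have h0 := funk_pos hx hy
  rw [sqrt_disc_eq hx, exitGap, exitPoint, inner_add_right, inner_smul_right,
    real_inner_self_eq_norm_sq]
  field_simp; ring

/-- The working form of the metric: a quotient of two quantities whose derivatives are simple in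
terms of the exit point. -/
lemma berwald_eq {x y : Eu n} (hx : ‖x‖ < 1) (hy : y ≠ 0) :
    berwald n x y = funk x y / exitGap x y := by
  have h0 := funk_pos hx hy
  have h1 := one_sub_norm_sq_pos hx
  have h2 := exitGap_pos hx hy
  have h3 : √(disc x y) + inner ℝ x y = (1 - ‖x‖ ^ 2) * funk x y := by
    rw [sqrt_disc_eq hx]; ring
  rw [berwald_eq_disc, h3, sqrt_disc_eq_mul hx hy]
  field_simp

@[simp] lemma berwald_zero_right (x : Eu n) : berwald n x 0 = 0 := by simp [berwald]

lemma berwald_pos {x y : Eu n} (hx : ‖x‖ < 1) (hy : y ≠ 0) : 0 < berwald n x y := by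
  rw [berwald_eq hx hy]; exact div_pos (funk_pos hx hy) (exitGap_pos hx hy)

lemma berwald_smul (x y : Eu n) {t : ℝ} (ht : 0 ≤ t) :
    berwald n x (t • y) = t * berwald n x y := by
  simp only [berwald_eq_disc, disc_smul, inner_smul_right]
  rw [Real.sqrt_mul (sq_nonneg t), Real.sqrt_sq ht]
  rcases ht.eq_or_lt with rfl | ht
  · simp
  rw [← mul_add, mul_pow, sq t, mul_assoc, mul_left_comm (_ ^ 2) t, mul_div_mul_left _ _ ht.ne',
    mul_div_assoc]

/-! ### Smoothness -/

lemma contDiff_disc : ContDiff ℝ ∞ (fun z : Eu n × Eu n => disc z.1 z.2) := by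
  unfold disc
  have h1 : ContDiff ℝ ∞ (fun z : Eu n × Eu n => ‖z.1‖ ^ 2) := contDiff_fst.norm_sq ℝ
  have h2 : ContDiff ℝ ∞ (fun z : Eu n × Eu n => ‖z.2‖ ^ 2) := contDiff_snd.norm_sq ℝ
  have h3 : ContDiff ℝ ∞ (fun z : Eu n × Eu n => (inner ℝ z.1 z.2 : ℝ)) :=
    contDiff_fst.inner ℝ contDiff_snd
  exact ((contDiff_const.sub h1).mul h2).add (h3.pow 2)

lemma contDiffAt_sqrt_disc {x y : Eu n} (hx : ‖x‖ < 1) (hy : y ≠ 0) :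
    ContDiffAt ℝ ∞ (fun z : Eu n × Eu n => √(disc z.1 z.2)) (x, y) :=
  contDiff_disc.contDiffAt.sqrt (disc_pos hx hy).ne'

lemma contDiffAt_funk {x y : Eu n} (hx : ‖x‖ < 1) (hy : y ≠ 0) :
    ContDiffAt ℝ ∞ (fun z : Eu n × Eu n => funk z.1 z.2) (x, y) := by
  have h1 : ContDiff ℝ ∞ (fun z : Eu n × Eu n => ‖z.1‖ ^ 2) := contDiff_fst.norm_sq ℝ
  have h3 : ContDiff ℝ ∞ (fun z : Eu n × Eu n => (inner ℝ z.1 z.2 : ℝ)) :=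
    contDiff_fst.inner ℝ contDiff_snd
  exact ((contDiffAt_sqrt_disc hx hy).add h3.contDiffAt).div
    (contDiffAt_const.sub h1.contDiffAt) (one_sub_norm_sq_pos hx).ne'

lemma contDiffAt_berwald {x y : Eu n} (hx : ‖x‖ < 1) (hy : y ≠ 0) :
    ContDiffAt ℝ ∞ (fun z : Eu n × Eu n => berwald n z.1 z.2) (x, y) := by
  have h1 : ContDiff ℝ ∞ (fun z : Eu n × Eu n => ‖z.1‖ ^ 2) := contDiff_fst.norm_sq ℝ
  have h3 : ContDiff ℝ ∞ (fun z : Eu n × Eu n => (inner ℝ z.1 z.2 : ℝ)) :=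
    contDiff_fst.inner ℝ contDiff_snd
  have h4 := contDiffAt_sqrt_disc hx hy
  refine ((h4.add h3.contDiffAt).pow 2).div
    (((contDiffAt_const.sub h1.contDiffAt).pow 2).mul h4) ?_
  have := one_sub_norm_sq_pos hx
  have := Real.sqrt_pos.2 (disc_pos hx hy)
  positivity

lemma continuousOn_funk :
    ContinuousOn (fun z : Eu n × Eu n => funk z.1 z.2) (unitBall n ×ˢ Set.univ) := by
  unfold funk
  refine ContinuousOn.div (Continuous.continuousOn ?_) (Continuous.continuousOn ?_) ?_
  · exact (Real.continuous_sqrt.comp contDiff_disc.continuous).add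
      (continuous_fst.inner continuous_snd)
  · fun_prop
  · rintro ⟨x, y⟩ ⟨hx, -⟩
    exact (one_sub_norm_sq_pos (mem_ball_zero_iff.1 hx)).ne'

/-! ### Derivatives along curves -/

section Curves

variable {x y : ℝ → Eu n} {x' y' : Eu n} {s : Set ℝ} {t : ℝ}

/-- The variations of `x` and `y` enter only through `y' + Θx'`, which is Funk's equation `Θ_x =
ΘΘ_y`. Conceptually it is the derivative of `|x + y/Θ|² = 1`; the proof differentiates the explicit
formula and then eliminates `|y|²` and `⟨x,y⟩`. -/
lemma hasDerivWithinAt_funk (hx : ‖x t‖ < 1) (hy : y t ≠ 0)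
    (dx : HasDerivWithinAt x x' s t) (dy : HasDerivWithinAt y y' s t) :
    HasDerivWithinAt (fun τ => funk (x τ) (y τ))
      (inner ℝ (exitPoint (x t) (y t)) (y' + funk (x t) (y t) • x') / exitGap (x t) (y t)) s t := by
  have hT := funk_pos hx hy
  have hq := exitGap_pos hx hy
  have ha := sqrt_disc_eq_mul hx hy
  have ha' := sqrt_disc_eq hx (y t)
  have hquad := funk_quadratic hx (y t)
  have hc := one_sub_norm_sq_pos hx
  have d1 := dx.norm_sq
  have d2 := dy.norm_sq
  have d3 := dx.inner ℝ dy
  have dD : HasDerivWithinAt (fun τ => disc (x τ) (y τ)) _ s t :=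
    ((d1.const_sub 1).mul d2).add (d3.pow 2)
  have dF := ((dD.sqrt (disc_pos hx hy).ne').add d3).div (d1.const_sub 1) hc.ne'
  refine dF.congr_deriv ?_
  have e1 : (inner ℝ (exitPoint (x t) (y t)) (y' + funk (x t) (y t) • x') : ℝ) *
      funk (x t) (y t) = inner ℝ (y t) y' + funk (x t) (y t) * (inner ℝ (x t) y' + inner ℝ x' (y t))
        + funk (x t) (y t) ^ 2 * inner ℝ (x t) x' := by
    simp only [exitPoint, inner_add_left, inner_add_right, inner_smul_left, inner_smul_right,
      real_inner_comm x' (y t), RCLike.conj_to_real]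
    field_simp
    ring
  have e2 : (inner ℝ (exitPoint (x t) (y t)) (y' + funk (x t) (y t) • x') : ℝ) /
      exitGap (x t) (y t) = (inner ℝ (y t) y' + funk (x t) (y t) *
        (inner ℝ (x t) y' + inner ℝ x' (y t)) + funk (x t) (y t) ^ 2 * inner ℝ (x t) x') /
          √(disc (x t) (y t)) := by
    rw [← e1, ha]; field_simp
  have hapos := Real.sqrt_pos.2 (disc_pos hx hy)
  rw [e2]
  have hy2 : ‖y t‖ ^ 2 = (1 - ‖x t‖ ^ 2) * funk (x t) (y t) ^ 2
      - 2 * inner ℝ (x t) (y t) * funk (x t) (y t) := by linarith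
  have hw : √(disc (x t) (y t)) + inner ℝ (x t) (y t) = (1 - ‖x t‖ ^ 2) * funk (x t) (y t) := by
    rw [ha']; ring
  simp only [Pi.add_apply]
  rw [hw, hy2]
  have hi : (inner ℝ (x t) (y t) : ℝ) = (1 - ‖x t‖ ^ 2) * funk (x t) (y t) - √(disc (x t) (y t)) := by
    linarith
  rw [hi]
  field_simp
  ring

/-- Up to the factor `1/Θ`, this is the projection of `y' + Θx'` to the tangent space of the sphere
at `u` along the ray direction `u - x`. -/
lemma hasDerivWithinAt_exitPoint (hx : ‖x t‖ < 1) (hy : y t ≠ 0)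
    (dx : HasDerivWithinAt x x' s t) (dy : HasDerivWithinAt y y' s t) :
    HasDerivWithinAt (fun τ => exitPoint (x τ) (y τ))
      ((funk (x t) (y t))⁻¹ • (y' + funk (x t) (y t) • x' -
        (inner ℝ (exitPoint (x t) (y t)) (y' + funk (x t) (y t) • x') / exitGap (x t) (y t)) •
          (exitPoint (x t) (y t) - x t))) s t := by
  have hT := funk_pos hx hy
  have d := dx.add (((hasDerivWithinAt_funk hx hy dx dy).inv hT.ne').smul dy)
  refine d.congr_deriv ?_
  have e : exitPoint (x t) (y t) - x t = (funk (x t) (y t))⁻¹ • y t := by simp [exitPoint]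
  rw [e]
  generalize (inner ℝ (exitPoint (x t) (y t)) (y' + funk (x t) (y t) • x') : ℝ) /
    exitGap (x t) (y t) = r
  simp only [Pi.inv_apply]
  match_scalars <;> field_simp

lemma hasDerivWithinAt_exitGap (hx : ‖x t‖ < 1) (hy : y t ≠ 0)
    (dx : HasDerivWithinAt x x' s t) (dy : HasDerivWithinAt y y' s t) :
    HasDerivWithinAt (fun τ => exitGap (x τ) (y τ))
      (-(inner ℝ x' (exitPoint (x t) (y t)) + (funk (x t) (y t))⁻¹ *
        (inner ℝ (x t) y' + funk (x t) (y t) * inner ℝ (x t) x' -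
        (inner ℝ (exitPoint (x t) (y t)) (y' + funk (x t) (y t) • x') / exitGap (x t) (y t)) *
          (1 - exitGap (x t) (y t) - ‖x t‖ ^ 2)))) s t := by
  have d := (dx.inner ℝ (hasDerivWithinAt_exitPoint hx hy dx dy)).const_sub 1
  refine d.congr_deriv ?_
  rw [inner_smul_right, inner_sub_right, inner_smul_right (x t), inner_add_right (x t), inner_smul_right (x t),
    inner_sub_right (x t), real_inner_self_eq_norm_sq]
  have : (inner ℝ (x t) (exitPoint (x t) (y t)) : ℝ) = 1 - exitGap (x t) (y t) := by
    unfold exitGap; ring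
  rw [this]; ring

end Curves

/-! ### Generalities on Minkowski norms -/

section General

variable {V W : Type*} [NormedAddCommGroup V] [NormedSpace ℝ V] [NormedAddCommGroup W]
  [NormedSpace ℝ W]

lemma hasDerivAt_line (y v : V) (t : ℝ) : HasDerivAt (fun t : ℝ => y + t • v) v t := by
  simpa using ((hasDerivAt_id t).smul_const v).const_add y

lemma fderiv_apply_eq_of_hasDerivAt_line {f : V → W} {y v : V} {d : W}
    (hf : DifferentiableAt ℝ f y) (h : HasDerivAt (fun t : ℝ => f (y + t • v)) d 0) :
    fderiv ℝ f y v = d := by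
  have h1 : HasFDerivAt f (fderiv ℝ f y) (y + (0 : ℝ) • v) := by simpa using hf.hasFDerivAt
  exact (h1.comp_hasDerivAt 0 (hasDerivAt_line y v 0)).unique h

lemma eventually_line_ne_zero {y : V} (hy : y ≠ 0) (v : V) :
    ∀ᶠ t : ℝ in 𝓝 0, y + t • v ≠ 0 := by
  have : Continuous fun t : ℝ => y + t • v := by fun_prop
  exact this.continuousAt.eventually_ne (by simpa using hy)

namespace IsMinkowskiNorm

variable {φ : V → ℝ} {y : V}

lemma contDiffAt (h : IsMinkowskiNorm φ) (hy : y ≠ 0) : ContDiffAt ℝ ∞ φ y :=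
  h.smooth.contDiffAt (isOpen_compl_singleton.mem_nhds hy)

lemma pos (h : IsMinkowskiNorm φ) (hy : y ≠ 0) : 0 < φ y :=
  (h.nonneg y).lt_of_ne fun h0 => hy ((h.eq_zero_iff y).1 h0.symm)

end IsMinkowskiNorm

lemma fundTensor_apply (φ : V → ℝ) (y v w : V) :
    fundTensor φ y v w = 1 / 2 * fderiv ℝ (fderiv ℝ (fun w => φ w ^ 2)) y v w := rfl

lemma fundTensor_symm {φ : V → ℝ} {y : V} (h : ContDiffAt ℝ ∞ (fun w => φ w ^ 2) y) (v w : V) :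
    fundTensor φ y v w = fundTensor φ y w v := by
  have := h.isSymmSndFDerivAt
    (by rw [minSmoothness_of_isRCLikeNormedField]; exact WithTop.coe_le_coe.2 le_top) v w
  rw [fundTensor_apply, fundTensor_apply, this]

lemma fderiv_fderiv_apply_eq_of_hasDerivAt {f : V → ℝ} {y v w : V} {d : ℝ}
    (h : ContDiffAt ℝ ∞ f y) (hd : HasDerivAt (fun t : ℝ => fderiv ℝ f (y + t • v) w) d 0) :
    fderiv ℝ (fderiv ℝ f) y v w = d := by
  have h1 : ContDiffAt ℝ ∞ (fderiv ℝ f) y := h.fderiv_right (by simp)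
  have h2 : DifferentiableAt ℝ (fderiv ℝ f) y := h1.differentiableAt (by simp)
  have h3 : DifferentiableAt ℝ (fun z => fderiv ℝ f z w) y :=
    h2.clm_apply (differentiableAt_const w)
  rw [← fderiv_apply_eq_of_hasDerivAt_line h3 hd, fderiv_clm_apply h2 (differentiableAt_const w)]
  simp

lemma fundTensor_apply_eq_of_hasDerivAt {φ : V → ℝ} {y v w : V} {d : ℝ}
    (h : ContDiffAt ℝ ∞ (fun w => φ w ^ 2) y)
    (hd : HasDerivAt (fun t : ℝ => fderiv ℝ (fun w => φ w ^ 2) (y + t • v) w) d 0) :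
    fundTensor φ y v w = d / 2 := by
  rw [fundTensor_apply, fderiv_fderiv_apply_eq_of_hasDerivAt h hd]; ring

lemma fderiv_sq_apply {φ : V → ℝ} {y : V} (h : DifferentiableAt ℝ φ y) (v : V) :
    fderiv ℝ (fun w => φ w ^ 2) y v = 2 * φ y * fderiv ℝ φ y v := by
  rw [(h.hasFDerivAt.pow 2).fderiv]; simp

/-- Euler's theorem for the degree-one derivative of `φ²`. -/
lemma fundTensor_self {φ : V → ℝ} {y : V} (h : ContDiffAt ℝ ∞ φ y)
    (hom : ∀ (c : ℝ) (w : V), 0 < c → φ (c • w) = c * φ w) (v : V) :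
    fundTensor φ y y v = φ y * fderiv ℝ φ y v := by
  have key : ∀ c : ℝ, 0 < c → fderiv ℝ (fun w => φ w ^ 2) (c • y) v =
      c * fderiv ℝ (fun w => φ w ^ 2) y v := by
    intro c hc
    have h1 := fderiv_comp_smul (𝕜 := ℝ) (f := fun w => φ w ^ 2) (x := y) c
    have h2 : (fun w => φ (c • w) ^ 2) = fun w => c ^ 2 • φ w ^ 2 := by
      ext w; rw [hom c w hc, mul_pow, smul_eq_mul]
    rw [h2, fderiv_fun_const_smul ((h.pow 2).differentiableAt (by simp))] at h1
    have h3 := congrArg (fun L => L v) h1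
    simp only [smul_apply, smul_eq_mul] at h3
    have : c * (c * fderiv ℝ (fun w => φ w ^ 2) y v) =
      c * fderiv ℝ (fun w => φ w ^ 2) (c • y) v := by rw [← h3]; ring
    exact (mul_left_cancel₀ hc.ne' this).symm
  have hd : HasDerivAt (fun t : ℝ => fderiv ℝ (fun w => φ w ^ 2) (y + t • y) v)
      (fderiv ℝ (fun w => φ w ^ 2) y v) 0 := by
    have h1 : HasDerivAt (fun t : ℝ => (1 + t) * fderiv ℝ (fun w => φ w ^ 2) y v)
      (fderiv ℝ (fun w => φ w ^ 2) y v) 0 := by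
      simpa using ((hasDerivAt_id (0 : ℝ)).const_add 1).mul_const
        (fderiv ℝ (fun w => φ w ^ 2) y v)
    refine h1.congr_of_eventuallyEq ?_
    filter_upwards [eventually_gt_nhds (show (-1 : ℝ) < 0 by norm_num)] with t ht
    rw [← key (1 + t) (by linarith), add_smul, one_smul]
  rw [fundTensor_apply_eq_of_hasDerivAt (h.pow 2) hd,
    fderiv_sq_apply (h.differentiableAt (by simp))]
  ring

lemma fderiv_self_of_homogeneous {φ : V → ℝ} {y : V} (h : DifferentiableAt ℝ φ y)
    (hom : ∀ (c : ℝ) (w : V), 0 < c → φ (c • w) = c * φ w) : fderiv ℝ φ y y = φ y := by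
  apply fderiv_apply_eq_of_hasDerivAt_line h
  have h1 : HasDerivAt (fun t : ℝ => (1 + t) * φ y) (φ y) 0 := by
    simpa using ((hasDerivAt_id (0 : ℝ)).const_add 1).mul_const (φ y)
  refine h1.congr_of_eventuallyEq ?_
  filter_upwards [eventually_gt_nhds (show (-1 : ℝ) < 0 by norm_num)] with t ht
  rw [← hom (1 + t) _ (by linarith), add_smul, one_smul]

end General

/-! ### Berwald's metric is a Finsler metric -/

/-- The derivative of Berwald's metric `B(x, ·)` at `y` in the direction `v`. -/
def berwaldDeriv (x y v : Eu n) : ℝ :=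
  (2 * inner ℝ (exitPoint x y) v + inner ℝ x v) / exitGap x y ^ 2 -
    (1 - ‖x‖ ^ 2) * inner ℝ (exitPoint x y) v / exitGap x y ^ 3

/-- Quotient rule for `B = Θ/q`. In the base direction it reads `B_x = ΘB_y + Θ_y B = (ΘB)_y`, the
equation that makes the metric projectively flat. -/
lemma hasDerivWithinAt_berwald {x y : ℝ → Eu n} {x' y' : Eu n} {s : Set ℝ} {t : ℝ}
    (hx : ‖x t‖ < 1) (hy : y t ≠ 0)
    (dx : HasDerivWithinAt x x' s t) (dy : HasDerivWithinAt y y' s t) :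
    HasDerivWithinAt (fun τ => berwald n (x τ) (y τ))
      (berwaldDeriv (x t) (y t) (y' + funk (x t) (y t) • x') +
        inner ℝ (exitPoint (x t) (y t)) x' / exitGap (x t) (y t) * berwald n (x t) (y t)) s t := by
  have hq := exitGap_pos hx hy
  have hT := funk_pos hx hy
  have d := (hasDerivWithinAt_funk hx hy dx dy).div (hasDerivWithinAt_exitGap hx hy dx dy) hq.ne'
  have hnx : ∀ᶠ τ in 𝓝[s] t, ‖x τ‖ < 1 :=
    dx.continuousWithinAt.norm.eventually (eventually_lt_nhds hx)
  have hny : ∀ᶠ τ in 𝓝[s] t, y τ ≠ 0 := dy.continuousWithinAt.eventually_ne hy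
  have d' := d.congr_of_eventuallyEq (f₁ := fun τ => berwald n (x τ) (y τ))
    (by filter_upwards [hnx, hny] with τ h1 h2 using berwald_eq h1 h2) (berwald_eq hx hy)
  refine d'.congr_deriv ?_
  rw [berwald_eq hx hy, berwaldDeriv]
  rw [inner_add_right, inner_smul_right, inner_add_right, inner_smul_right,
    real_inner_comm (exitPoint (x t) (y t)) x']
  field_simp
  ring

lemma hasDerivAt_berwald {x y : ℝ → Eu n} {x' y' : Eu n} {t : ℝ}
    (hx : ‖x t‖ < 1) (hy : y t ≠ 0) (dx : HasDerivAt x x' t) (dy : HasDerivAt y y' t) :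
    HasDerivAt (fun τ => berwald n (x τ) (y τ))
      (berwaldDeriv (x t) (y t) (y' + funk (x t) (y t) • x') +
        inner ℝ (exitPoint (x t) (y t)) x' / exitGap (x t) (y t) * berwald n (x t) (y t)) t := by
  rw [← hasDerivWithinAt_univ] at *
  exact hasDerivWithinAt_berwald hx hy dx dy

lemma contDiffAt_berwald_right {x y : Eu n} (hx : ‖x‖ < 1) (hy : y ≠ 0) :
    ContDiffAt ℝ ∞ (berwald n x) y :=
  (contDiffAt_berwald hx hy).comp y (contDiffAt_const.prodMk contDiffAt_id)

lemma differentiableAt_berwald_right {x y : Eu n} (hx : ‖x‖ < 1) (hy : y ≠ 0) :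
    DifferentiableAt ℝ (berwald n x) y :=
  (contDiffAt_berwald_right hx hy).differentiableAt (by simp)

lemma fderiv_berwald_right {x y : Eu n} (hx : ‖x‖ < 1) (hy : y ≠ 0) (v : Eu n) :
    fderiv ℝ (berwald n x) y v = berwaldDeriv x y v := by
  apply fderiv_apply_eq_of_hasDerivAt_line (differentiableAt_berwald_right hx hy)
  have := hasDerivAt_berwald (x := fun _ => x) (y := fun t : ℝ => y + t • v) (t := 0) hx
    (by simpa using hy) (hasDerivAt_const _ _) (hasDerivAt_line y v 0)
  simpa using this

/-- The second fibre derivative of `B`, arranged with `T = ⟨u,v⟩/q` as a difference to which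
Cauchy-Schwarz applies, plus a square. -/
lemma hasDerivAt_berwaldDeriv_line {x y : Eu n} (hx : ‖x‖ < 1) (hy : y ≠ 0) (v : Eu n) :
    HasDerivAt (fun t : ℝ => berwaldDeriv x (y + t • v) v)
      ((‖exitPoint x y - x‖ ^ 2 * (‖v + (inner ℝ (exitPoint x y) v / exitGap x y) • x‖ ^ 2 -
          (inner ℝ (exitPoint x y) v / exitGap x y) ^ 2) +
        2 * (inner ℝ x v - (1 - ‖x‖ ^ 2 - exitGap x y) *
          (inner ℝ (exitPoint x y) v / exitGap x y)) ^ 2) / (funk x y * exitGap x y ^ 3)) 0 := by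
  have hy' : y + (0 : ℝ) • v ≠ 0 := by simpa using hy
  have hq := exitGap_pos hx hy
  have hT := funk_pos hx hy
  have du := (hasDerivWithinAt_exitPoint (x := fun _ => x) hx hy' (hasDerivWithinAt_const _ _ _)
    (hasDerivAt_line y v 0).hasDerivWithinAt).hasDerivAt univ_mem
  have dq := (hasDerivWithinAt_exitGap (x := fun _ => x) hx hy' (hasDerivWithinAt_const _ _ _)
    (hasDerivAt_line y v 0).hasDerivWithinAt).hasDerivAt univ_mem
  have dm := du.inner ℝ (hasDerivAt_const 0 v)
  have hq' : exitGap x (y + (0 : ℝ) • v) ≠ 0 := by simpa using hq.ne'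
  have d := (((dm.const_mul 2).add_const (inner ℝ x v)).div (dq.pow 2) (pow_ne_zero 2 hq')).sub
    ((dm.const_mul (1 - ‖x‖ ^ 2)).div (dq.pow 3) (pow_ne_zero 3 hq'))
  refine d.congr_deriv ?_
  -- Uses `|u| = 1`; it turns the factor `2q - (1-|x|²)` produced by the quotient rule into a
  -- squared norm.
  have e : ‖exitPoint x y - x‖ ^ 2 = 2 * exitGap x y - (1 - ‖x‖ ^ 2) := by
    rw [norm_sub_sq_real, norm_exitPoint hx hy, exitGap, real_inner_comm]; ring
  rw [e, norm_add_sq_real, inner_smul_right, norm_smul, mul_pow, Real.norm_eq_abs, sq_abs]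
  simp only [zero_smul, add_zero, smul_zero, inner_zero_right, inner_zero_left, mul_zero,
    inner_smul_left, inner_sub_left, real_inner_self_eq_norm_sq, zero_add, real_inner_comm x v,
    RCLike.conj_to_real, Pi.pow_apply]
  field_simp
  ring

/-- The form is `B_y(v)² + B B_yy(v,v)`. Strict Cauchy-Schwarz makes the second term positive; in
the equality case `v` is radial and the first term is positive. -/
lemma fundTensor_berwald_pos {x y v : Eu n} (hx : ‖x‖ < 1) (hy : y ≠ 0) (hv : v ≠ 0) :
    0 < fundTensor (berwald n x) y v v := by
  have hq := exitGap_pos hx hy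
  have hT := funk_pos hx hy
  have hd : HasDerivAt (fun t : ℝ => fderiv ℝ (fun w => berwald n x w ^ 2) (y + t • v) v)
      (2 * (berwaldDeriv x y v * berwaldDeriv x y v + berwald n x y *
        ((‖exitPoint x y - x‖ ^ 2 * (‖v + (inner ℝ (exitPoint x y) v / exitGap x y) • x‖ ^ 2 -
          (inner ℝ (exitPoint x y) v / exitGap x y) ^ 2) +
        2 * (inner ℝ x v - (1 - ‖x‖ ^ 2 - exitGap x y) *
          (inner ℝ (exitPoint x y) v / exitGap x y)) ^ 2) / (funk x y * exitGap x y ^ 3)))) 0 := by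
    have d1 := hasDerivAt_berwald (x := fun _ => x) (y := fun t : ℝ => y + t • v) (t := 0) hx
      (by simpa using hy) (hasDerivAt_const _ _) (hasDerivAt_line y v 0)
    have d := (d1.mul (hasDerivAt_berwaldDeriv_line hx hy v)).const_mul 2
    refine (d.congr_of_eventuallyEq ?_).congr_deriv ?_
    · filter_upwards [eventually_line_ne_zero hy v] with t ht
      rw [fderiv_sq_apply (differentiableAt_berwald_right hx ht), fderiv_berwald_right hx ht]
      simp only [Pi.mul_apply]; ring
    · simp
  rw [fundTensor_apply_eq_of_hasDerivAt ((contDiffAt_berwald_right hx hy).pow 2) hd]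
  have hF := berwald_pos hx hy
  set u := exitPoint x y with hu
  have hun : ‖u‖ = 1 := norm_exitPoint hx hy
  set T := inner ℝ u v / exitGap x y with hTd
  have hm : inner ℝ u v = T * exitGap x y := by rw [hTd]; field_simp
  -- By `⟨u,v⟩ = Tq` and `⟨u,x⟩ = 1 - q`. As `|u| = 1`, Cauchy-Schwarz then gives `T² ≤ |v + Tx|²`.
  have hin : inner ℝ u (v + T • x) = T := by
    rw [inner_add_right, inner_smul_right, hm, exitGap, real_inner_comm x]; ring
  have hux : 0 < ‖u - x‖ ^ 2 := by
    have : u - x ≠ 0 := by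
      intro h; rw [sub_eq_zero.1 h] at hun; linarith
    have := norm_pos_iff.2 this
    positivity
  have hle : T ^ 2 ≤ ‖v + T • x‖ ^ 2 := by
    have := abs_real_inner_le_norm u (v + T • x)
    rw [hin, hun, one_mul] at this
    exact sq_le_sq' (by linarith [neg_abs_le T]) (by linarith [le_abs_self T])
  have hden : 0 < funk x y * exitGap x y ^ 3 := by positivity
  rcases hle.lt_or_eq with hlt | heq
  · have h1 : 0 < ‖u - x‖ ^ 2 * (‖v + T • x‖ ^ 2 - T ^ 2) := mul_pos hux (by linarith)
    have : 0 < (‖u - x‖ ^ 2 * (‖v + T • x‖ ^ 2 - T ^ 2) +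
      2 * (inner ℝ x v - (1 - ‖x‖ ^ 2 - exitGap x y) * T) ^ 2) / (funk x y * exitGap x y ^ 3) := by
      positivity
    have := mul_pos hF this
    nlinarith [mul_self_nonneg (berwaldDeriv x y v)]
  -- Equality in Cauchy-Schwarz with a unit vector forces `v + Tx = Tu`.
  · have hvT : v = T • (u - x) := by
      have : ‖v + T • x - T • u‖ ^ 2 = 0 := by
        rw [norm_sub_sq_real, inner_smul_right, real_inner_comm, hin, norm_smul, hun, ← heq,
          mul_one, Real.norm_eq_abs, sq_abs]; ring
      have := norm_eq_zero.1 (pow_eq_zero_iff (two_ne_zero) |>.1 this)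
      rw [smul_sub, ← sub_eq_zero, ← this]; abel
    have hT0 : T ≠ 0 := by rintro h; rw [h, zero_smul] at hvT; exact hv hvT
    have hk : inner ℝ x v = T * (1 - ‖x‖ ^ 2 - exitGap x y) := by
      conv_lhs => rw [hvT]
      rw [inner_smul_right, inner_sub_right, real_inner_self_eq_norm_sq, exitGap]; ring
    have hB : berwaldDeriv x y v = T / exitGap x y := by
      rw [berwaldDeriv, ← hu, hm, hk]; field_simp; ring
    have h1 : 0 < berwaldDeriv x y v * berwaldDeriv x y v := by
      rw [hB]; exact mul_self_pos.2 (div_ne_zero hT0 hq.ne')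
    have : 0 ≤ (‖u - x‖ ^ 2 * (‖v + T • x‖ ^ 2 - T ^ 2) +
      2 * (inner ℝ x v - (1 - ‖x‖ ^ 2 - exitGap x y) * T) ^ 2) / (funk x y * exitGap x y ^ 3) := by
      have : 0 ≤ ‖v + T • x‖ ^ 2 - T ^ 2 := by linarith
      positivity
    have := mul_nonneg hF.le this
    linarith

lemma isMinkowskiNorm_berwald {x : Eu n} (hx : ‖x‖ < 1) : IsMinkowskiNorm (berwald n x) where
  nonneg y := by
    rcases eq_or_ne y 0 with rfl | hy
    · simp
    · exact (berwald_pos hx hy).le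
  eq_zero_iff y := by
    refine ⟨fun h => ?_, by rintro rfl; simp⟩
    by_contra hy
    exact (berwald_pos hx hy).ne' h
  pos_homogeneous c y hc := berwald_smul x y hc.le
  smooth y hy := (contDiffAt_berwald_right hx hy).contDiffWithinAt
  posDef y hy v hv := fundTensor_berwald_pos hx hy hv

lemma isFinslerManifold_berwald : IsFinslerManifold (unitBall n) (berwald n) where
  isOpen := Metric.isOpen_ball
  isConnected := ((convex_ball (0 : Eu n) 1).isPathConnected ⟨0, by simp⟩).isConnected
  smooth := by
    rintro ⟨x, y⟩ ⟨hx, hy⟩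
    exact (contDiffAt_berwald (mem_ball_zero_iff.1 hx) hy).contDiffWithinAt
  minkowski x hx := isMinkowskiNorm_berwald (mem_ball_zero_iff.1 hx)

/-! ### The geodesic coefficients of Berwald's metric -/

lemma sum_smul_single (y : Eu n) : ∑ j, y j • EuclideanSpace.single j (1 : ℝ) = y := by
  have := (EuclideanSpace.basisFun (Fin n) ℝ).sum_repr y
  simpa using this

lemma sum_mul_apply_single {W : Type*} [NormedAddCommGroup W] [NormedSpace ℝ W]
    (L : Eu n →L[ℝ] W) (y : Eu n) : ∑ j, y j • L (EuclideanSpace.single j 1) = L y := by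
  conv_rhs => rw [← sum_smul_single y]
  simp

lemma sum_mul_pd (f : Eu n → ℝ) (x y : Eu n) : ∑ j, y j * pd j f x = fderiv ℝ f x y :=
  sum_mul_apply_single (fderiv ℝ f x) y

lemma sum_mul_gMatrix (F : Eu n → Eu n → ℝ) (x y v : Eu n) (l : Fin n) :
    ∑ j, v j * gMatrix F x y j l = fundTensor (F x) y v (EuclideanSpace.single l 1) := by
  have := sum_mul_apply_single (fundTensor (F x) y) v
  rw [← this]
  simp [gMatrix]

lemma sum_sum_mul_gMatrix (F : Eu n → Eu n → ℝ) (x y v w : Eu n) :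
    ∑ j, ∑ k, v j * w k * gMatrix F x y j k = fundTensor (F x) y v w := by
  rw [← sum_mul_apply_single (fundTensor (F x) y v) w, Finset.sum_comm]
  refine Finset.sum_congr rfl fun k _ => ?_
  rw [← sum_mul_gMatrix, smul_eq_mul, Finset.mul_sum]
  exact Finset.sum_congr rfl fun j _ => by ring

/-- Two partial derivatives in `y` are taken with `x` as a parameter; joint smoothness of `B` is
what keeps the result smooth in `x`. -/
lemma contDiffAt_fundTensor_berwald {x y : Eu n} (hx : ‖x‖ < 1) (hy : y ≠ 0) :
    ContDiffAt ℝ ∞ (fun z => fundTensor (berwald n z) y) x := by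
  have h0 : ∀ w : Eu n, w ≠ 0 →
      ContDiffAt ℝ ∞ (fun p : Eu n × Eu n => berwald n p.1 p.2 ^ 2) (x, w) :=
    fun w hw => (contDiffAt_berwald hx hw).pow 2
  have h1 : ContDiffAt ℝ ∞
      (fun p : Eu n × Eu n => fderiv ℝ (fun w => berwald n p.1 w ^ 2) p.2) (x, y) := by
    refine ContDiffAt.fderiv (m := ∞) (n := ∞) (x₀ := (x, y))
      (f := fun (p : Eu n × Eu n) w => berwald n p.1 w ^ 2) (g := fun p => p.2) ?_ contDiffAt_snd
      (by simp)
    have : ContDiffAt ℝ ∞ (fun q : (Eu n × Eu n) × Eu n => (q.1.1, q.2)) ((x, y), y) := by fun_prop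
    exact (h0 y hy).comp ((x, y), y) this
  have h2 : ContDiffAt ℝ ∞
      (fun z => fderiv ℝ (fderiv ℝ (fun w => berwald n z w ^ 2)) y) x :=
    ContDiffAt.fderiv (m := ∞) (n := ∞)
      (f := fun z => fderiv ℝ (fun w => berwald n z w ^ 2)) (g := fun _ => y)
      h1 contDiffAt_const (by simp)
  exact h2.const_smul (1 / 2 : ℝ)

lemma differentiableAt_gMatrix_berwald {x y : Eu n} (hx : ‖x‖ < 1) (hy : y ≠ 0) (j l : Fin n) :
    DifferentiableAt ℝ (fun z => gMatrix (berwald n) z y j l) x :=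
  (((contDiffAt_fundTensor_berwald hx hy).differentiableAt (by simp)).clm_apply
    (differentiableAt_const _)).clm_apply (differentiableAt_const _)

/-! ### Euler identities, and derivatives along the straight line through `x` in the direction `y`
-/

lemma berwaldDeriv_smul (x y v : Eu n) (t : ℝ) :
    berwaldDeriv x y (t • v) = t * berwaldDeriv x y v := by
  simp only [berwaldDeriv, inner_smul_right]; ring

lemma inner_exitPoint_self {x y : Eu n} (hx : ‖x‖ < 1) (hy : y ≠ 0) :
    inner ℝ (exitPoint x y) y = funk x y * exitGap x y := by
  have e : inner ℝ (exitPoint x y) y = inner ℝ (exitPoint x y)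
      (funk x y • (exitPoint x y - x)) := by rw [← smul_exitPoint_sub hx hy]
  rw [e, inner_smul_right, inner_sub_right, real_inner_self_eq_norm_sq, norm_exitPoint hx hy,
    exitGap, real_inner_comm]; ring

lemma inner_self_left {x y : Eu n} (hx : ‖x‖ < 1) (hy : y ≠ 0) :
    inner ℝ x y = funk x y * (1 - ‖x‖ ^ 2 - exitGap x y) := by
  conv_lhs => rw [smul_exitPoint_sub hx hy]
  rw [inner_smul_right, inner_sub_right, real_inner_self_eq_norm_sq, exitGap]; ring

lemma berwaldDeriv_self {x y : Eu n} (hx : ‖x‖ < 1) (hy : y ≠ 0) :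
    berwaldDeriv x y y = berwald n x y := by
  have hq := exitGap_pos hx hy
  rw [berwaldDeriv, inner_exitPoint_self hx hy, inner_self_left hx hy, berwald_eq hx hy]
  field_simp; ring

/-- Sliding the base point along its own ray does not change the ray, hence not its exit point. -/
lemma hasDerivAt_exitPoint_along {x y : Eu n} (hx : ‖x‖ < 1) (hy : y ≠ 0) :
    HasDerivAt (fun t : ℝ => exitPoint (x + t • y) y) 0 0 := by
  have hq := exitGap_pos hx hy
  have hT := funk_pos hx hy
  have du := (hasDerivWithinAt_exitPoint (y := fun _ => y) (t := 0) (by simpa using hx) hy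
    (hasDerivAt_line x y 0).hasDerivWithinAt (hasDerivWithinAt_const _ _ _)).hasDerivAt univ_mem
  refine du.congr_deriv ?_
  simp only [zero_smul, add_zero, zero_add, inner_smul_right, inner_exitPoint_self hx hy]
  rw [mul_div_assoc, mul_div_cancel_right₀ _ hq.ne', mul_smul, ← smul_exitPoint_sub hx hy]
  simp

lemma hasDerivAt_exitGap_along {x y : Eu n} (hx : ‖x‖ < 1) (hy : y ≠ 0) :
    HasDerivAt (fun t : ℝ => exitGap (x + t • y) y) (-(funk x y * exitGap x y)) 0 := by
  refine (((hasDerivAt_line x y 0).inner ℝ (hasDerivAt_exitPoint_along hx hy)).const_sub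
    1).congr_deriv ?_
  simp [real_inner_comm (exitPoint x y) y, inner_exitPoint_self hx hy]

lemma hasDerivAt_berwald_along {x y : Eu n} (hx : ‖x‖ < 1) (hy : y ≠ 0) :
    HasDerivAt (fun t : ℝ => berwald n (x + t • y) y) (2 * funk x y * berwald n x y) 0 := by
  have hq := exitGap_pos hx hy
  have d := hasDerivAt_berwald (y := fun _ => y) (t := 0) (by simpa using hx) hy
    (hasDerivAt_line x y 0) (hasDerivAt_const _ _)
  refine d.congr_deriv ?_
  simp only [zero_smul, add_zero, zero_add, berwaldDeriv_smul, berwaldDeriv_self hx hy,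
    inner_exitPoint_self hx hy]
  field_simp; ring

lemma hasDerivAt_berwaldDeriv_along {x y : Eu n} (hx : ‖x‖ < 1) (hy : y ≠ 0) (v : Eu n) :
    HasDerivAt (fun t : ℝ => berwaldDeriv (x + t • y) y v)
      (funk x y * (berwaldDeriv x y v + inner ℝ (exitPoint x y) v / exitGap x y ^ 2)) 0 := by
  have hq := exitGap_pos hx hy
  have hq' : exitGap (x + (0 : ℝ) • y) y ≠ 0 := by simpa using hq.ne'
  have dx := hasDerivAt_line x y 0
  have du := hasDerivAt_exitPoint_along hx hy
  have dq := hasDerivAt_exitGap_along hx hy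
  have dm := du.inner ℝ (hasDerivAt_const 0 v)
  have dk := dx.inner ℝ (hasDerivAt_const 0 v)
  have d := (((dm.const_mul 2).add dk).div (dq.pow 2) (pow_ne_zero 2 hq')).sub
    (((dx.norm_sq.const_sub 1).mul dm).div (dq.pow 3) (pow_ne_zero 3 hq'))
  refine d.congr_deriv ?_
  have hyv : inner ℝ y v = funk x y * (inner ℝ (exitPoint x y) v - inner ℝ x v) := by
    conv_lhs => rw [smul_exitPoint_sub hx hy]
    rw [inner_smul_left, inner_sub_left]; rfl
  simp only [zero_smul, add_zero, inner_zero_right, inner_zero_left, mul_zero, zero_add,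
    Pi.pow_apply, Pi.mul_apply, Pi.add_apply, inner_self_left hx hy, hyv, berwaldDeriv]
  field_simp
  ring

lemma fundTensor_berwald_self {x y : Eu n} (hx : ‖x‖ < 1) (hy : y ≠ 0) (v : Eu n) :
    fundTensor (berwald n x) y y v = berwald n x y * berwaldDeriv x y v := by
  rw [fundTensor_self (contDiffAt_berwald_right hx hy) fun c w hc => berwald_smul x w hc.le,
    fderiv_berwald_right hx hy]

lemma fundTensor_berwald_self_self {x y : Eu n} (hx : ‖x‖ < 1) (hy : y ≠ 0) :
    fundTensor (berwald n x) y y y = berwald n x y ^ 2 := by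
  rw [fundTensor_berwald_self hx hy, berwaldDeriv_self hx hy, sq]

lemma eventually_line_norm_lt_one {x : Eu n} (hx : ‖x‖ < 1) (v : Eu n) :
    ∀ᶠ t : ℝ in 𝓝 0, ‖x + t • v‖ < 1 := by
  have hc : Continuous fun t : ℝ => ‖x + t • v‖ := by fun_prop
  exact hc.continuousAt.eventually (eventually_lt_nhds (by simpa using hx))

/-- The first term of the geodesic coefficients, `yʲ yᵏ ∂g_{jl}/∂xᵏ`. -/
lemma sum_pd_gMatrix_along {x y : Eu n} (hx : ‖x‖ < 1) (hy : y ≠ 0) (l : Fin n) :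
    ∑ j, ∑ k, pd k (fun z => gMatrix (berwald n) z y j l) x * y j * y k =
      funk x y * berwald n x y * (3 * berwaldDeriv x y (EuclideanSpace.single l 1) +
        inner ℝ (exitPoint x y) (EuclideanSpace.single l 1) / exitGap x y ^ 2) := by
  have hg := fun j => differentiableAt_gMatrix_berwald hx hy j l
  have h1 : ∀ j, ∑ k, pd k (fun z => gMatrix (berwald n) z y j l) x * y j * y k =
      y j * fderiv ℝ (fun z => gMatrix (berwald n) z y j l) x y := by
    intro j
    rw [← sum_mul_pd, Finset.mul_sum]
    exact Finset.sum_congr rfl fun k _ => by ring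
  have hd : DifferentiableAt ℝ (fun z => ∑ j, y j * gMatrix (berwald n) z y j l) x :=
    DifferentiableAt.fun_sum fun j _ => (hg j).const_mul _
  have h2 : ∑ j, y j * fderiv ℝ (fun z => gMatrix (berwald n) z y j l) x y =
      fderiv ℝ (fun z => ∑ j, y j * gMatrix (berwald n) z y j l) x y := by
    rw [fderiv_fun_sum fun j _ => (hg j).const_mul _]
    simp [fderiv_const_mul (hg _)]
  simp only [h1, h2]
  apply fderiv_apply_eq_of_hasDerivAt_line hd
  have d := (hasDerivAt_berwald_along hx hy).mul
    (hasDerivAt_berwaldDeriv_along hx hy (EuclideanSpace.single l 1))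
  refine (d.congr_of_eventuallyEq ?_).congr_deriv ?_
  · filter_upwards [eventually_line_norm_lt_one hx y] with t ht
    rw [sum_mul_gMatrix, fundTensor_berwald_self ht hy]; rfl
  · simp only [zero_smul, add_zero]; ring

/-- The second term of the geodesic coefficients, `yʲ yᵏ ∂g_{jk}/∂xˡ`. -/
lemma sum_pd_gMatrix {x y : Eu n} (hx : ‖x‖ < 1) (hy : y ≠ 0) (l : Fin n) :
    ∑ j, ∑ k, pd l (fun z => gMatrix (berwald n) z y j k) x * y j * y k =
      2 * berwald n x y * (funk x y * berwaldDeriv x y (EuclideanSpace.single l 1) +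
        inner ℝ (exitPoint x y) (EuclideanSpace.single l 1) / exitGap x y * berwald n x y) := by
  have hg := fun j k => differentiableAt_gMatrix_berwald hx hy j k
  have hd : DifferentiableAt ℝ
      (fun z => ∑ j, ∑ k, y j * y k * gMatrix (berwald n) z y j k) x :=
    DifferentiableAt.fun_sum fun j _ => DifferentiableAt.fun_sum fun k _ => (hg j k).const_mul _
  have h2 : ∑ j, ∑ k, pd l (fun z => gMatrix (berwald n) z y j k) x * y j * y k =
      fderiv ℝ (fun z => ∑ j, ∑ k, y j * y k * gMatrix (berwald n) z y j k) x
        (EuclideanSpace.single l 1) := by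
    rw [fderiv_fun_sum fun j _ => DifferentiableAt.fun_sum fun k _ => (hg j k).const_mul _]
    simp only [sum_apply]
    refine Finset.sum_congr rfl fun j _ => ?_
    rw [fderiv_fun_sum fun k _ => (hg j k).const_mul _]
    simp only [sum_apply]
    refine Finset.sum_congr rfl fun k _ => ?_
    rw [fderiv_const_mul (hg j k), smul_apply, smul_eq_mul, pd]
    ring
  rw [h2]
  apply fderiv_apply_eq_of_hasDerivAt_line hd
  set v := EuclideanSpace.single l (1 : ℝ)
  have d1 := hasDerivAt_berwald (y := fun _ => y) (t := 0) (by simpa using hx) hy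
    (hasDerivAt_line x v 0) (hasDerivAt_const _ _)
  refine ((d1.pow 2).congr_of_eventuallyEq ?_).congr_deriv ?_
  · filter_upwards [eventually_line_norm_lt_one hx v] with t ht
    rw [sum_sum_mul_gMatrix, fundTensor_berwald_self_self ht hy]; rfl
  · simp only [zero_smul, add_zero, zero_add, berwaldDeriv_smul]; push_cast; ring

/-- A kernel vector would be a null vector of a positive definite form. -/
lemma isUnit_det_gMatrix_berwald {x y : Eu n} (hx : ‖x‖ < 1) (hy : y ≠ 0) :
    IsUnit (gMatrix (berwald n) x y).det := by
  rw [isUnit_iff_ne_zero]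
  intro h0
  obtain ⟨v, hv, hgv⟩ := Matrix.exists_mulVec_eq_zero_iff.2 h0
  have hv' : WithLp.toLp 2 v ≠ (0 : Eu n) := by
    intro h; apply hv; ext i; exact congrArg (fun w : Eu n => w i) h
  have h1 := fundTensor_berwald_pos hx hy hv'
  rw [← sum_sum_mul_gMatrix] at h1
  refine h1.ne' (Finset.sum_eq_zero fun j _ => ?_)
  have := congrFun hgv j
  simp only [Matrix.mulVec, dotProduct, Pi.zero_apply] at this
  calc _ = v j * ∑ k, gMatrix (berwald n) x y j k * v k := by
        rw [Finset.mul_sum]; exact Finset.sum_congr rfl fun k _ => by simp; ring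
    _ = 0 := by rw [this, mul_zero]

/-- Berwald's metric is projectively flat, with the Funk metric as its projective factor. -/
theorem geodesicCoeff_berwald {x : Eu n} (hx : ‖x‖ < 1) (y : Eu n) (i : Fin n) :
    geodesicCoeff (berwald n) x y i = funk x y * y i := by
  rcases eq_or_ne y 0 with rfl | hy
  · simp [geodesicCoeff]
  have hq := exitGap_pos hx hy
  -- Since `g_{lm} yᵐ = B B_{y^l}`, it suffices to see that the bracket equals `4ΘB B_{y^l}`;
  -- applying the inverse matrix then leaves `Θyⁱ`.
  have key : ∀ l, ∑ j, ∑ k, (2 * pd k (fun z => gMatrix (berwald n) z y j l) x -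
      pd l (fun z => gMatrix (berwald n) z y j k) x) * y j * y k =
      4 * funk x y * ∑ m, gMatrix (berwald n) x y l m * y m := by
    intro l
    have h1 : ∑ m, gMatrix (berwald n) x y l m * y m =
        berwald n x y * berwaldDeriv x y (EuclideanSpace.single l 1) := by
      rw [← fundTensor_berwald_self hx hy, ← sum_mul_gMatrix]
      refine Finset.sum_congr rfl fun m _ => ?_
      rw [mul_comm]
      congr 1
      exact fundTensor_symm ((contDiffAt_berwald_right hx hy).pow 2) _ _
    have h2 : ∑ j, ∑ k, (2 * pd k (fun z => gMatrix (berwald n) z y j l) x -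
        pd l (fun z => gMatrix (berwald n) z y j k) x) * y j * y k =
        2 * (∑ j, ∑ k, pd k (fun z => gMatrix (berwald n) z y j l) x * y j * y k) -
          ∑ j, ∑ k, pd l (fun z => gMatrix (berwald n) z y j k) x * y j * y k := by
      simp only [Finset.mul_sum, ← Finset.sum_sub_distrib]
      exact Finset.sum_congr rfl fun j _ => Finset.sum_congr rfl fun k _ => by ring
    -- The two terms containing `⟨u, e_l⟩` cancel precisely because `B = Θ/q`.
    rw [h2, h1, sum_pd_gMatrix_along hx hy, sum_pd_gMatrix hx hy, berwald_eq hx hy]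
    field_simp; ring
  have hinv : ((gMatrix (berwald n) x y)⁻¹.mulVec
      ((gMatrix (berwald n) x y).mulVec (fun m => y m))) i = y i := by
    rw [Matrix.mulVec_mulVec, Matrix.nonsing_inv_mul _ (isUnit_det_gMatrix_berwald hx hy),
      Matrix.one_mulVec]
  simp only [Matrix.mulVec, dotProduct] at hinv
  rw [geodesicCoeff]
  calc _ = 1 / 4 * ∑ l, (gMatrix (berwald n) x y)⁻¹ i l *
        ∑ j, ∑ k, (2 * pd k (fun z => gMatrix (berwald n) z y j l) x -
          pd l (fun z => gMatrix (berwald n) z y j k) x) * y j * y k := by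
        simp only [Finset.mul_sum, mul_assoc]
    _ = funk x y * ∑ l, (gMatrix (berwald n) x y)⁻¹ i l *
          ∑ m, gMatrix (berwald n) x y l m * y m := by
        simp only [key]
        rw [Finset.mul_sum, Finset.mul_sum]
        exact Finset.sum_congr rfl fun l _ => by ring
    _ = _ := by rw [hinv]

/-! ### Flatness -/

/-- The derivative of the Funk metric at `(x, y)` in the direction `v` of the second variable. -/
def funkDeriv (x y v : Eu n) : ℝ := inner ℝ (exitPoint x y) v / exitGap x y

lemma funkDeriv_self {x y : Eu n} (hx : ‖x‖ < 1) (hy : y ≠ 0) :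
    funkDeriv x y y = funk x y := by
  rw [funkDeriv, inner_exitPoint_self hx hy, mul_div_cancel_right₀ _ (exitGap_pos hx hy).ne']

lemma funkDeriv_add (x y v w : Eu n) :
    funkDeriv x y (v + w) = funkDeriv x y v + funkDeriv x y w := by
  simp only [funkDeriv, inner_add_right, add_div]

lemma funkDeriv_smul (x y v : Eu n) (t : ℝ) :
    funkDeriv x y (t • v) = t * funkDeriv x y v := by
  simp only [funkDeriv, inner_smul_right, mul_div_assoc]

lemma hasDerivAt_funk {x y : ℝ → Eu n} {x' y' : Eu n} {t : ℝ}
    (hx : ‖x t‖ < 1) (hy : y t ≠ 0) (dx : HasDerivAt x x' t) (dy : HasDerivAt y y' t) :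
    HasDerivAt (fun τ => funk (x τ) (y τ))
      (funkDeriv (x t) (y t) (y' + funk (x t) (y t) • x')) t := by
  rw [← hasDerivWithinAt_univ] at *
  exact hasDerivWithinAt_funk hx hy dx dy

lemma differentiableAt_funk {x y : Eu n} (hx : ‖x‖ < 1) (hy : y ≠ 0) :
    DifferentiableAt ℝ (fun z : Eu n × Eu n => funk z.1 z.2) (x, y) :=
  (contDiffAt_funk hx hy).differentiableAt (by simp)

lemma differentiableAt_funkDeriv {x y : Eu n} (hx : ‖x‖ < 1) (hy : y ≠ 0) (v : Eu n) :
    DifferentiableAt ℝ (fun z : Eu n × Eu n => funkDeriv z.1 z.2 v) (x, y) := by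
  have h1 : DifferentiableAt ℝ (fun z : Eu n × Eu n => exitPoint z.1 z.2) (x, y) :=
    differentiableAt_fst.add
      (((differentiableAt_funk hx hy).inv (funk_pos hx hy).ne').smul differentiableAt_snd)
  have h2 : DifferentiableAt ℝ (fun z : Eu n × Eu n => exitGap z.1 z.2) (x, y) :=
    (differentiableAt_fst.inner ℝ h1).const_sub 1
  have h3 : DifferentiableAt ℝ (fun z : Eu n × Eu n => (inner ℝ (exitPoint z.1 z.2) v : ℝ)) (x, y) :=
    h1.inner ℝ (differentiableAt_const v)
  simp only [funkDeriv, div_eq_mul_inv]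
  exact h3.mul (h2.inv (exitGap_pos hx hy).ne')

lemma differentiableAt_prodMk_left (x y : Eu n) :
    DifferentiableAt ℝ (fun z : Eu n => (z, y)) x :=
  differentiableAt_id.prodMk (differentiableAt_const y)

lemma differentiableAt_prodMk_right (x y : Eu n) :
    DifferentiableAt ℝ (fun w : Eu n => (x, w)) y :=
  (differentiableAt_const x).prodMk differentiableAt_id

lemma differentiableAt_funk_left {x y : Eu n} (hx : ‖x‖ < 1) (hy : y ≠ 0) :
    DifferentiableAt ℝ (fun z => funk z y) x := by
  have h := (differentiableAt_funk hx hy).comp x (differentiableAt_prodMk_left x y)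
  exact h

lemma differentiableAt_funk_right {x y : Eu n} (hx : ‖x‖ < 1) (hy : y ≠ 0) :
    DifferentiableAt ℝ (fun w => funk x w) y :=
  (differentiableAt_funk hx hy).comp y (differentiableAt_prodMk_right x y)

lemma differentiableAt_coord (i : Fin n) (y : Eu n) :
    DifferentiableAt ℝ (fun w : Eu n => w i) y :=
  (EuclideanSpace.proj (𝕜 := ℝ) i).differentiableAt

lemma fderiv_funk_left {x y : Eu n} (hx : ‖x‖ < 1) (hy : y ≠ 0) (v : Eu n) :
    fderiv ℝ (fun z => funk z y) x v = funk x y * funkDeriv x y v := by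
  apply fderiv_apply_eq_of_hasDerivAt_line (differentiableAt_funk_left hx hy)
  have := hasDerivAt_funk (x := fun t : ℝ => x + t • v) (y := fun _ => y) (t := 0)
    (by simpa using hx) hy (hasDerivAt_line x v 0) (hasDerivAt_const _ _)
  simpa [funkDeriv_smul] using this

lemma fderiv_funk_right {x y : Eu n} (hx : ‖x‖ < 1) (hy : y ≠ 0) (v : Eu n) :
    fderiv ℝ (fun w => funk x w) y v = funkDeriv x y v := by
  apply fderiv_apply_eq_of_hasDerivAt_line (differentiableAt_funk_right hx hy)
  have := hasDerivAt_funk (x := fun _ => x) (y := fun t : ℝ => y + t • v) (t := 0)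
    hx (by simpa using hy) (hasDerivAt_const _ _) (hasDerivAt_line y v 0)
  simpa using this

lemma fderiv_funk_mul_coord {x y : Eu n} (hx : ‖x‖ < 1) (hy : y ≠ 0) (i : Fin n) (v : Eu n) :
    fderiv ℝ (fun w => funk x w * w i) y v = funkDeriv x y v * y i + funk x y * v i := by
  have h : fderiv ℝ (fun w : Eu n => w i) y = EuclideanSpace.proj i :=
    (EuclideanSpace.proj (𝕜 := ℝ) i).fderiv
  rw [fderiv_fun_mul (differentiableAt_funk_right hx hy) (differentiableAt_coord i y), h]
  simp [fderiv_funk_right hx hy]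
  ring

lemma geodesicCoeff_berwald_fun {x : Eu n} (hx : ‖x‖ < 1) (i : Fin n) :
    (fun w => geodesicCoeff (berwald n) x w i) = fun w => funk x w * w i :=
  funext fun w => geodesicCoeff_berwald hx w i

lemma eventually_norm_lt_one {x : Eu n} (hx : ‖x‖ < 1) : ∀ᶠ z in 𝓝 x, ‖z‖ < 1 :=
  continuous_norm.continuousAt.eventually (eventually_lt_nhds hx)

/-- Along the line the exit point is fixed and only `Θ` and `q` move: `Θ` at rate `Θ²` and `Θ_y(v)`
at rate `ΘΘ_y(v)`. -/
lemma pd_pd_along_base {x y : Eu n} (hx : ‖x‖ < 1) (hy : y ≠ 0) (i : Fin n) (v : Eu n) :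
    fderiv ℝ (fun z => funkDeriv z y v * y i + funk z y * v i) x y =
      funk x y * funkDeriv x y v * y i + funk x y ^ 2 * v i := by
  have hq := exitGap_pos hx hy
  have h1 : DifferentiableAt ℝ (fun z => funkDeriv z y v) x := by
    have h := (differentiableAt_funkDeriv hx hy v).comp x (differentiableAt_prodMk_left x y)
    exact h
  apply fderiv_apply_eq_of_hasDerivAt_line
    ((h1.mul_const _).add ((differentiableAt_funk_left hx hy).mul_const _))
  have d1 := hasDerivAt_funk (x := fun t : ℝ => x + t • y) (y := fun _ => y) (t := 0)
    (by simpa using hx) hy (hasDerivAt_line x y 0) (hasDerivAt_const _ _)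
  have d2 : HasDerivAt (fun t : ℝ => funkDeriv (x + t • y) y v) _ 0 :=
    ((hasDerivAt_exitPoint_along hx hy).inner ℝ (hasDerivAt_const 0 v)).div
      (hasDerivAt_exitGap_along hx hy) (by simpa using hq.ne')
  refine ((d2.mul_const (y i)).add (d1.mul_const (v i))).congr_deriv ?_
  simp only [zero_smul, add_zero, zero_add, funkDeriv_smul, funkDeriv_self hx hy,
    inner_zero_left, inner_zero_right]
  rw [funkDeriv]
  field_simp
  ring

/-- Euler's theorem: the exit point depends only on the direction of `w`, so the function is
positively homogeneous of degree one. -/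
lemma pd_pd_along_fiber {x y : Eu n} (hx : ‖x‖ < 1) (hy : y ≠ 0) (i : Fin n) (v : Eu n) :
    fderiv ℝ (fun w => funkDeriv x w v * w i + funk x w * v i) y y =
      funkDeriv x y v * y i + funk x y * v i := by
  have h1 : DifferentiableAt ℝ (fun w => funkDeriv x w v) y :=
    (differentiableAt_funkDeriv hx hy v).comp y (differentiableAt_prodMk_right x y)
  apply fderiv_self_of_homogeneous (φ := fun w => funkDeriv x w v * w i + funk x w * v i)
    ((h1.mul (differentiableAt_coord i y)).add ((differentiableAt_funk_right hx hy).mul_const _))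
  intro c w hc
  have h2 : funkDeriv x (c • w) v = funkDeriv x w v := by
    simp only [funkDeriv, exitGap, exitPoint_smul x w hc]
  rw [h2, funk_smul x w hc.le]
  simp only [PiLp.smul_apply, smul_eq_mul]; ring

theorem riemannCoeff_berwald {x y : Eu n} (hx : ‖x‖ < 1) (hy : y ≠ 0) (i k : Fin n) :
    riemannCoeff (berwald n) x y i k = 0 := by
  set e : Eu n := EuclideanSpace.single k 1 with he
  have t1 : pd k (fun z => geodesicCoeff (berwald n) z y i) x =
      funk x y * funkDeriv x y e * y i := by
    have : (fun z => geodesicCoeff (berwald n) z y i) =ᶠ[𝓝 x] fun z => funk z y * y i := by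
      filter_upwards [eventually_norm_lt_one hx] with z hz using geodesicCoeff_berwald hz y i
    rw [pd, this.fderiv_eq, fderiv_mul_const (differentiableAt_funk_left hx hy), smul_apply,
      fderiv_funk_left hx hy, smul_eq_mul]
    ring
  have inner_pd : ∀ z : Eu n, ‖z‖ < 1 → ∀ w : Eu n, w ≠ 0 → ∀ j l : Fin n,
      pd j (fun w' => geodesicCoeff (berwald n) z w' l) w =
        funkDeriv z w (EuclideanSpace.single j 1) * w l +
          funk z w * (EuclideanSpace.single j 1 : Eu n) l := by
    intro z hz w hw j l
    rw [geodesicCoeff_berwald_fun hz l, pd, fderiv_funk_mul_coord hz hw]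
  have t2 : ∑ j, y j * pd j (fun z => pd k (fun w => geodesicCoeff (berwald n) z w i) y) x =
      funk x y * funkDeriv x y e * y i + funk x y ^ 2 * e i := by
    have : (fun z => pd k (fun w => geodesicCoeff (berwald n) z w i) y) =ᶠ[𝓝 x]
        fun z => funkDeriv z y e * y i + funk z y * e i := by
      filter_upwards [eventually_norm_lt_one hx] with z hz using inner_pd z hz y hy k i
    rw [sum_mul_pd, this.fderiv_eq, pd_pd_along_base hx hy]
  have t3 : ∑ j, geodesicCoeff (berwald n) x y j *
      pd j (fun w => pd k (fun w' => geodesicCoeff (berwald n) x w' i) w) y =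
      funk x y * (funkDeriv x y e * y i + funk x y * e i) := by
    have : (fun w => pd k (fun w' => geodesicCoeff (berwald n) x w' i) w) =ᶠ[𝓝 y]
        fun w => funkDeriv x w e * w i + funk x w * e i := by
      filter_upwards [isOpen_ne.mem_nhds hy] with w hw using inner_pd x hx w hw k i
    rw [← pd_pd_along_fiber hx hy, ← this.fderiv_eq, ← sum_mul_pd, Finset.mul_sum]
    exact Finset.sum_congr rfl fun j _ => by rw [geodesicCoeff_berwald hx, mul_assoc]
  -- The Jacobian of `G = Θy` sends `v` to `Θ_y(v)y + Θv`. Here it is applied twice to the basis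
  -- vector `e`, with `Θ_y(y) = Θ`.
  have t4 : ∑ j, pd j (fun w => geodesicCoeff (berwald n) x w i) y *
      pd k (fun w => geodesicCoeff (berwald n) x w j) y =
      3 * funk x y * funkDeriv x y e * y i + funk x y ^ 2 * e i := by
    have h1 : ∀ j, pd k (fun w => geodesicCoeff (berwald n) x w j) y =
        (funkDeriv x y e • y + funk x y • e) j := fun j => by
      rw [inner_pd x hx y hy]; rfl
    simp only [h1, mul_comm (pd _ _ y)]
    rw [sum_mul_pd, geodesicCoeff_berwald_fun hx, fderiv_funk_mul_coord hx hy, funkDeriv_add,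
      funkDeriv_smul, funkDeriv_smul, funkDeriv_self hx hy]
    simp only [PiLp.add_apply, PiLp.smul_apply, smul_eq_mul]
    ring
  rw [riemannCoeff, t1, t2, t3, t4]
  ring

theorem flagCurvature_berwald {x y : Eu n} (hx : ‖x‖ < 1) (hy : y ≠ 0) (v : Eu n) :
    flagCurvature (berwald n) x y v = 0 := by
  have : riemannMap (berwald n) x y v = 0 := by
    ext i
    simp [riemannMap, riemannCoeff_berwald hx hy]
  simp [flagCurvature, this]

theorem isFlat_berwald : IsFlat (unitBall n) (berwald n) := fun _ hx _ v hyv =>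
  flagCurvature_berwald (mem_ball_zero_iff.1 hx) (by simpa using hyv.ne_zero 0) v

/-! ### Forward completeness -/

/-- The ray from an interior point meets the sphere once: the quadratic equation of the Funk metric
has a single positive root. -/
lemma funk_eq_of_norm_eq_one {x y : Eu n} {k : ℝ} (hx : ‖x‖ < 1) (hk : 0 < k)
    (h : ‖x + k⁻¹ • y‖ = 1) : funk x y = k := by
  have hc := one_sub_norm_sq_pos hx
  have hy : y ≠ 0 := by rintro rfl; simp at h; linarith
  have hT := funk_pos hx hy
  have h1 := funk_quadratic hx y
  have h2 : ‖x + k⁻¹ • y‖ ^ 2 = 1 := by rw [h]; norm_num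
  rw [norm_add_sq_real, inner_smul_right, norm_smul, norm_inv, Real.norm_eq_abs,
    abs_of_pos hk] at h2
  have h3 : (1 - ‖x‖ ^ 2) * k ^ 2 - 2 * inner ℝ x y * k - ‖y‖ ^ 2 = 0 := by
    field_simp at h2; linarith
  have h4 : (funk x y - k) * (k * ((1 - ‖x‖ ^ 2) * (funk x y + k)) - 2 * inner ℝ x y * k) = 0 := by
    linear_combination k * h1 - k * h3
  have h5 : 0 < k * ((1 - ‖x‖ ^ 2) * (funk x y + k)) - 2 * inner ℝ x y * k := by
    have : 0 < (1 - ‖x‖ ^ 2) * funk x y * k := by positivity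
    nlinarith [sq_nonneg ‖y‖]
  have := (mul_eq_zero.1 h4).resolve_right h5.ne'
  linarith

lemma _root_.Convex.eq_of_hasDerivWithinAt_zero {V : Type*} [NormedAddCommGroup V]
    [NormedSpace ℝ V] {f : ℝ → V} {s : Set ℝ} (hs : Convex ℝ s)
    (h : ∀ t ∈ s, HasDerivWithinAt f 0 s t) {a b : ℝ} (ha : a ∈ s) (hb : b ∈ s) : f b = f a := by
  have := hs.norm_image_sub_le_of_norm_hasDerivWithin_le (C := 0) h (by simp) ha hb
  simpa [sub_eq_zero] using this

lemma isGeodesicOn_const {x : Eu n} (hx : ‖x‖ < 1) :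
    IsGeodesicOn (unitBall n) (berwald n) (fun _ => x) (Set.Ici 0) where
  mapsTo _ _ := mem_ball_zero_iff.2 hx
  smooth := contDiffOn_const
  equation t _ i := by
    have : derivWithin (fun _ : ℝ => x) (Set.Ici 0) = 0 := by
      ext1 t; simp
    simp [this, geodesicCoeff_berwald hx]

/-- The ray from `x` to the boundary point `u`, parametrized as a geodesic. -/
lemma isGeodesicOn_ray {x u : Eu n} (hx : ‖x‖ < 1) (hu : ‖u‖ = 1) {k : ℝ} (hk : 0 < k) :
    IsGeodesicOn (unitBall n) (berwald n) (fun t => u + (1 + k * t)⁻¹ • (x - u))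
      (Set.Ici 0) := by
  have hpos : ∀ t ∈ Set.Ici (0 : ℝ), 0 < 1 + k * t := fun t ht => by
    have : 0 ≤ k * t := mul_nonneg hk.le ht
    linarith
  have hmem : ∀ t ∈ Set.Ici (0 : ℝ), ‖u + (1 + k * t)⁻¹ • (x - u)‖ < 1 := fun t ht => by
    have h1 := hpos t ht
    have h2 : (1 + k * t)⁻¹ ≤ 1 := inv_le_one_of_one_le₀ (by nlinarith [Set.mem_Ici.1 ht])
    have h3 : 0 < (1 + k * t)⁻¹ := inv_pos.2 h1
    have : u + (1 + k * t)⁻¹ • (x - u) = (1 - (1 + k * t)⁻¹) • u + (1 + k * t)⁻¹ • x := by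
      rw [smul_sub, sub_smul, one_smul]; abel
    rw [this]
    refine (norm_add_le _ _).trans_lt ?_
    rw [norm_smul, norm_smul, hu, Real.norm_of_nonneg (by linarith), Real.norm_of_nonneg h3.le]
    nlinarith
  have hli : ∀ t : ℝ, HasDerivAt (fun t : ℝ => 1 + k * t) k t := fun t => by
    simpa using ((hasDerivAt_id t).const_mul k).const_add 1
  have hd1 : ∀ t ∈ Set.Ici (0 : ℝ), derivWithin (fun t => u + (1 + k * t)⁻¹ • (x - u))
      (Set.Ici 0) t = (-k / (1 + k * t) ^ 2) • (x - u) := fun t ht => by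
    have := (((hli t).inv (hpos t ht).ne').smul_const (x - u)).const_add u
    exact this.hasDerivWithinAt.derivWithin (uniqueDiffOn_Ici 0 t ht)
  have hd2 : ∀ t ∈ Set.Ici (0 : ℝ), derivWithin (derivWithin
      (fun t => u + (1 + k * t)⁻¹ • (x - u)) (Set.Ici 0)) (Set.Ici 0) t =
        (2 * k ^ 2 / (1 + k * t) ^ 3) • (x - u) := fun t ht => by
    rw [derivWithin_congr hd1 (hd1 t ht)]
    have h1 := hpos t ht
    have : HasDerivAt (fun t => (-k / (1 + k * t) ^ 2) • (x - u)) _ t :=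
      (((hasDerivAt_const t (-k)).div ((hli t).pow 2) (pow_ne_zero 2 h1.ne'))).smul_const (x - u)
    rw [this.hasDerivWithinAt.derivWithin (uniqueDiffOn_Ici 0 t ht)]
    congr 1
    simp only [Pi.pow_apply]
    field_simp
    ring
  refine ⟨fun t ht => mem_ball_zero_iff.2 (hmem t ht), ?_, fun t ht i => ?_⟩
  · intro t ht
    have h1 : ContDiffAt ℝ ∞ (fun t : ℝ => (1 + k * t)⁻¹) t :=
      ContDiffAt.inv (by fun_prop) (hpos t ht).ne'
    exact (contDiffAt_const.add (h1.smul contDiffAt_const)).contDiffWithinAt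
  · have h1 := hpos t ht
    have hf : funk (u + (1 + k * t)⁻¹ • (x - u)) ((-k / (1 + k * t) ^ 2) • (x - u)) =
        k / (1 + k * t) := by
      refine funk_eq_of_norm_eq_one (hmem t ht) (by positivity) ?_
      rw [smul_smul, add_assoc, ← add_smul]
      have : (1 + k * t)⁻¹ + (k / (1 + k * t))⁻¹ * (-k / (1 + k * t) ^ 2) = 0 := by
        field_simp; ring
      rw [this, zero_smul, add_zero, hu]
    rw [hd2 t ht, hd1 t ht, geodesicCoeff_berwald (hmem t ht), hf]
    simp only [PiLp.smul_apply, smul_eq_mul]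
    field_simp
    ring

/-- The solutions of a scalar linear differential equation keep their direction. -/
lemma exists_pos_smul_eq_of_hasDerivWithinAt {V : Type*} [NormedAddCommGroup V]
    [NormedSpace ℝ V] {v : ℝ → V} {f : ℝ → ℝ} {a b : ℝ} (hab : a ≤ b)
    (hf : ContinuousOn f (Set.Icc a b))
    (hv : ∀ t ∈ Set.Icc a b, HasDerivWithinAt v (f t • v t) (Set.Icc a b) t) :
    ∃ e : ℝ, 0 < e ∧ v b = e • v a := by
  -- The coefficient is extended by constants to a continuous function on the line, so that the
  -- exponent of the integrating factor `exp(-∫θ)` is differentiable also at the end points.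
  set θ : ℝ → ℝ := fun t => f (Set.projIcc a b hab t) with hθ
  have hθc : Continuous θ := hf.comp_continuous
    (continuous_subtype_val.comp continuous_projIcc) fun t => (Set.projIcc a b hab t).2
  have hθe : ∀ t ∈ Set.Icc a b, θ t = f t := fun t ht => by
    simp only [hθ, Set.projIcc_of_mem hab ht]
  have hI : ∀ t, HasDerivAt (fun t => ∫ τ in a..t, θ τ) (θ t) t := fun t =>
    (hθc.integral_hasStrictDerivAt a t).hasDerivAt
  have hconst : ∀ t ∈ Set.Icc a b, HasDerivWithinAt
      (fun t => Real.exp (-∫ τ in a..t, θ τ) • v t) 0 (Set.Icc a b) t := by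
    intro t ht
    refine ((hI t).neg.exp.hasDerivWithinAt.smul (hv t ht)).congr_deriv ?_
    rw [hθe t ht, smul_smul, ← add_smul, mul_neg, add_neg_cancel, zero_smul]
  have := (convex_Icc a b).eq_of_hasDerivWithinAt_zero hconst
    (Set.left_mem_Icc.2 hab) (Set.right_mem_Icc.2 hab)
  simp only [intervalIntegral.integral_same, neg_zero, Real.exp_zero, one_smul] at this
  refine ⟨(Real.exp (-∫ τ in a..b, θ τ))⁻¹, by positivity, ?_⟩
  rw [← this, smul_smul, inv_mul_cancel₀ (Real.exp_pos _).ne', one_smul]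

section Geodesics

variable {γ : ℝ → Eu n}

lemma IsGeodesicOn.hasDerivWithinAt {U : Set (Eu n)} {F : Eu n → Eu n → ℝ} {s : Set ℝ}
    (h : IsGeodesicOn U F γ s) {t : ℝ} (ht : t ∈ s) :
    HasDerivWithinAt γ (derivWithin γ s t) s t :=
  ((h.smooth t ht).differentiableWithinAt (by simp)).hasDerivWithinAt

lemma IsGeodesicOn.hasDerivWithinAt_velocity {s : Set ℝ}
    (h : IsGeodesicOn (unitBall n) (berwald n) γ s) (hs : UniqueDiffOn ℝ s) {t : ℝ} (ht : t ∈ s) :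
    HasDerivWithinAt (derivWithin γ s)
      ((-2 * funk (γ t) (derivWithin γ s t)) • derivWithin γ s t) s t := by
  have h1 : ContDiffOn ℝ ∞ (derivWithin γ s) s := h.smooth.derivWithin hs (by simp)
  have h2 := ((h1 t ht).differentiableWithinAt (by simp)).hasDerivWithinAt
  refine h2.congr_deriv ?_
  ext i
  have := h.equation t ht i
  rw [geodesicCoeff_berwald (mem_ball_zero_iff.1 (h.mapsTo ht))] at this
  simp only [PiLp.smul_apply, smul_eq_mul]
  linarith

/-- The velocity of a geodesic is a positive multiple of the initial velocity. -/
lemma IsGeodesicOn.exists_velocity_eq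
    (h : IsGeodesicOn (unitBall n) (berwald n) γ (Set.Ico 0 1)) {b : ℝ}
    (hb : b ∈ Set.Ico (0 : ℝ) 1) :
    ∃ e : ℝ, 0 < e ∧ derivWithin γ (Set.Ico 0 1) b = e • derivWithin γ (Set.Ico 0 1) 0 := by
  have hsub : Set.Icc 0 b ⊆ Set.Ico 0 1 := fun t ht => ⟨ht.1, ht.2.trans_lt hb.2⟩
  have hv := fun t (ht : t ∈ Set.Icc 0 b) =>
    (h.hasDerivWithinAt_velocity (uniqueDiffOn_Ico 0 1) (hsub ht)).mono hsub
  have hc : ContinuousOn (fun t => (γ t, derivWithin γ (Set.Ico 0 1) t)) (Set.Icc 0 b) :=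
    (h.smooth.continuousOn.mono hsub).prodMk fun t ht => (hv t ht).continuousWithinAt
  have hθ : ContinuousOn (fun t => funk (γ t) (derivWithin γ (Set.Ico 0 1) t)) (Set.Icc 0 b) := by
    have := (continuousOn_funk (n := n)).comp hc
      fun t ht => ⟨h.mapsTo (hsub ht), Set.mem_univ _⟩
    exact this
  exact exists_pos_smul_eq_of_hasDerivWithinAt hb.1 (hθ.const_mul (-2)) hv

theorem forwardComplete_berwald : ForwardComplete (unitBall n) (berwald n) := by
  intro γ h
  set S : Set ℝ := Set.Ico 0 1
  set v := derivWithin γ S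
  have h0S : (0 : ℝ) ∈ S := ⟨le_rfl, one_pos⟩
  have hx : ∀ t ∈ S, ‖γ t‖ < 1 := fun t ht => mem_ball_zero_iff.1 (h.mapsTo ht)
  -- The velocity either vanishes identically or never does; the exit point can be differentiated
  -- only in the second case.
  by_cases hv0 : v 0 = 0
  · refine ⟨fun _ => γ 0, isGeodesicOn_const (hx 0 h0S), fun t ht => ?_⟩
    refine (convex_Ico 0 1).eq_of_hasDerivWithinAt_zero (fun τ hτ => ?_) h0S ht
    obtain ⟨e, -, he⟩ := h.exists_velocity_eq hτ
    have := h.hasDerivWithinAt hτ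
    change v τ = e • v 0 at he
    change HasDerivWithinAt γ (v τ) S τ at this
    rwa [he, hv0, smul_zero] at this
  · have hv : ∀ t ∈ S, v t ≠ 0 := fun t ht => by
      obtain ⟨e, he0, he⟩ := h.exists_velocity_eq ht
      change v t = e • v 0 at he
      rw [he]; exact smul_ne_zero he0.ne' hv0
    -- This is the combination `y' + Θx'` along a geodesic. Being `-Θv`, a multiple of the velocity,
    -- it gives `Θ' = -Θ²` and `u' = 0`.
    have hsum : ∀ t, (-2 * funk (γ t) (v t)) • v t + funk (γ t) (v t) • v t =
        (-funk (γ t) (v t)) • v t := fun t => by rw [← add_smul]; congr 1; ring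
    have hΘ : ∀ t ∈ S, HasDerivWithinAt (fun t => funk (γ t) (v t))
        (-(funk (γ t) (v t)) ^ 2) S t := fun t ht => by
      have d := hasDerivWithinAt_funk (hx t ht) (hv t ht) (h.hasDerivWithinAt ht)
        (h.hasDerivWithinAt_velocity (uniqueDiffOn_Ico 0 1) ht)
      refine d.congr_deriv ?_
      have hq := exitGap_pos (hx t ht) (hv t ht)
      rw [hsum, inner_smul_right, inner_exitPoint_self (hx t ht) (hv t ht)]
      field_simp
    have hu : ∀ t ∈ S, HasDerivWithinAt (fun t => exitPoint (γ t) (v t)) 0 S t := fun t ht => by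
      have d := hasDerivWithinAt_exitPoint (hx t ht) (hv t ht) (h.hasDerivWithinAt ht)
        (h.hasDerivWithinAt_velocity (uniqueDiffOn_Ico 0 1) ht)
      refine d.congr_deriv ?_
      have hq := exitGap_pos (hx t ht) (hv t ht)
      rw [hsum, inner_smul_right, inner_exitPoint_self (hx t ht) (hv t ht), ← mul_assoc,
        mul_div_cancel_right₀ _ hq.ne', mul_smul, ← smul_exitPoint_sub (hx t ht) (hv t ht),
        sub_self, smul_zero]
    have hu' : ∀ t ∈ S, exitPoint (γ t) (v t) = exitPoint (γ 0) (v 0) := fun t ht =>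
      (convex_Ico 0 1).eq_of_hasDerivWithinAt_zero hu h0S ht
    set u := exitPoint (γ 0) (v 0)
    set k := funk (γ 0) (v 0)
    have hk : 0 < k := funk_pos (hx 0 h0S) hv0
    have hΘ' : ∀ t ∈ S, funk (γ t) (v t) = k / (1 + k * t) := fun t ht => by
      have hd : ∀ t ∈ S, HasDerivWithinAt (fun t => (funk (γ t) (v t))⁻¹ - t) 0 S t :=
        fun t ht => by
          have hp := funk_pos (hx t ht) (hv t ht)
          refine (((hΘ t ht).inv hp.ne').sub (hasDerivWithinAt_id t S)).congr_deriv ?_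
          field_simp; ring
      have e := (convex_Ico 0 1).eq_of_hasDerivWithinAt_zero hd h0S ht
      have hp := funk_pos (hx t ht) (hv t ht)
      have e' : (funk (γ t) (v t))⁻¹ = k⁻¹ + t := by
        simp only [sub_zero] at e; linarith
      rw [← inv_inv (funk (γ t) (v t)), e']
      field_simp
    have hpos : ∀ t ∈ S, 0 < 1 + k * t := fun t ht => by nlinarith [ht.1]
    have hγ : ∀ t ∈ S, HasDerivWithinAt (fun t => (1 + k * t) • (γ t - u)) 0 S t := fun t ht => by
      have d1 : HasDerivWithinAt (fun t : ℝ => 1 + k * t) k S t := by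
        simpa using (((hasDerivAt_id t).const_mul k).const_add 1).hasDerivWithinAt
      refine (d1.smul ((h.hasDerivWithinAt ht).sub_const u)).congr_deriv ?_
      -- The second-order equation has been integrated to this first-order linear one, whose first
      -- integral is `(1 + kt)(γ - u)`.
      have e : v t = (k / (1 + k * t)) • (u - γ t) := by
        rw [← hΘ' t ht, ← hu' t ht]; exact smul_exitPoint_sub (hx t ht) (hv t ht)
      have := hpos t ht
      change (1 + k * t) • v t + k • (γ t - u) = 0
      rw [e, smul_smul, mul_div_cancel₀ _ this.ne', ← smul_add]
      simp
    refine ⟨_, isGeodesicOn_ray (hx 0 h0S) (norm_exitPoint (hx 0 h0S) hv0) hk, fun t ht => ?_⟩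
    have e := (convex_Ico 0 1).eq_of_hasDerivWithinAt_zero hγ h0S ht
    simp only [mul_zero, add_zero, one_smul] at e
    change γ t = u + (1 + k * t)⁻¹ • (γ 0 - u)
    rw [← e, smul_smul, inv_mul_cancel₀ (hpos t ht).ne', one_smul]
    abel

end Geodesics

theorem isCartanHadamard_berwald : IsCartanHadamard (unitBall n) (berwald n) where
  finsler := isFinslerManifold_berwald
  simplyConnected := by
    have : ContractibleSpace (unitBall n) :=
      (convex_ball (0 : Eu n) 1).contractibleSpace ⟨0, by simp⟩
    exact SimplyConnectedSpace.ofContractible _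
  forwardComplete := forwardComplete_berwald
  flagCurvature_nonpos x hx y v hyv := (isFlat_berwald x hx y v hyv).le

/-! ### Pointwise estimates -/

lemma berwald_nonneg {x : Eu n} (hx : ‖x‖ < 1) (y : Eu n) : 0 ≤ berwald n x y :=
  (isMinkowskiNorm_berwald hx).nonneg y

/-- From `|y| = Θ|u - x| ≤ 2Θ` and `q ≤ 2`. -/
lemma norm_le_four_mul_berwald {x : Eu n} (hx : ‖x‖ < 1) (y : Eu n) :
    ‖y‖ ≤ 4 * berwald n x y := by
  rcases eq_or_ne y 0 with rfl | hy
  · simp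
  have hT := funk_pos hx hy
  have hq := exitGap_pos hx hy
  have h1 : ‖y‖ ≤ 2 * funk x y := by
    have e : ‖y‖ = funk x y * ‖exitPoint x y - x‖ := by
      have e0 := congrArg norm (smul_exitPoint_sub hx hy)
      rwa [norm_smul, Real.norm_of_nonneg hT.le] at e0
    have := norm_sub_le (exitPoint x y) x
    rw [norm_exitPoint hx hy] at this
    rw [e]; nlinarith
  have h2 : exitGap x y ≤ 2 := by
    have := (abs_le.1 (abs_real_inner_le_norm x (exitPoint x y))).1
    rw [norm_exitPoint hx hy] at this
    unfold exitGap; linarith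
  rw [berwald_eq hx hy]
  have : funk x y / 2 ≤ funk x y / exitGap x y := by gcongr
  linarith

/-- Near the boundary, the outward radial direction is expensive. -/
lemma inner_le_mul_berwald {x : Eu n} (hx : ‖x‖ < 1) (y : Eu n) :
    inner ℝ x y ≤ (1 - ‖x‖ ^ 2) ^ 2 * berwald n x y := by
  rcases eq_or_ne y 0 with rfl | hy
  · simp
  have hT := funk_pos hx hy
  have hq := exitGap_pos hx hy
  rw [berwald_eq hx hy, inner_self_left hx hy, mul_div_assoc', le_div_iff₀ hq]
  -- With `c = 1 - |x|²` the claim reduces to `(c - q)q ≤ c²`, which holds because `(c - q)q ≤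
  -- c²/4`.
  nlinarith [sq_nonneg ((1 - ‖x‖ ^ 2) - 2 * exitGap x y), sq_nonneg (1 - ‖x‖ ^ 2)]

lemma berwald_smul_left {x : Eu n} {t : ℝ} (ht : 1 + t * ‖x‖ ≠ 0) :
    berwald n (t • x) x = ‖x‖ / (1 - t * ‖x‖) ^ 2 := by
  rcases eq_or_ne x 0 with rfl | hx0
  · simp
  have hx := norm_pos_iff.2 hx0
  have hd : disc (t • x) x = ‖x‖ ^ 2 := by
    simp only [disc, norm_smul, inner_smul_left, real_inner_self_eq_norm_sq, mul_pow,
      Real.norm_eq_abs, sq_abs, RCLike.conj_to_real]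
    ring
  rw [berwald_eq_disc, hd, Real.sqrt_sq hx.le, norm_smul, inner_smul_left,
    real_inner_self_eq_norm_sq, mul_pow, Real.norm_eq_abs, sq_abs, RCLike.conj_to_real]
  have e1 : 1 - t ^ 2 * ‖x‖ ^ 2 = (1 - t * ‖x‖) * (1 + t * ‖x‖) := by ring
  have e2 : (‖x‖ + t * ‖x‖ ^ 2) ^ 2 = ‖x‖ ^ 2 * (1 + t * ‖x‖) ^ 2 := by ring
  rw [e1, e2]
  rcases eq_or_ne (1 - t * ‖x‖) 0 with h0 | h0
  · simp [h0]
  rw [mul_pow, mul_comm ((1 - t * ‖x‖) ^ 2), mul_assoc, mul_comm (‖x‖ ^ 2),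
    mul_div_mul_left _ _ (pow_ne_zero 2 ht), sq ‖x‖, mul_div_mul_right _ _ hx.ne']

lemma berwald_self {x : Eu n} : berwald n x x = ‖x‖ / (1 - ‖x‖) ^ 2 := by
  have := berwald_smul_left (x := x) (t := 1) (by positivity)
  simpa using this

lemma berwald_neg_self {x : Eu n} (hx : ‖x‖ < 1) : berwald n x (-x) = ‖x‖ / (1 + ‖x‖) ^ 2 := by
  have := berwald_smul_left (x := -x) (t := -1) (by rw [norm_neg]; linarith)
  simpa using this

/-! ### Infinite reversibility -/

/-- The quotient `B(x,x)/B(x,-x) = ((1+|x|)/(1-|x|))²` is unbounded at the sphere. The radius is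
chosen so that `1/(1-t) = K + 2`. -/
lemma exists_mul_berwald_lt (hn : 0 < n) (C : ℝ) :
    ∃ x ∈ unitBall n, ∃ y, y ≠ 0 ∧ C * berwald n x y < berwald n x (-y) := by
  set K := max C 0
  have hK : 0 ≤ K := le_max_right _ _
  set t : ℝ := 1 - (K + 2)⁻¹ with ht
  have hi : (K + 2)⁻¹ ≤ 2⁻¹ := by gcongr; linarith
  have hi0 : 0 < (K + 2)⁻¹ := by positivity
  set x : Eu n := EuclideanSpace.single ⟨0, hn⟩ t
  have hxt : ‖x‖ = t := by
    simp only [x, PiLp.norm_single]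
    exact Real.norm_of_nonneg (by linarith)
  have hx1 : ‖x‖ < 1 := by rw [hxt]; linarith
  have hx0 : x ≠ 0 := by rw [← norm_pos_iff, hxt]; linarith
  refine ⟨x, mem_ball_zero_iff.2 hx1, -x, neg_ne_zero.2 hx0, ?_⟩
  rw [neg_neg, berwald_neg_self hx1, berwald_self, hxt]
  have h1 : t / (1 - t) ^ 2 = t * (K + 2) ^ 2 := by rw [ht]; field_simp; ring
  have h2 : t / (1 + t) ^ 2 ≤ t := div_le_self (by linarith) (by nlinarith)
  have ht0 : 0 < t := by linarith
  rw [h1]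
  have h3 : 0 ≤ t / (1 + t) ^ 2 := by positivity
  calc C * (t / (1 + t) ^ 2) ≤ K * (t / (1 + t) ^ 2) := by gcongr; exact le_max_left _ _
    _ ≤ K * t := by gcongr
    _ < t * (K + 2) ^ 2 := by nlinarith

theorem reversibility_berwald (hn : 0 < n) : reversibility (unitBall n) (berwald n) = ⊤ := by
  refine ENNReal.eq_top_of_forall_nnreal_le fun C => ?_
  obtain ⟨x, hx, y, hy, h⟩ := exists_mul_berwald_lt hn C
  have hp := berwald_pos (mem_ball_zero_iff.1 hx) hy
  refine le_trans ?_ (le_iSup₂_of_le x hx (le_iSup₂_of_le y hy le_rfl))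
  rw [← ENNReal.ofReal_coe_nnreal]
  exact ENNReal.ofReal_le_ofReal ((le_div_iff₀ hp).2 h.le)

/-- By homogeneity it is enough to bound `φ(-w)/φ(w)` on the compact unit sphere. -/
lemma IsMinkowskiNorm.exists_neg_le {V : Type*} [NormedAddCommGroup V] [NormedSpace ℝ V]
    [FiniteDimensional ℝ V] {φ : V → ℝ} (h : IsMinkowskiNorm φ) :
    ∃ C, ∀ w, φ (-w) ≤ C * φ w := by
  have hne : ∀ w ∈ Metric.sphere (0 : V) 1, w ≠ 0 := fun w hw => by
    rintro rfl; simp at hw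
  have hc : ContinuousOn (fun w => φ (-w) / φ w) (Metric.sphere (0 : V) 1) := by
    intro w hw
    have h1 := (h.contDiffAt (hne w hw)).continuousAt
    have h2 : ContinuousAt (fun w => φ (-w)) w :=
      ContinuousAt.comp (f := fun w : V => -w) (g := φ)
        (h.contDiffAt (neg_ne_zero.2 (hne w hw))).continuousAt continuous_neg.continuousAt
    exact (h2.div h1 (h.pos (hne w hw)).ne').continuousWithinAt
  obtain ⟨C, hC⟩ := (isCompact_sphere (0 : V) 1).exists_bound_of_continuousOn hc
  refine ⟨C, fun w => ?_⟩
  rcases eq_or_ne w 0 with rfl | hw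
  · simp [(h.eq_zero_iff 0).2 rfl]
  have hwp := norm_pos_iff.2 hw
  have hmem : ‖w‖⁻¹ • w ∈ Metric.sphere (0 : V) 1 := by
    simp [norm_smul, hwp.ne']
  have h1 := (le_abs_self _).trans (hC _ hmem)
  have hi : 0 < ‖w‖⁻¹ := inv_pos.2 hwp
  rw [← smul_neg, h.pos_homogeneous _ _ hi, h.pos_homogeneous _ _ hi,
    mul_div_mul_left _ _ hi.ne', div_le_iff₀ (h.pos hw)] at h1
  exact h1

theorem not_exists_isIsometricEmbedding (hn : 0 < n) {V : Type*} [NormedAddCommGroup V]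
    [NormedSpace ℝ V] [FiniteDimensional ℝ V] {φ : V → ℝ} (h : IsMinkowskiNorm φ) :
    ¬ ∃ f, IsIsometricEmbedding (unitBall n) (berwald n) φ f := by
  rintro ⟨f, hf⟩
  obtain ⟨C, hC⟩ := h.exists_neg_le
  obtain ⟨x, hx, y, hy, hlt⟩ := exists_mul_berwald_lt hn C
  rw [← hf.isometric x hx, ← hf.isometric x hx, map_neg] at hlt
  exact absurd (hC _) (not_le.2 hlt)

/-! ### The gradient -/

/-- Maximize `η/B` on the unit sphere. At a maximizer `y₀` with value `M`, `η - M B` has a critical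
point, so `η = M B_y(y₀)`; scaling `y₀` by `M/B(y₀)` gives a preimage. It ensures that the gradient,
defined by a chosen inverse, really is a preimage of the differential. -/
lemma legendre_berwald_surjective {x : Eu n} (hx : ‖x‖ < 1) :
    Function.Surjective (legendre (berwald n) x) := by
  intro η
  by_cases hη : η = 0
  · exact ⟨0, by simp [legendre, hη]⟩
  obtain ⟨v₀, hv₀⟩ : ∃ v, 0 < η v := by
    by_contra! hle
    apply hη
    ext v
    have h1 := hle v
    have h2 := hle (-v)
    rw [map_neg] at h2
    simp only [zero_apply]; linarith
  have hv₀' : v₀ ≠ 0 := by rintro rfl; simp at hv₀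
  have hne : ∀ w ∈ Metric.sphere (0 : Eu n) 1, w ≠ 0 := fun w hw => by
    rintro rfl; simp at hw
  have hcont : ContinuousOn (fun w => η w / berwald n x w) (Metric.sphere (0 : Eu n) 1) :=
    fun w hw => (η.continuous.continuousAt.div
      (contDiffAt_berwald_right hx (hne w hw)).continuousAt
        (berwald_pos hx (hne w hw)).ne').continuousWithinAt
  have hunit : ∀ w : Eu n, w ≠ 0 → ‖w‖⁻¹ • w ∈ Metric.sphere (0 : Eu n) 1 := fun w hw => by
    simp [norm_smul, (norm_pos_iff.2 hw).ne']
  obtain ⟨y₀, hy₀, hmax⟩ := (isCompact_sphere (0 : Eu n) 1).exists_isMaxOn ⟨_, hunit v₀ hv₀'⟩ hcont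
  have hy₀' := hne y₀ hy₀
  have hF₀ := berwald_pos hx hy₀'
  set M := η y₀ / berwald n x y₀ with hM
  have hle : ∀ w, η w - M * berwald n x w ≤ 0 := by
    intro w
    rcases eq_or_ne w 0 with rfl | hw
    · simp
    have h1 : η (‖w‖⁻¹ • w) / berwald n x (‖w‖⁻¹ • w) ≤ M := hmax (hunit w hw)
    have hi : 0 < ‖w‖⁻¹ := inv_pos.2 (norm_pos_iff.2 hw)
    rw [berwald_smul x w hi.le, map_smul, smul_eq_mul, mul_div_mul_left _ _ hi.ne',
      div_le_iff₀ (berwald_pos hx hw)] at h1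
    linarith
  have hM0 : 0 < M := by
    have := hle v₀
    have := berwald_pos hx hv₀'
    by_contra! h0
    nlinarith
  have heq : η y₀ - M * berwald n x y₀ = 0 := by rw [hM]; field_simp; ring
  have hloc : IsLocalMax (fun w => η w - M * berwald n x w) y₀ :=
    Filter.Eventually.of_forall fun w => by simpa only [heq] using hle w
  have hdiff := differentiableAt_berwald_right hx hy₀'
  have hzero := hloc.fderiv_eq_zero
  rw [fderiv_fun_sub η.differentiableAt (hdiff.const_mul M), fderiv_const_mul hdiff,
    ContinuousLinearMap.fderiv] at hzero
  have hs : 0 < M / berwald n x y₀ := div_pos hM0 hF₀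
  refine ⟨(M / berwald n x y₀) • y₀, ?_⟩
  ext v
  have hv : η v = M * berwaldDeriv x y₀ v := by
    have := congrArg (fun L => L v) hzero
    simp only [sub_apply, smul_apply, smul_eq_mul, zero_apply,
      fderiv_berwald_right hx hy₀'] at this
    linarith
  rw [legendre, fundTensor_berwald_self hx (smul_ne_zero hs.ne' hy₀'), berwald_smul x _ hs.le, hv]
  have : berwaldDeriv x ((M / berwald n x y₀) • y₀) v = berwaldDeriv x y₀ v := by
    simp only [berwaldDeriv, exitGap, exitPoint_smul x y₀ hs]
  rw [this]
  field_simp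

/-- For `y = ∇f` one has `B(y)² = g_y(y,y) = df(y) ≤ M B(y)`. All energy estimates use only this
half of `B(∇f) = B*(df)`. -/
lemma berwald_gradient_le {x : Eu n} (hx : ‖x‖ < 1) {f : Eu n → ℝ} {M : ℝ} (hM : 0 ≤ M)
    (h : ∀ y, fderiv ℝ f x y ≤ M * berwald n x y) :
    berwald n x (gradient (berwald n) f x) ≤ M := by
  have hg : legendre (berwald n) x (gradient (berwald n) f x) = fderiv ℝ f x :=
    Function.invFun_eq (legendre_berwald_surjective hx _)
  set y := gradient (berwald n) f x
  rcases eq_or_ne y 0 with hy | hy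
  · simpa [hy] using hM
  have h1 := h y
  rw [← hg, legendre, fundTensor_berwald_self_self hx hy, sq] at h1
  exact le_of_mul_le_mul_right h1 (berwald_pos hx hy)

lemma berwald_gradient_le_norm {x : Eu n} (hx : ‖x‖ < 1) (f : Eu n → ℝ) :
    berwald n x (gradient (berwald n) f x) ≤ 4 * ‖fderiv ℝ f x‖ := by
  refine berwald_gradient_le hx (by positivity) fun y => ?_
  calc fderiv ℝ f x y ≤ ‖fderiv ℝ f x‖ * ‖y‖ := (le_abs_self _).trans ((fderiv ℝ f x).le_opNorm y)
    _ ≤ ‖fderiv ℝ f x‖ * (4 * berwald n x y) := by gcongr; exact norm_le_four_mul_berwald hx y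
    _ = _ := by ring

/-! ### The distance from the centre -/

lemma _root_.LipschitzOnWith.enorm_sub_le_lintegral_deriv {ζ : ℝ → Eu n} {K : NNReal}
    (h : LipschitzOnWith K ζ (Set.Icc 0 1)) :
    ‖ζ 1 - ζ 0‖ₑ ≤ ∫⁻ t in Set.Icc (0 : ℝ) 1, ‖deriv ζ t‖ₑ := by
  set x := ζ 1 - ζ 0 with hxdef
  rcases eq_or_ne x 0 with hx | hx
  · simp [hx]
  set e := ‖x‖⁻¹ • x with he
  have hen : ‖e‖ = 1 := by simp [he, norm_smul, (norm_pos_iff.2 hx).ne']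
  -- Projection to the direction of the displacement reduces the length estimate to the fundamental
  -- theorem of calculus for a scalar Lipschitz function.
  set L : Eu n →L[ℝ] ℝ := innerSL ℝ e
  have hL : ∀ w, |L w| ≤ ‖w‖ := fun w => by
    have := abs_real_inner_le_norm e w
    rwa [hen, one_mul] at this
  have hlip : LipschitzOnWith K (fun t => L (ζ t)) (Set.Icc 0 1) := by
    rw [lipschitzOnWith_iff_dist_le_mul] at h ⊢
    intro s hs t ht
    refine le_trans ?_ (h s hs t ht)
    rw [dist_eq_norm, dist_eq_norm, ← map_sub]
    exact hL _
  have hac : AbsolutelyContinuousOnInterval (fun t => L (ζ t)) 0 1 :=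
    LipschitzOnWith.absolutelyContinuousOnInterval (K := K) (by rwa [Set.uIcc_of_le zero_le_one])
  have hint := hac.integral_deriv_eq_sub
  have hval : L (ζ 1) - L (ζ 0) = ‖x‖ := by
    rw [← map_sub, ← hxdef]
    change inner ℝ e x = ‖x‖
    rw [he, inner_smul_left, real_inner_self_eq_norm_sq]
    simp only [RCLike.conj_to_real]
    field_simp
  have hae : ∀ᵐ t ∂(volume.restrict (Set.Ioc (0 : ℝ) 1)), DifferentiableAt ℝ ζ t := by
    have h1 := h.ae_differentiableWithinAt_of_mem (μ := volume)
    have h2 : ∀ᵐ t : ℝ, t ≠ 1 := by simp [ae_iff]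
    rw [ae_restrict_iff' measurableSet_Ioc]
    filter_upwards [h1, h2] with t ht1 ht2 ht
    exact (ht1 ⟨ht.1.le, ht.2⟩).differentiableAt (Icc_mem_nhds ht.1 (lt_of_le_of_ne ht.2 ht2))
  calc ‖x‖ₑ = ‖∫ t in Set.Ioc (0 : ℝ) 1, deriv (fun t => L (ζ t)) t‖ₑ := by
        rw [← intervalIntegral.integral_of_le zero_le_one, hint, hval, enorm_norm]
    _ ≤ ∫⁻ t in Set.Ioc (0 : ℝ) 1, ‖deriv (fun t => L (ζ t)) t‖ₑ :=
        enorm_integral_le_lintegral_enorm _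
    _ ≤ ∫⁻ t in Set.Ioc (0 : ℝ) 1, ‖deriv ζ t‖ₑ := by
        refine lintegral_mono_ae ?_
        filter_upwards [hae] with t ht
        have : deriv (fun t => L (ζ t)) t = L (deriv ζ t) :=
          (L.hasFDerivAt.comp_hasDerivAt t ht.hasDerivAt).deriv
        rw [this, enorm_le_iff_norm_le]
        exact hL _
    _ ≤ _ := lintegral_mono_set Set.Ioc_subset_Icc_self

lemma ofReal_norm_div_four_le_edist (x : Eu n) :
    ENNReal.ofReal (‖x‖ / 4) ≤ edist (unitBall n) (berwald n) 0 x := by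
  refine le_iInf₂ fun ζ hζ => ?_
  obtain ⟨⟨K, hK⟩, hmaps, h0, h1⟩ := hζ
  have h := hK.enorm_sub_le_lintegral_deriv
  rw [h0, h1, sub_zero] at h
  have hq : ENNReal.ofReal (‖x‖ / 4) = ‖x‖ₑ * ENNReal.ofReal (1 / 4) := by
    rw [← ofReal_norm, ← ENNReal.ofReal_mul (norm_nonneg _)]
    congr 1; ring
  rw [hq]
  calc ‖x‖ₑ * ENNReal.ofReal (1 / 4)
      ≤ (∫⁻ t in Set.Icc (0 : ℝ) 1, ‖deriv ζ t‖ₑ) * ENNReal.ofReal (1 / 4) := by gcongr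
    _ = ∫⁻ t in Set.Icc (0 : ℝ) 1, ‖deriv ζ t‖ₑ * ENNReal.ofReal (1 / 4) :=
        (lintegral_mul_const' _ _ ENNReal.ofReal_ne_top).symm
    _ ≤ _ := by
        refine setLIntegral_mono_ae' measurableSet_Icc (Eventually.of_forall fun t ht => ?_)
        rw [← ofReal_norm, ← ENNReal.ofReal_mul (norm_nonneg _)]
        refine ENNReal.ofReal_le_ofReal ?_
        have := norm_le_four_mul_berwald (mem_ball_zero_iff.1 (hmaps ht)) (deriv ζ t)
        linarith

/-- The bound is the length of the radial segment, `∫₀¹ |x|/(1 - t|x|)² dt`. -/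
lemma edist_le_ofReal {x : Eu n} (hx : ‖x‖ < 1) :
    edist (unitBall n) (berwald n) 0 x ≤ ENNReal.ofReal (‖x‖ / (1 - ‖x‖)) := by
  have hpos : ∀ t ∈ Set.Icc (0 : ℝ) 1, 0 < 1 - t * ‖x‖ := fun t ht => by
    nlinarith [norm_nonneg x, ht.1, ht.2]
  have hder : ∀ t : ℝ, HasDerivAt (fun t : ℝ => t • x) x t := fun t => by
    simpa using (hasDerivAt_id t).smul_const x
  have hlip : LipschitzWith ‖x‖₊ (fun t : ℝ => t • x) :=
    LipschitzWith.of_dist_le_mul fun s t => by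
      rw [dist_eq_norm, ← sub_smul, norm_smul, dist_eq_norm, mul_comm]; rfl
  have hmaps : Set.MapsTo (fun t : ℝ => t • x) (Set.Icc 0 1) (unitBall n) := fun t ht => by
    rw [mem_ball_zero_iff, norm_smul, Real.norm_of_nonneg ht.1]
    linarith [hpos t ht]
  refine (iInf₂_le (fun t : ℝ => t • x)
    ⟨⟨_, hlip.lipschitzOnWith⟩, hmaps, by simp, by simp⟩).trans ?_
  have hcont : ContinuousOn (fun t : ℝ => ‖x‖ / (1 - t * ‖x‖) ^ 2) (Set.Icc 0 1) :=
    continuousOn_const.div (by fun_prop) fun t ht => (pow_pos (hpos t ht) 2).ne'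
  have hintegral : ∫ t in (0 : ℝ)..1, ‖x‖ / (1 - t * ‖x‖) ^ 2 = ‖x‖ / (1 - ‖x‖) := by
    have hd : ∀ t ∈ Set.uIcc (0 : ℝ) 1, HasDerivAt (fun t : ℝ => (1 - t * ‖x‖)⁻¹)
        (‖x‖ / (1 - t * ‖x‖) ^ 2) t := by
      intro t ht
      rw [Set.uIcc_of_le zero_le_one] at ht
      have h1 : HasDerivAt (fun t : ℝ => 1 - t * ‖x‖) (-‖x‖) t := by
        simpa using ((hasDerivAt_id t).mul_const ‖x‖).const_sub 1
      exact (h1.inv (hpos t ht).ne').congr_deriv (by rw [neg_neg])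
    rw [intervalIntegral.integral_eq_sub_of_hasDerivAt hd
      (ContinuousOn.intervalIntegrable (by rwa [Set.uIcc_of_le zero_le_one]))]
    have : 1 - ‖x‖ ≠ 0 := by linarith
    simp only [one_mul, zero_mul, sub_zero, inv_one]
    field_simp; ring
  rw [← hintegral, intervalIntegral.integral_of_le zero_le_one, ← integral_Icc_eq_integral_Ioc,
    ofReal_integral_eq_lintegral_ofReal hcont.integrableOn_Icc
      (Eventually.of_forall fun t => by positivity)]
  refine setLIntegral_mono_ae' measurableSet_Icc (Eventually.of_forall fun t ht => ?_)
  rw [(hder t).deriv, berwald_smul_left]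
  have := mul_nonneg ht.1 (norm_nonneg x)
  linarith

/-! ### Finiteness of the energy and of the weighted integrals -/

lemma _root_.ENNReal.rpow_le_rpow_of_exponent_nonpos {a b : ℝ≥0∞} {z : ℝ} (h : a ≤ b)
    (hz : z ≤ 0) : b ^ z ≤ a ^ z := by
  rw [← neg_neg z, ENNReal.rpow_neg, ENNReal.rpow_neg a]
  exact ENNReal.inv_le_inv.2 (ENNReal.rpow_le_rpow h (neg_nonneg.2 hz))

lemma _root_.ENNReal.rpow_pos_of_exponent_nonpos {a : ℝ≥0∞} {z : ℝ} (h : a ≠ ⊤)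
    (hz : z ≤ 0) : 0 < a ^ z := by
  rw [← neg_neg z, ENNReal.rpow_neg]
  exact ENNReal.inv_pos.2 (ENNReal.rpow_ne_top_of_nonneg (neg_nonneg.2 hz) h)

lemma volume_unitBall_lt_top : volume (unitBall n) < ⊤ := measure_ball_lt_top

lemma IsTestFunction.exists_bound {U : Set (Eu n)} {f : Eu n → ℝ} (hf : IsTestFunction U f) :
    ∃ C, ∀ x, ‖f x‖ₑ ≤ ENNReal.ofReal C := by
  obtain ⟨C, hC⟩ := hf.smooth.continuous.bounded_above_of_compact_support hf.hasCompactSupport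
  exact ⟨C, fun x => by rw [← ofReal_norm]; exact ENNReal.ofReal_le_ofReal (hC x)⟩

lemma IsTestFunction.exists_bound_fderiv {U : Set (Eu n)} {f : Eu n → ℝ}
    (hf : IsTestFunction U f) : ∃ C, ∀ x, ‖fderiv ℝ f x‖ ≤ C :=
  (hf.smooth.continuous_fderiv (by simp)).bounded_above_of_compact_support
    (hf.hasCompactSupport.fderiv (𝕜 := ℝ))

lemma energy_berwald_lt_top {p : ℝ} (hp : 0 < p) {f : Eu n → ℝ}
    (hf : IsTestFunction (unitBall n) f) : energy (unitBall n) (berwald n) p f < ⊤ := by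
  obtain ⟨C, hC⟩ := hf.exists_bound_fderiv
  calc energy (unitBall n) (berwald n) p f
      ≤ ∫⁻ _ in unitBall n, ENNReal.ofReal (4 * C) ^ p := by
        refine setLIntegral_mono_ae' measurableSet_ball (Eventually.of_forall fun x hx => ?_)
        refine ENNReal.rpow_le_rpow (ENNReal.ofReal_le_ofReal ?_) hp.le
        exact (berwald_gradient_le_norm (mem_ball_zero_iff.1 hx) f).trans (by gcongr; exact hC x)
    _ < ⊤ := by
        rw [setLIntegral_const]
        exact ENNReal.mul_lt_top (ENNReal.rpow_lt_top_of_nonneg hp.le ENNReal.ofReal_ne_top)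
          volume_unitBall_lt_top

lemma lintegral_edist_rpow_lt_top (hn : 1 ≤ n) {q : ℝ} (hq : q ≤ 0) (hqn : -(n : ℝ) < q) :
    ∫⁻ x in unitBall n, edist (unitBall n) (berwald n) 0 x ^ q < ⊤ := by
  have : Nonempty (Fin n) := ⟨⟨0, hn⟩⟩
  have hae : ∀ᵐ x ∂(volume.restrict (unitBall n)), x ≠ (0 : Eu n) := by
    simp [ae_iff]
  have hint : IntegrableOn (fun x : Eu n => (‖x‖ / 4) ^ q) (Metric.ball 0 1) := by
    refine integrableOn_ball_of_norm_le_rpow (C := (1 / 4) ^ q) (α := -q) (by simpa using hn)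
      (by simp; linarith) (Eventually.of_forall fun x => ?_) ?_
    · rw [neg_neg, ← Real.mul_rpow (by norm_num) (norm_nonneg x),
        Real.norm_of_nonneg (by positivity), div_eq_inv_mul, one_div]
    · exact ((measurable_norm.div_const 4).pow_const q).aestronglyMeasurable
  refine lt_of_le_of_lt (lintegral_mono_ae ?_) hint.lintegral_lt_top
  filter_upwards [hae] with x hx
  rw [← ENNReal.ofReal_rpow_of_pos (by have := norm_pos_iff.2 hx; positivity)]
  exact ENNReal.rpow_le_rpow_of_exponent_nonpos (ofReal_norm_div_four_le_edist x) hq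

/-- Negative powers of `r` are integrable at the origin because `r ≥ |x|/4` and `q > -n`; positive
powers are bounded on the support, which lies in a smaller ball. -/
lemma weighted_berwald_lt_top (hn : 1 ≤ n) {p q : ℝ} (hp : 0 < p) (hqn : -(n : ℝ) < q)
    {f : Eu n → ℝ} (hf : IsTestFunction (unitBall n) f) :
    weighted (unitBall n) (berwald n) p q f < ⊤ := by
  obtain ⟨C, hC⟩ := hf.exists_bound
  have hCp : ENNReal.ofReal C ^ p ≠ ⊤ := ENNReal.rpow_ne_top_of_nonneg hp.le ENNReal.ofReal_ne_top
  rcases le_total q 0 with hq | hq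
  · calc weighted (unitBall n) (berwald n) p q f
        ≤ ∫⁻ x in unitBall n, ENNReal.ofReal C ^ p *
            edist (unitBall n) (berwald n) 0 x ^ q := by
          refine lintegral_mono fun x => ?_
          gcongr
          exact hC x
      _ < ⊤ := by
          rw [lintegral_const_mul' _ _ hCp]
          exact ENNReal.mul_lt_top hCp.lt_top (lintegral_edist_rpow_lt_top hn hq hqn)
  · obtain ⟨R, hR, hsub⟩ := exists_lt_subset_ball (isClosed_tsupport f) hf.tsupport_subset
    have hR' : ENNReal.ofReal (1 / (1 - R)) ^ q ≠ ⊤ :=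
      ENNReal.rpow_ne_top_of_nonneg hq ENNReal.ofReal_ne_top
    calc weighted (unitBall n) (berwald n) p q f
        ≤ ∫⁻ _ in unitBall n, ENNReal.ofReal C ^ p * ENNReal.ofReal (1 / (1 - R)) ^ q := by
          refine setLIntegral_mono_ae' measurableSet_ball (Eventually.of_forall fun x hx => ?_)
          by_cases hfx : f x = 0
          · simp [hfx, ENNReal.zero_rpow_of_pos hp]
          have hxR : ‖x‖ < R := mem_ball_zero_iff.1 (hsub (subset_tsupport f hfx))
          gcongr
          · exact hC x
          · refine (edist_le_ofReal (mem_ball_zero_iff.1 hx)).trans (ENNReal.ofReal_le_ofReal ?_)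
            have : 0 < 1 - R := by linarith
            gcongr
            linarith
      _ < ⊤ := by
          rw [setLIntegral_const]
          exact ENNReal.mul_lt_top (ENNReal.mul_lt_top hCp.lt_top hR'.lt_top)
            volume_unitBall_lt_top

lemma weighted_berwald_pos {p q : ℝ} (hp : 0 < p) (hq : q ≤ 0)
    {f : Eu n → ℝ} (hf : IsTestFunction (unitBall n) f) (hf0 : f ≠ 0) :
    0 < weighted (unitBall n) (berwald n) p q f := by
  -- An explicit measurable minorant of the integrand, so that measurability of the distance is not
  -- needed.
  set g : Eu n → ℝ≥0∞ := fun x => ‖f x‖ₑ ^ p * ENNReal.ofReal (‖x‖ / (1 - ‖x‖)) ^ q with hg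
  have hmeas : Measurable g := by
    refine ((hf.smooth.continuous.measurable.enorm).pow_const p).mul
      (Measurable.pow_const (Measurable.ennreal_ofReal ?_) q)
    exact measurable_norm.div (measurable_norm.const_sub 1)
  have hle : ∫⁻ x in unitBall n, g x ≤ weighted (unitBall n) (berwald n) p q f := by
    refine setLIntegral_mono_ae' measurableSet_ball (Eventually.of_forall fun x hx => ?_)
    exact mul_le_mul_right (ENNReal.rpow_le_rpow_of_exponent_nonpos (edist_le_ofReal (mem_ball_zero_iff.1 hx)) hq) _
  refine lt_of_lt_of_le ?_ hle
  rw [setLIntegral_pos_iff hmeas]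
  have hsub : Function.support f ⊆ Function.support g ∩ unitBall n := by
    intro x hx
    refine ⟨?_, hf.tsupport_subset (subset_tsupport f hx)⟩
    refine mul_ne_zero ?_ (ENNReal.rpow_pos_of_exponent_nonpos ENNReal.ofReal_ne_top hq).ne'
    exact (ENNReal.rpow_pos_of_nonneg (enorm_pos.2 hx) hp.le).ne'
  refine lt_of_lt_of_le (IsOpen.measure_pos _ ?_ ?_) (measure_mono hsub)
  · exact isOpen_ne.preimage hf.smooth.continuous
  · exact Function.support_nonempty_iff.2 hf0

/-! ### Cut-off functions with small energy -/

/-- A smooth function equal to `-1` where `1 - |x|² ≥ 2ε` and to `0` where `1 - |x|² ≤ ε`. -/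
def cutoff (n : ℕ) (ε : ℝ) (x : Eu n) : ℝ := -Real.smoothTransition ((1 - ‖x‖ ^ 2) / ε - 1)

lemma exists_deriv_smoothTransition_le :
    ∃ C, 0 ≤ C ∧ ∀ t, deriv Real.smoothTransition t ≤ C := by
  have hc : Continuous (deriv Real.smoothTransition) :=
    (Real.smoothTransition.contDiff (n := 1)).continuous_deriv (by simp)
  have hs : HasCompactSupport (deriv Real.smoothTransition) := by
    refine HasCompactSupport.intro (isCompact_Icc (a := (0 : ℝ)) (b := 1)) fun t ht => ?_
    rw [Set.mem_Icc, not_and_or, not_le, not_le] at ht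
    rcases ht with ht | ht
    · have : Real.smoothTransition =ᶠ[𝓝 t] fun _ => 0 := by
        filter_upwards [eventually_lt_nhds ht] with s hs
        exact Real.smoothTransition.zero_of_nonpos hs.le
      rw [this.deriv_eq, deriv_const]
    · have : Real.smoothTransition =ᶠ[𝓝 t] fun _ => 1 := by
        filter_upwards [eventually_gt_nhds ht] with s hs
        exact Real.smoothTransition.one_of_one_le hs.le
      rw [this.deriv_eq, deriv_const]
  obtain ⟨C, hC⟩ := hc.bounded_above_of_compact_support hs
  exact ⟨C, (norm_nonneg _).trans (hC 0), fun t => (le_abs_self _).trans (hC t)⟩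

lemma contDiff_cutoff (ε : ℝ) : ContDiff ℝ ∞ (cutoff n ε) := by
  have h1 : ContDiff ℝ ∞ (fun x : Eu n => (1 - ‖x‖ ^ 2) / ε - 1) :=
    ((contDiff_const.sub (contDiff_id.norm_sq ℝ)).div_const ε).sub contDiff_const
  exact ((Real.smoothTransition.contDiff (n := ⊤)).comp h1).neg

lemma cutoff_eq_zero {ε : ℝ} (hε : 0 < ε) {x : Eu n} (h : 1 - ‖x‖ ^ 2 ≤ ε) :
    cutoff n ε x = 0 := by
  rw [cutoff, Real.smoothTransition.zero_of_nonpos, neg_zero]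
  rw [sub_nonpos, div_le_one hε]; exact h

lemma cutoff_eq_neg_one {ε : ℝ} (hε : 0 < ε) {x : Eu n} (h : 2 * ε ≤ 1 - ‖x‖ ^ 2) :
    cutoff n ε x = -1 := by
  rw [cutoff, Real.smoothTransition.one_of_one_le]
  rw [le_sub_iff_add_le, le_div_iff₀ hε]; linarith

lemma enorm_cutoff_le_one (ε : ℝ) (x : Eu n) : ‖cutoff n ε x‖ₑ ≤ 1 := by
  rw [← ofReal_norm, cutoff, norm_neg, Real.norm_of_nonneg (Real.smoothTransition.nonneg _)]
  exact ENNReal.ofReal_le_one.2 (Real.smoothTransition.le_one _)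

lemma isTestFunction_cutoff {ε : ℝ} (hε : 0 < ε) : IsTestFunction (unitBall n) (cutoff n ε) := by
  have hsub : tsupport (cutoff n ε) ⊆ {x | ε ≤ 1 - ‖x‖ ^ 2} := by
    refine closure_minimal (fun x hx => ?_) (isClosed_le continuous_const (by fun_prop))
    by_contra h
    exact hx (cutoff_eq_zero hε (not_le.1 h).le)
  have hball : tsupport (cutoff n ε) ⊆ unitBall n := fun x hx => by
    have := hsub hx
    rw [mem_ball_zero_iff]
    simp only [Set.mem_ofPred_eq] at this
    nlinarith [norm_nonneg x]
  refine ⟨contDiff_cutoff ε, ?_, hball⟩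
  exact (isCompact_closedBall (0 : Eu n) 1).of_isClosed_subset (isClosed_tsupport _)
    (hball.trans Metric.ball_subset_closedBall)

lemma cutoff_ne_zero {ε : ℝ} (hε : 0 < ε) (h : 2 * ε ≤ 1) : cutoff n ε ≠ 0 := fun h0 => by
  have h1 := cutoff_eq_neg_one (n := n) hε (x := 0) (by simpa using h)
  rw [h0] at h1
  simp at h1

lemma fderiv_cutoff {ε : ℝ} (x y : Eu n) :
    fderiv ℝ (cutoff n ε) x y =
      deriv Real.smoothTransition ((1 - ‖x‖ ^ 2) / ε - 1) * (2 / ε) * inner ℝ x y := by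
  apply fderiv_apply_eq_of_hasDerivAt_line ((contDiff_cutoff ε).differentiable (by simp) x)
  have h1 : HasDerivAt (fun t : ℝ => (1 - ‖x + t • y‖ ^ 2) / ε - 1)
      (-(2 * inner ℝ x y) / ε) 0 := by
    have := ((((hasDerivAt_line x y 0).norm_sq).const_sub 1).div_const ε).sub_const 1
    simpa using this
  have h2 : HasDerivAt Real.smoothTransition
      (deriv Real.smoothTransition ((1 - ‖x‖ ^ 2) / ε - 1)) ((1 - ‖x + (0 : ℝ) • y‖ ^ 2) / ε - 1) := by
    rw [zero_smul, add_zero]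
    exact ((Real.smoothTransition.contDiff (n := 1)).differentiable (by simp) _).hasDerivAt
  refine (HasDerivAt.comp (0 : ℝ) h2 h1).neg.congr_deriv ?_
  ring

/-- The region near the boundary where the cut-off functions vary. -/
def shell (n : ℕ) (ε : ℝ) : Set (Eu n) := unitBall n ∩ {x | 1 - ‖x‖ ^ 2 ≤ 2 * ε}

lemma measurableSet_shell (ε : ℝ) : MeasurableSet (shell n ε) :=
  measurableSet_ball.inter (isClosed_le (f := fun x : Eu n => 1 - ‖x‖ ^ 2) (by fun_prop)
    continuous_const).measurableSet

lemma berwald_gradient_cutoff_le {C ε : ℝ} (hC0 : 0 ≤ C)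
    (hC : ∀ t, deriv Real.smoothTransition t ≤ C) (hε : 0 < ε) {x : Eu n} (hx : ‖x‖ < 1) :
    berwald n x (gradient (berwald n) (cutoff n ε) x) ≤
      (shell n ε).indicator (fun _ => 8 * C * ε) x := by
  have hc := one_sub_norm_sq_pos hx
  by_cases hs : x ∈ shell n ε
  · rw [Set.indicator_of_mem hs]
    refine berwald_gradient_le hx (by positivity) fun y => ?_
    have hd0 : 0 ≤ deriv Real.smoothTransition ((1 - ‖x‖ ^ 2) / ε - 1) :=
      Real.smoothTransition.monotone.deriv_nonneg
    have hB := berwald_nonneg hx y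
    rw [fderiv_cutoff]
    have hsq : (1 - ‖x‖ ^ 2) ^ 2 ≤ (2 * ε) ^ 2 := pow_le_pow_left₀ hc.le hs.2 2
    -- The cut-off is negative inside, so its differential is a nonnegative multiple of `⟨x,·⟩` and
    -- the outward estimate applies. Slope `2C/ε` times cost `(2ε)²` gives `8Cε`.
    calc _ ≤ deriv Real.smoothTransition ((1 - ‖x‖ ^ 2) / ε - 1) * (2 / ε) *
            ((1 - ‖x‖ ^ 2) ^ 2 * berwald n x y) := by
          gcongr; exact inner_le_mul_berwald hx y
      _ ≤ C * (2 / ε) * ((2 * ε) ^ 2 * berwald n x y) := by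
          gcongr; exact hC _
      _ = _ := by field_simp; ring
  · rw [Set.indicator_of_notMem hs]
    refine berwald_gradient_le hx le_rfl fun y => ?_
    have hlt : 2 * ε < 1 - ‖x‖ ^ 2 := by
      by_contra! h
      exact hs ⟨mem_ball_zero_iff.2 hx, h⟩
    have : cutoff n ε =ᶠ[𝓝 x] fun _ => -1 := by
      have hcont : Continuous fun x : Eu n => 1 - ‖x‖ ^ 2 := by fun_prop
      filter_upwards [hcont.continuousAt.eventually (eventually_gt_nhds hlt)] with z hz
      exact cutoff_eq_neg_one hε hz.le
    rw [this.fderiv_eq]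
    simp

lemma energy_cutoff_le {C ε p : ℝ} (hC0 : 0 ≤ C)
    (hC : ∀ t, deriv Real.smoothTransition t ≤ C) (hε : 0 < ε) (hp : 0 < p) :
    energy (unitBall n) (berwald n) p (cutoff n ε) ≤
      ENNReal.ofReal (8 * C * ε) ^ p * volume (shell n ε) := by
  calc energy (unitBall n) (berwald n) p (cutoff n ε)
      ≤ ∫⁻ x in unitBall n, (shell n ε).indicator (fun _ => ENNReal.ofReal (8 * C * ε) ^ p) x := by
        refine setLIntegral_mono_ae' measurableSet_ball (Eventually.of_forall fun x hx => ?_)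
        have h := berwald_gradient_cutoff_le hC0 hC hε (mem_ball_zero_iff.1 hx)
        by_cases hs : x ∈ shell n ε
        · rw [Set.indicator_of_mem hs] at h ⊢
          exact ENNReal.rpow_le_rpow (ENNReal.ofReal_le_ofReal h) hp.le
        · rw [Set.indicator_of_notMem hs] at h ⊢
          rw [ENNReal.ofReal_of_nonpos h, ENNReal.zero_rpow_of_pos hp]
    _ ≤ _ := by
        refine (setLIntegral_le_lintegral _ _).trans ?_
        rw [lintegral_indicator (measurableSet_shell ε), setLIntegral_const]

/-- On the half ball the cut-off is `-1`, since `2ε ≤ 1/2 < 3/4 < 1 - |x|²`, and `r ≤ 1`, so a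
nonpositive power of `r` is at least one. -/
lemma volume_ball_half_le_weighted_cutoff {ε p q : ℝ} (hε : 0 < ε) (hε' : ε ≤ 1 / 4)
    (hq : q ≤ 0) :
    volume (Metric.ball (0 : Eu n) (1 / 2)) ≤ weighted (unitBall n) (berwald n) p q (cutoff n ε) := by
  have hsub : Metric.ball (0 : Eu n) (1 / 2) ⊆ unitBall n := Metric.ball_subset_ball (by norm_num)
  calc volume (Metric.ball (0 : Eu n) (1 / 2)) = ∫⁻ _ in Metric.ball (0 : Eu n) (1 / 2), 1 := by
        simp
    _ ≤ ∫⁻ x in Metric.ball (0 : Eu n) (1 / 2),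
          ‖cutoff n ε x‖ₑ ^ p * edist (unitBall n) (berwald n) 0 x ^ q := by
        refine setLIntegral_mono_ae' measurableSet_ball (Eventually.of_forall fun x hx => ?_)
        have hx' : ‖x‖ < 1 / 2 := mem_ball_zero_iff.1 hx
        rw [cutoff_eq_neg_one hε (by nlinarith [norm_nonneg x])]
        have h1 : edist (unitBall n) (berwald n) 0 x ≤ 1 := by
          refine (edist_le_ofReal (by linarith)).trans (ENNReal.ofReal_le_one.2 ?_)
          rw [div_le_one (by linarith)]; linarith
        have := ENNReal.rpow_le_rpow_of_exponent_nonpos h1 hq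
        simpa using this
    _ ≤ _ := lintegral_mono_set hsub

lemma weighted_cutoff_le_of_nonpos {ε p q : ℝ} (hp : 0 < p) :
    weighted (unitBall n) (berwald n) p q (cutoff n ε) ≤
      ∫⁻ x in unitBall n, edist (unitBall n) (berwald n) 0 x ^ q := by
  refine lintegral_mono fun x => ?_
  calc _ ≤ 1 ^ p * edist (unitBall n) (berwald n) 0 x ^ q := by
        gcongr; exact enorm_cutoff_le_one ε x
    _ = _ := by simp

/-- Where the cut-off does not vanish, `1 - |x|² > ε`, whence `r ≤ |x|/(1-|x|) ≤ 2/ε`. -/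
lemma weighted_cutoff_le_of_nonneg {ε p q : ℝ} (hε : 0 < ε) (hp : 0 < p) (hq : 0 ≤ q) :
    weighted (unitBall n) (berwald n) p q (cutoff n ε) ≤
      ENNReal.ofReal (2 / ε) ^ q * volume (unitBall n) := by
  rw [← setLIntegral_const]
  refine setLIntegral_mono_ae' measurableSet_ball (Eventually.of_forall fun x hx => ?_)
  have hx' := mem_ball_zero_iff.1 hx
  by_cases h0 : 1 - ‖x‖ ^ 2 ≤ ε
  · simp [cutoff_eq_zero hε h0, ENNReal.zero_rpow_of_pos hp]
  · calc _ ≤ 1 ^ p * ENNReal.ofReal (2 / ε) ^ q := by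
          gcongr
          · exact enorm_cutoff_le_one ε x
          · refine (edist_le_ofReal hx').trans (ENNReal.ofReal_le_ofReal ?_)
            rw [div_le_div_iff₀ (by linarith) hε]
            nlinarith [norm_nonneg x]
      _ = _ := by simp

lemma neg_lt_conjExponent_mul {p s : ℝ} (hp : 1 < p) (hs : -p + 1 < s) :
    -p < Real.conjExponent p * s := by
  unfold Real.conjExponent
  rw [div_mul_eq_mul_div, lt_div_iff₀ (by linarith)]
  nlinarith

/-- The growth is at most of order `(2/ε)^s` when `s ≥ 0` and bounded when `s ≤ 0`; `s ≤ 1` makes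
`2/ε` sufficient in both cases, exactly what the factor `ε` in the energy can absorb. -/
lemma exists_weighted_cutoff_rpow_le (hn : 1 ≤ n) {p s : ℝ} (hp : 1 < p) (hpn : p < n)
    (hs : -p + 1 < s) (hs1 : s ≤ 1) :
    ∃ A : ℝ≥0∞, A ≠ ⊤ ∧ ∀ ε, 0 < ε → ε ≤ 1 / 4 →
      weighted (unitBall n) (berwald n) p (Real.conjExponent p * s) (cutoff n ε) ^
        (1 / Real.conjExponent p) ≤ ENNReal.ofReal (2 / ε) * A := by
  have hp' : 0 < Real.conjExponent p := by
    unfold Real.conjExponent; exact div_pos (by linarith) (by linarith)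
  have hi : 0 ≤ 1 / Real.conjExponent p := by positivity
  rcases le_total s 0 with h0 | h0
  · refine ⟨(∫⁻ x in unitBall n, edist (unitBall n) (berwald n) 0 x ^
      (Real.conjExponent p * s)) ^ (1 / Real.conjExponent p), ?_, fun ε hε hε4 => ?_⟩
    · refine ENNReal.rpow_ne_top_of_nonneg hi (lintegral_edist_rpow_lt_top hn
        (mul_nonpos_of_nonneg_of_nonpos hp'.le h0) ?_).ne
      linarith [neg_lt_conjExponent_mul hp hs]
    · have h1 : 1 ≤ ENNReal.ofReal (2 / ε) := by
        rw [ENNReal.one_le_ofReal, le_div_iff₀ hε]; linarith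
      calc _ ≤ _ := ENNReal.rpow_le_rpow (weighted_cutoff_le_of_nonpos (by linarith)) hi
        _ = 1 * _ := (one_mul _).symm
        _ ≤ _ := by gcongr
  · refine ⟨volume (unitBall n) ^ (1 / Real.conjExponent p),
      ENNReal.rpow_ne_top_of_nonneg hi volume_unitBall_lt_top.ne, fun ε hε hε4 => ?_⟩
    have h1 : 1 ≤ ENNReal.ofReal (2 / ε) := by
      rw [ENNReal.one_le_ofReal, le_div_iff₀ hε]; linarith
    refine (ENNReal.rpow_le_rpow (weighted_cutoff_le_of_nonneg hε (by linarith)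
      (mul_nonneg hp'.le h0)) hi).trans ?_
    rw [ENNReal.mul_rpow_of_nonneg _ _ hi, ← ENNReal.rpow_mul]
    have e : Real.conjExponent p * s * (1 / Real.conjExponent p) = s := by field_simp
    rw [e]
    gcongr
    calc ENNReal.ofReal (2 / ε) ^ s ≤ ENNReal.ofReal (2 / ε) ^ (1 : ℝ) :=
          ENNReal.rpow_le_rpow_of_exponent_le h1 hs1
      _ = _ := ENNReal.rpow_one _

/-- The widths of a sequence of cut-off functions. -/
def cutoffWidth (k : ℕ) : ℝ := 1 / (4 * ((k : ℝ) + 1))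

lemma cutoffWidth_pos (k : ℕ) : 0 < cutoffWidth k := by unfold cutoffWidth; positivity

lemma cutoffWidth_le (k : ℕ) : cutoffWidth k ≤ 1 / 4 := by
  unfold cutoffWidth
  gcongr
  linarith [(Nat.cast_nonneg k : (0 : ℝ) ≤ k)]

lemma tendsto_cutoffWidth : Tendsto cutoffWidth atTop (𝓝 0) := by
  have h := (tendsto_one_div_add_atTop_nhds_zero_nat (𝕜 := ℝ)).const_mul (1 / 4)
  rw [mul_zero] at h
  refine h.congr fun k => ?_
  unfold cutoffWidth
  field_simp

lemma tendsto_volume_shell : Tendsto (fun k => volume (shell n (cutoffWidth k))) atTop (𝓝 0) := by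
  have hanti : Antitone fun k => shell n (cutoffWidth k) := by
    intro i j hij x hx
    have h : 1 - ‖x‖ ^ 2 ≤ 2 * cutoffWidth j := hx.2
    refine ⟨hx.1, ?_⟩
    change 1 - ‖x‖ ^ 2 ≤ 2 * cutoffWidth i
    refine h.trans ?_
    unfold cutoffWidth
    gcongr
  have h := tendsto_measure_iInter_atTop (μ := volume)
    (fun k => (measurableSet_shell (n := n) (cutoffWidth k)).nullMeasurableSet) hanti
    ⟨0, ((measure_mono (fun x hx => hx.1)).trans_lt volume_unitBall_lt_top).ne⟩
  have hempty : ⋂ k, shell n (cutoffWidth k) = ∅ := by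
    rw [Set.eq_empty_iff_forall_notMem]
    intro x hx
    rw [Set.mem_iInter] at hx
    have h1 := one_sub_norm_sq_pos (mem_ball_zero_iff.1 (hx 0).1)
    have h2 : 1 - ‖x‖ ^ 2 ≤ 2 * 0 :=
      ge_of_tendsto' (tendsto_cutoffWidth.const_mul 2) fun k => (hx k).2
    linarith
  rw [hempty, measure_empty] at h
  exact h

lemma iInf_testFunction_eq_zero {Q : (Eu n → ℝ) → ℝ≥0∞} {B : ℕ → ℝ≥0∞}
    (hB : Tendsto B atTop (𝓝 0)) (hQ : ∀ k, Q (cutoff n (cutoffWidth k)) ≤ B k) :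
    ⨅ (f : Eu n → ℝ) (_ : IsTestFunction (unitBall n) f) (_ : f ≠ 0), Q f = 0 := by
  refine le_antisymm (ge_of_tendsto' hB fun k => ?_) bot_le
  refine (iInf₂_le (cutoff n (cutoffWidth k)) (isTestFunction_cutoff (cutoffWidth_pos k))).trans ?_
  exact (iInf_le _ (cutoff_ne_zero (cutoffWidth_pos k) (by linarith [cutoffWidth_le k]))).trans
    (hQ k)

theorem iInf_hardy_quotient_eq_zero {p : ℝ} (hp : 1 < p) :
    ⨅ (f : Eu n → ℝ) (_ : IsTestFunction (unitBall n) f) (_ : f ≠ 0),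
      energy (unitBall n) (berwald n) p f / weighted (unitBall n) (berwald n) p (-p) f = 0 := by
  obtain ⟨C, hC0, hC⟩ := exists_deriv_smoothTransition_le
  have hp0 : 0 < p := by linarith
  set V := volume (Metric.ball (0 : Eu n) (1 / 2)) with hV
  have hV0 : V ≠ 0 := (Metric.measure_ball_pos volume _ (by norm_num)).ne'
  refine iInf_testFunction_eq_zero
    (B := fun k => ENNReal.ofReal (8 * C) ^ p * volume (shell n (cutoffWidth k)) / V) ?_ fun k => ?_
  · have h := ENNReal.Tendsto.div_const (ENNReal.Tendsto.const_mul (a := ENNReal.ofReal (8 * C) ^ p)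
      (tendsto_volume_shell (n := n))
      (Or.inr (ENNReal.rpow_ne_top_of_nonneg hp0.le ENNReal.ofReal_ne_top))) (b := V) (Or.inr hV0)
    simpa using h
  · have h0 := cutoffWidth_pos k
    have h4 := cutoffWidth_le k
    refine ENNReal.div_le_div ((energy_cutoff_le hC0 hC h0 hp0).trans ?_)
      (volume_ball_half_le_weighted_cutoff h0 h4 (by linarith))
    gcongr ENNReal.ofReal ?_ ^ p * _
    -- The gain of a factor `ε` is discarded here: the vanishing volume of the shell is enough.
    exact mul_le_of_le_one_right (by positivity) (by linarith)

theorem iInf_uncertainty_quotient_eq_zero (hn : 1 ≤ n) {p s : ℝ} (hp : 1 < p) (hpn : p < n)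
    (hs : -p + 1 < s) (hs1 : s ≤ 1) :
    ⨅ (f : Eu n → ℝ) (_ : IsTestFunction (unitBall n) f) (_ : f ≠ 0),
      energy (unitBall n) (berwald n) p f ^ (1 / p) *
        weighted (unitBall n) (berwald n) p (Real.conjExponent p * s) f ^
          (1 / Real.conjExponent p) /
        weighted (unitBall n) (berwald n) p (s - 1) f = 0 := by
  obtain ⟨C, hC0, hC⟩ := exists_deriv_smoothTransition_le
  obtain ⟨A, hA, hW⟩ := exists_weighted_cutoff_rpow_le hn hp hpn hs hs1
  have hp0 : 0 < p := by linarith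
  have hip : 0 < 1 / p := by positivity
  set V := volume (Metric.ball (0 : Eu n) (1 / 2)) with hV
  have hV0 : V ≠ 0 := (Metric.measure_ball_pos volume _ (by norm_num)).ne'
  refine iInf_testFunction_eq_zero (B := fun k => ENNReal.ofReal (16 * C) * A *
    volume (shell n (cutoffWidth k)) ^ (1 / p) / V) ?_ fun k => ?_
  · have h1 := ENNReal.Tendsto.const_mul (a := ENNReal.ofReal (16 * C) * A)
      ((tendsto_volume_shell (n := n)).ennrpow_const (1 / p))
      (Or.inr (ENNReal.mul_ne_top ENNReal.ofReal_ne_top hA))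
    have h := ENNReal.Tendsto.div_const h1 (b := V) (Or.inr hV0)
    simpa [ENNReal.zero_rpow_of_pos hip, hp0] using h
  · have h0 := cutoffWidth_pos k
    have h4 := cutoffWidth_le k
    refine ENNReal.div_le_div ?_ (volume_ball_half_le_weighted_cutoff h0 h4 (by linarith))
    calc _ ≤ (ENNReal.ofReal (8 * C * cutoffWidth k) ^ p *
            volume (shell n (cutoffWidth k))) ^ (1 / p) *
              (ENNReal.ofReal (2 / cutoffWidth k) * A) := by
          gcongr
          · exact energy_cutoff_le hC0 hC h0 hp0
          · exact hW _ h0 h4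
      _ = (ENNReal.ofReal (8 * C * cutoffWidth k) * ENNReal.ofReal (2 / cutoffWidth k)) * A *
            volume (shell n (cutoffWidth k)) ^ (1 / p) := by
          rw [ENNReal.mul_rpow_of_nonneg _ _ hip.le, ← ENNReal.rpow_mul, mul_one_div_cancel hp0.ne',
            ENNReal.rpow_one]
          ring
      _ = _ := by
          -- The widths cancel, and the decay comes from the shell volume alone.
          have e : 8 * C * cutoffWidth k * (2 / cutoffWidth k) = 16 * C := by field_simp; ring
          rw [← ENNReal.ofReal_mul (by positivity), e]

/-! ### Weak differentials -/

lemma IsTestFunction.integrable_smul {W : Type*} [NormedAddCommGroup W] [NormedSpace ℝ W]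
    {U : Set (Eu n)} {φ : Eu n → ℝ} (hφ : IsTestFunction U φ) {ξ : Eu n → W}
    (hξ : LocallyIntegrableOn ξ U volume) : Integrable (fun x => φ x • ξ x) := by
  have hsupp : Function.support (fun x => φ x • ξ x) ⊆ tsupport φ :=
    (Function.support_smul_subset_left φ ξ).trans (subset_tsupport φ)
  rw [← integrableOn_iff_integrable_of_support_subset hsupp]
  exact (hξ.integrableOn_compact_subset hφ.tsupport_subset hφ.hasCompactSupport).continuousOn_smul
    hφ.smooth.continuous.continuousOn hφ.hasCompactSupport

/-- Integration by parts over the whole space: the test function has compact support in `U`, so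
nothing is required of `u` outside `U`. -/
lemma hasWeakDifferential_of_contDiffOn {U : Set (Eu n)} (hU : IsOpen U) {u : Eu n → ℝ}
    (hu : ContDiffOn ℝ 1 u U) : HasWeakDifferential U u (fderiv ℝ u) := by
  have hd : LocallyIntegrableOn (fderiv ℝ u) U volume :=
    (hu.continuousOn_fderiv_of_isOpen hU le_rfl).locallyIntegrableOn hU.measurableSet
  have hl : LocallyIntegrableOn u U volume :=
    hu.continuousOn.locallyIntegrableOn hU.measurableSet
  refine ⟨hl, hd, fun φ hφ v => ?_⟩
  have hφ0 : ∀ x ∉ U, φ x = 0 := fun x hx =>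
    image_eq_zero_of_notMem_tsupport fun h => hx (hφ.tsupport_subset h)
  have hφ0' : ∀ x ∉ U, fderiv ℝ φ x v = 0 := fun x hx => by
    rw [fderiv_of_notMem_tsupport ℝ fun h => hx (hφ.tsupport_subset h)]; rfl
  rw [setIntegral_eq_integral_of_forall_compl_eq_zero fun x hx => by rw [hφ0' x hx, mul_zero],
    setIntegral_eq_integral_of_forall_compl_eq_zero fun x hx => by rw [hφ0 x hx, mul_zero]]
  have hdv : IsTestFunction U (fun x => fderiv ℝ φ x v) := by
    have hsub : tsupport (fun x => fderiv ℝ φ x v) ⊆ tsupport φ :=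
      tsupport_fderiv_apply_subset ℝ v
    exact ⟨(hφ.smooth.fderiv_right (by simp)).clm_apply contDiff_const,
      hφ.hasCompactSupport.of_isClosed_subset (isClosed_tsupport _) hsub,
      hsub.trans hφ.tsupport_subset⟩
  refine integral_mul_fderiv_eq_neg_fderiv_mul_of_integrable ?_ ?_ ?_ (fun x hx => ?_)
    fun x _ => hφ.smooth.differentiable (by simp) x
  · have := (hφ.integrable_smul hd).apply_continuousLinearMap v
    simpa [mul_comm] using this
  · simpa [mul_comm] using hdv.integrable_smul hl
  · simpa [mul_comm] using hφ.integrable_smul hl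
  · exact (hu.contDiffAt (hU.mem_nhds (hφ.tsupport_subset hx))).differentiableAt (by simp)

lemma HasWeakDifferential.congr {U : Set (Eu n)} {u w : Eu n → ℝ}
    {ξ : Eu n → Eu n →L[ℝ] ℝ} (h : HasWeakDifferential U u ξ)
    (huw : u =ᵐ[volume.restrict U] w) : HasWeakDifferential U w ξ := by
  refine ⟨h.locallyIntegrable.congr huw, h.locallyIntegrable_differential, fun φ hφ v => ?_⟩
  rw [← h.integral_eq φ hφ v]
  refine integral_congr_ae ?_
  filter_upwards [huw] with x hx
  rw [hx]

/-- By the fundamental lemma of the calculus of variations. It lets an arbitrary weak differential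
of `(1-|x|²)^α` be replaced by the classical one. -/
lemma HasWeakDifferential.ae_eq {U : Set (Eu n)} (hU : IsOpen U) {u : Eu n → ℝ}
    {ξ ξ' : Eu n → Eu n →L[ℝ] ℝ} (h : HasWeakDifferential U u ξ)
    (h' : HasWeakDifferential U u ξ') : ∀ᵐ x, x ∈ U → ξ x = ξ' x := by
  have hloc : LocallyIntegrableOn (fun x => ξ x - ξ' x) U volume :=
    h.locallyIntegrable_differential.sub h'.locallyIntegrable_differential
  have key := hU.ae_eq_zero_of_integral_contDiff_smul_eq_zero hloc fun g hg hgc hgU => by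
    have hgt : IsTestFunction U g := ⟨hg, hgc, hgU⟩
    have hi := hgt.integrable_smul h.locallyIntegrable_differential
    have hi' := hgt.integrable_smul h'.locallyIntegrable_differential
    have hg0 : ∀ x ∉ U, g x = 0 := fun x hx =>
      image_eq_zero_of_notMem_tsupport fun hm => hx (hgU hm)
    have e : ∀ v, ∫ x, (g x • ξ x) v = ∫ x, (g x • ξ' x) v := fun v => by
      have e1 := h.integral_eq g hgt v
      rw [h'.integral_eq g hgt v, neg_inj] at e1
      rw [setIntegral_eq_integral_of_forall_compl_eq_zero fun x hx => by rw [hg0 x hx, mul_zero],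
        setIntegral_eq_integral_of_forall_compl_eq_zero
          fun x hx => by rw [hg0 x hx, mul_zero]] at e1
      simp only [smul_apply, smul_eq_mul, mul_comm (g _)]
      exact e1.symm
    simp only [smul_sub]
    rw [integral_sub hi hi', sub_eq_zero]
    ext v
    rw [ContinuousLinearMap.integral_apply hi, ContinuousLinearMap.integral_apply hi', e]
  filter_upwards [key] with x hx hxU
  exact sub_eq_zero.1 (hx hxU)

lemma coMetric_le {F : Eu n → Eu n → ℝ} {x : Eu n} {η : Eu n →L[ℝ] ℝ} {M : ℝ}
    (hF : ∀ y, y ≠ 0 → 0 < F x y) (h : ∀ y, η y ≤ M * F x y) :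
    coMetric F x η ≤ ENNReal.ofReal M :=
  iSup₂_le fun y hy => ENNReal.ofReal_le_ofReal ((div_le_iff₀ (hF y hy)).2 (h y))

lemma le_coMetric (F : Eu n → Eu n → ℝ) (x : Eu n) (η : Eu n →L[ℝ] ℝ) {y : Eu n} (hy : y ≠ 0) :
    ENNReal.ofReal (η y / F x y) ≤ coMetric F x η :=
  le_iSup₂_of_le y hy le_rfl

/-! ### A smooth truncation from below -/

/-- A smooth convex function that vanishes on `(-∞, 1]` and has slope one on `[2, ∞)`. -/
def softShift (s : ℝ) : ℝ := ∫ t in (0 : ℝ)..s, Real.smoothTransition (t - 1)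

lemma hasDerivAt_softShift (s : ℝ) :
    HasDerivAt softShift (Real.smoothTransition (s - 1)) s := by
  have hc : Continuous fun t : ℝ => Real.smoothTransition (t - 1) :=
    Real.smoothTransition.continuous.comp (by fun_prop)
  exact (hc.integral_hasStrictDerivAt 0 s).hasDerivAt

lemma contDiff_softShift : ContDiff ℝ ∞ softShift := by
  refine contDiff_infty_iff_deriv.2 ⟨fun s => (hasDerivAt_softShift s).differentiableAt, ?_⟩
  have : deriv softShift = fun s => Real.smoothTransition (s - 1) :=
    funext fun s => (hasDerivAt_softShift s).deriv
  rw [this]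
  exact (Real.smoothTransition.contDiff (n := ⊤)).comp (contDiff_id.sub contDiff_const)

lemma softShift_zero : softShift 0 = 0 := by simp [softShift]

lemma softShift_eq_zero {s : ℝ} (hs : s ≤ 1) : softShift s = 0 := by
  have h : ∀ t ∈ Set.Iic (1 : ℝ), HasDerivWithinAt softShift 0 (Set.Iic 1) t := fun t ht => by
    have := (hasDerivAt_softShift t).hasDerivWithinAt (s := Set.Iic 1)
    rwa [Real.smoothTransition.zero_of_nonpos (by linarith [Set.mem_Iic.1 ht])] at this
  rw [(convex_Iic 1).eq_of_hasDerivWithinAt_zero h (Set.mem_Iic.2 zero_le_one) (Set.mem_Iic.2 hs),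
    softShift_zero]

lemma softShift_monotone : Monotone softShift :=
  monotone_of_deriv_nonneg (fun s => (hasDerivAt_softShift s).differentiableAt) fun s => by
    rw [(hasDerivAt_softShift s).deriv]; exact Real.smoothTransition.nonneg _

/-- The difference vanishes at `0`, is nondecreasing, is at most `2` at `2`, and is constant from
there on. -/
lemma abs_sub_softShift_le {s : ℝ} (hs : 0 ≤ s) : |s - softShift s| ≤ 2 := by
  have hd : ∀ t, HasDerivAt (fun t => t - softShift t) (1 - Real.smoothTransition (t - 1)) t :=
    fun t => (hasDerivAt_id t).sub (hasDerivAt_softShift t)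
  have hmono : Monotone fun t => t - softShift t :=
    monotone_of_deriv_nonneg (fun t => (hd t).differentiableAt) fun t => by
      rw [(hd t).deriv]; linarith [Real.smoothTransition.le_one (t - 1)]
  have h0 : 0 ≤ s - softShift s := by simpa [softShift_zero] using hmono hs
  have h2 : 2 - softShift 2 ≤ 2 := by
    have := softShift_monotone (show (0 : ℝ) ≤ 2 by norm_num)
    rw [softShift_zero] at this; linarith
  rw [abs_of_nonneg h0]
  rcases le_total s 2 with h | h
  · exact (hmono h).trans h2
  · have hz : ∀ t ∈ Set.Ici (2 : ℝ),
        HasDerivWithinAt (fun t => t - softShift t) 0 (Set.Ici 2) t := fun t ht => by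
      have := (hd t).hasDerivWithinAt (s := Set.Ici 2)
      rwa [Real.smoothTransition.one_of_one_le (by linarith [Set.mem_Ici.1 ht]), sub_self] at this
    have := (convex_Ici 2).eq_of_hasDerivWithinAt_zero hz Set.self_mem_Ici (Set.mem_Ici.2 h)
    exact this.le.trans h2

/-! ### The Sobolev space is not symmetric -/

/-- The power `(1 - |x|²)₊ ^ α` of the defining function of the ball. -/
def defPow (n : ℕ) (α : ℝ) (x : Eu n) : ℝ := max (1 - ‖x‖ ^ 2) 0 ^ α

lemma defPow_nonneg (α : ℝ) (x : Eu n) : 0 ≤ defPow n α x :=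
  Real.rpow_nonneg (le_max_right _ _) _

lemma continuous_defPow {α : ℝ} (hα : 0 ≤ α) : Continuous (defPow n α) :=
  Continuous.rpow_const (by fun_prop) fun _ => Or.inr hα

lemma defPow_eventuallyEq {α : ℝ} {x : Eu n} (hx : ‖x‖ < 1) :
    defPow n α =ᶠ[𝓝 x] fun z => (1 - ‖z‖ ^ 2) ^ α := by
  filter_upwards [eventually_norm_lt_one hx] with z hz
  rw [defPow, max_eq_left (one_sub_norm_sq_pos hz).le]

lemma contDiffAt_defPow {α : ℝ} {x : Eu n} (hx : ‖x‖ < 1) : ContDiffAt ℝ ∞ (defPow n α) x := by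
  refine ContDiffAt.congr_of_eventuallyEq ?_ (defPow_eventuallyEq hx)
  exact (contDiffAt_const.sub (contDiffAt_id.norm_sq ℝ)).rpow_const_of_ne
    (one_sub_norm_sq_pos hx).ne'

lemma fderiv_defPow {α : ℝ} {x : Eu n} (hx : ‖x‖ < 1) (y : Eu n) :
    fderiv ℝ (defPow n α) x y = -(2 * α * (1 - ‖x‖ ^ 2) ^ (α - 1) * inner ℝ x y) := by
  apply fderiv_apply_eq_of_hasDerivAt_line ((contDiffAt_defPow hx).differentiableAt (by simp))
  have hc := one_sub_norm_sq_pos hx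
  have h1 : HasDerivAt (fun t : ℝ => 1 - ‖x + t • y‖ ^ 2) (-(2 * inner ℝ x y)) 0 := by
    simpa using ((hasDerivAt_line x y 0).norm_sq).const_sub 1
  have h2 := h1.rpow_const (p := α) (Or.inl (by simpa using hc.ne'))
  refine (h2.congr_of_eventuallyEq ?_).congr_deriv ?_
  · filter_upwards [eventually_line_norm_lt_one hx y] with t ht
    rw [defPow, max_eq_left (one_sub_norm_sq_pos ht).le]
  · simp only [zero_smul, add_zero]; ring

/-- Smooth truncations of `-(1 - |x|²)₊ ^ α` near the boundary. -/
def truncation (n : ℕ) (α δ : ℝ) (x : Eu n) : ℝ := -(δ * softShift (defPow n α x / δ))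

lemma isTestFunction_truncation {α δ : ℝ} (hα : 0 < α) (hδ : 0 < δ) :
    IsTestFunction (unitBall n) (truncation n α δ) := by
  have hzero : ∀ x, defPow n α x ≤ δ → truncation n α δ x = 0 := fun x hx => by
    rw [truncation, softShift_eq_zero ((div_le_one hδ).2 hx), mul_zero, neg_zero]
  have hsub : tsupport (truncation n α δ) ⊆ {x | δ ≤ defPow n α x} := by
    refine closure_minimal (fun x hx => ?_)
      (isClosed_le continuous_const (continuous_defPow hα.le))
    by_contra h
    exact hx (hzero x (not_le.1 h).le)
  have hout : ∀ x : Eu n, ¬ ‖x‖ < 1 → defPow n α x = 0 := fun x hx => by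
    rw [defPow, max_eq_right (by nlinarith [not_lt.1 hx]), Real.zero_rpow hα.ne']
  have hball : tsupport (truncation n α δ) ⊆ unitBall n := fun x hx => by
    rw [mem_ball_zero_iff]
    by_contra h
    have h1 : δ ≤ defPow n α x := hsub hx
    rw [hout x h] at h1
    linarith
  refine ⟨contDiff_iff_contDiffAt.2 fun x => ?_, ?_, hball⟩
  · by_cases hx : ‖x‖ < 1
    · have h1 : ContDiffAt ℝ ∞ (fun x => defPow n α x / δ) x := (contDiffAt_defPow hx).div_const δ
      have h2 : ContDiffAt ℝ ∞ (fun x => softShift (defPow n α x / δ)) x :=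
        contDiff_softShift.contDiffAt.comp x h1
      exact (contDiffAt_const.mul h2).neg
    -- The power need not be smooth at the sphere, but it is below `δ` there, where the truncation
    -- vanishes.
    · have : truncation n α δ =ᶠ[𝓝 x] fun _ => 0 := by
        have hlt : defPow n α x < δ := by rw [hout x hx]; exact hδ
        filter_upwards [(continuous_defPow hα.le).continuousAt.eventually
          (eventually_lt_nhds hlt)] with z hz
        exact hzero z hz.le
      exact contDiffAt_const.congr_of_eventuallyEq this
  · exact (isCompact_closedBall (0 : Eu n) 1).of_isClosed_subset (isClosed_tsupport _)
      (hball.trans Metric.ball_subset_closedBall)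

lemma fderiv_truncation {α δ : ℝ} (hδ : 0 < δ) {x : Eu n} (hx : ‖x‖ < 1) (y : Eu n) :
    fderiv ℝ (truncation n α δ) x y =
      -(Real.smoothTransition (defPow n α x / δ - 1) * fderiv ℝ (defPow n α) x y) := by
  have h1 := ((contDiffAt_defPow (α := α) hx).differentiableAt (by simp)).hasFDerivAt
  have h2 := (hasDerivAt_softShift (defPow n α x / δ)).comp_hasFDerivAt x (h1.mul_const δ⁻¹)
  have h3 : HasFDerivAt (truncation n α δ) _ x := (h2.const_mul δ).neg
  rw [h3.fderiv]
  simp only [neg_apply, smul_apply, smul_eq_mul]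
  field_simp

lemma enorm_defPow_sub_truncation_le {α δ : ℝ} (hδ : 0 < δ) (x : Eu n) :
    ‖-defPow n α x - truncation n α δ x‖ₑ ≤ ENNReal.ofReal (2 * δ) := by
  rw [← ofReal_norm]
  refine ENNReal.ofReal_le_ofReal ?_
  have h := abs_sub_softShift_le (div_nonneg (defPow_nonneg α x) hδ.le)
  have e : -defPow n α x - truncation n α δ x =
      -(δ * (defPow n α x / δ - softShift (defPow n α x / δ))) := by
    rw [truncation]; field_simp; ring
  rw [e, norm_neg, norm_mul, Real.norm_of_nonneg hδ.le, Real.norm_eq_abs]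
  nlinarith

/-- With `ρ = 1 - |x|²` and `S` the slope of the shift, the difference of differentials is
`(1-S)·2αρ^(α-1)⟨x,·⟩`, again a nonnegative multiple of `⟨x,·⟩`. The outward estimate supplies `ρ²`,
leaving `2αρ(1-S)ρ^α`. -/
lemma coMetric_defPow_sub_truncation_le {α δ : ℝ} (hα : 0 < α) (hα1 : α ≤ 1) (hδ : 0 < δ)
    {x : Eu n} (hx : ‖x‖ < 1) :
    coMetric (berwald n) x (fderiv ℝ (fun z => -defPow n α z) x - fderiv ℝ (truncation n α δ) x) ≤
      ENNReal.ofReal (4 * δ) := by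
  refine coMetric_le (fun y hy => berwald_pos hx hy) fun y => ?_
  have hc := one_sub_norm_sq_pos hx
  have hc1 : 1 - ‖x‖ ^ 2 ≤ 1 := by nlinarith [norm_nonneg x]
  have hB := berwald_nonneg hx y
  set S := Real.smoothTransition (defPow n α x / δ - 1) with hS
  have hS1 : S ≤ 1 := Real.smoothTransition.le_one _
  have hS0 : 0 ≤ S := Real.smoothTransition.nonneg _
  have hpow : 0 ≤ (1 - ‖x‖ ^ 2) ^ (α - 1) := Real.rpow_nonneg hc.le _
  have e : (fderiv ℝ (fun z => -defPow n α z) x - fderiv ℝ (truncation n α δ) x) y =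
      (1 - S) * (2 * α * (1 - ‖x‖ ^ 2) ^ (α - 1)) * inner ℝ x y := by
    rw [sub_apply, fderiv_fun_neg, neg_apply, fderiv_truncation hδ hx, fderiv_defPow hx]
    ring
  have hρ : (1 - ‖x‖ ^ 2) ^ (α - 1) * (1 - ‖x‖ ^ 2) ^ 2 = (1 - ‖x‖ ^ 2) * defPow n α x := by
    rw [defPow, max_eq_left hc.le, Real.rpow_sub_one hc.ne']
    field_simp
  -- The factor `1 - S` is zero as soon as the power reaches `2δ`.
  have hmain : (1 - S) * defPow n α x ≤ 2 * δ := by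
    have h0 := defPow_nonneg α x
    rcases le_total (defPow n α x) (2 * δ) with h | h
    · nlinarith
    · have : S = 1 := Real.smoothTransition.one_of_one_le (by
        rw [le_sub_iff_add_le, le_div_iff₀ hδ]; linarith)
      rw [this]; nlinarith
  have hmain0 : 0 ≤ (1 - S) * defPow n α x := mul_nonneg (by linarith) (defPow_nonneg α x)
  rw [e]
  calc (1 - S) * (2 * α * (1 - ‖x‖ ^ 2) ^ (α - 1)) * inner ℝ x y
      ≤ (1 - S) * (2 * α * (1 - ‖x‖ ^ 2) ^ (α - 1)) * ((1 - ‖x‖ ^ 2) ^ 2 * berwald n x y) := by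
        have : 0 ≤ 1 - S := by linarith
        gcongr
        exact inner_le_mul_berwald hx y
    _ = 2 * (α * (1 - ‖x‖ ^ 2)) * ((1 - S) * defPow n α x) * berwald n x y := by
        linear_combination (1 - S) * (2 * α) * berwald n x y * hρ
    _ ≤ 2 * 1 * (2 * δ) * berwald n x y := by
        gcongr
        exact mul_le_one₀ hα1 hc.le hc1
    _ = 4 * δ * berwald n x y := by ring

/-- The class of `-(1 - |x|²)₊ ^ α`. -/
def negPowClass (n : ℕ) {α : ℝ} (hα : 0 ≤ α) : Eu n →ₘ[volume.restrict (unitBall n)] ℝ :=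
  AEEqFun.mk (fun x => -defPow n α x) (continuous_defPow hα).neg.aestronglyMeasurable

lemma negPowClass_coe {α : ℝ} (hα : 0 ≤ α) :
    negPowClass n hα =ᵐ[volume.restrict (unitBall n)] fun x => -defPow n α x :=
  AEEqFun.coeFn_mk _ _

lemma contDiffOn_defPow (α : ℝ) : ContDiffOn ℝ 1 (defPow n α) (unitBall n) := fun _ hx =>
  ((contDiffAt_defPow (mem_ball_zero_iff.1 hx)).of_le
    (WithTop.coe_le_coe.2 le_top)).contDiffWithinAt

lemma setLIntegral_rpow_rpow_le {U : Set (Eu n)} {p : ℝ} (hp : 0 < p)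
    {g : Eu n → ℝ≥0∞} {c : ℝ≥0∞} (h : ∀ᵐ x ∂(volume.restrict U), g x ≤ c) :
    (∫⁻ x in U, g x ^ p) ^ (1 / p) ≤ c * volume U ^ (1 / p) := by
  have hi : 0 ≤ 1 / p := by positivity
  calc (∫⁻ x in U, g x ^ p) ^ (1 / p) ≤ (∫⁻ _ in U, c ^ p) ^ (1 / p) := by
        refine ENNReal.rpow_le_rpow (lintegral_mono_ae ?_) hi
        filter_upwards [h] with x hx using ENNReal.rpow_le_rpow hx hp.le
    _ = _ := by
        rw [setLIntegral_const, ENNReal.mul_rpow_of_nonneg _ _ hi, ← ENNReal.rpow_mul,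
          mul_one_div_cancel hp.ne', ENNReal.rpow_one]

/-- Both parts of the Sobolev norm of the error are bounded by a uniform `O(δ)` times a power of the
finite volume of the ball, with `δ = 1/(k+1)`. -/
lemma negPowClass_mem_sobolevSpace {α p : ℝ} (hα : 0 < α) (hα1 : α ≤ 1) (hp : 0 < p) :
    negPowClass n hα.le ∈ sobolevSpace (unitBall n) (berwald n) p := by
  have hu := negPowClass_coe (n := n) hα.le
  have hδ : ∀ k : ℕ, 0 < 1 / ((k : ℝ) + 1) := fun k => by positivity
  refine ⟨fderiv ℝ (fun z => -defPow n α z),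
    (hasWeakDifferential_of_contDiffOn Metric.isOpen_ball (contDiffOn_defPow α).neg).congr hu.symm,
    fun k => truncation n α (1 / ((k : ℝ) + 1)), fun k => isTestFunction_truncation hα (hδ k), ?_⟩
  set V := volume (unitBall n) ^ (1 / p)
  have hV : V ≠ ⊤ := ENNReal.rpow_ne_top_of_nonneg (by positivity) volume_unitBall_lt_top.ne
  have hlim : ∀ c : ℝ, Tendsto (fun k : ℕ => ENNReal.ofReal (c * (1 / ((k : ℝ) + 1))) * V) atTop
      (𝓝 0) := fun c => by
    have h1 := ((tendsto_one_div_add_atTop_nhds_zero_nat (𝕜 := ℝ)).const_mul c)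
    rw [mul_zero] at h1
    have h2 := ENNReal.Tendsto.mul_const (ENNReal.tendsto_ofReal h1) (b := V) (Or.inr hV)
    simpa using h2
  have hsum := (hlim 2).add (hlim 4)
  rw [add_zero] at hsum
  refine tendsto_of_tendsto_of_tendsto_of_le_of_le tendsto_const_nhds hsum (fun _ => zero_le)
    fun k => add_le_add ?_ ?_
  · refine setLIntegral_rpow_rpow_le hp ?_
    filter_upwards [hu] with x hx
    rw [hx]
    exact enorm_defPow_sub_truncation_le (hδ k) x
  · refine setLIntegral_rpow_rpow_le hp ?_
    filter_upwards [ae_restrict_mem measurableSet_ball] with x hx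
    exact coMetric_defPow_sub_truncation_le hα hα1 (hδ k) (mem_ball_zero_iff.1 hx)

/-- Polar coordinates reduce the claim to the divergence of `∫ dt/(1-t)` at `1`. -/
lemma lintegral_inv_one_sub_norm_eq_top (hn : 0 < n) {R : ℝ} (hR0 : 0 < R) (hR : R < 1) :
    ∫⁻ x in unitBall n ∩ {x | R < ‖x‖}, ENNReal.ofReal (1 - ‖x‖)⁻¹ = ⊤ := by
  by_contra hne
  have : Nonempty (Fin n) := ⟨⟨0, hn⟩⟩
  have hA : MeasurableSet {x : Eu n | R < ‖x‖} := measurableSet_lt measurable_const measurable_norm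
  have hmeas : Measurable fun x : Eu n => (1 - ‖x‖)⁻¹ := (measurable_norm.const_sub 1).inv
  have h1 : IntegrableOn (fun x : Eu n => (1 - ‖x‖)⁻¹) (unitBall n ∩ {x | R < ‖x‖}) := by
    refine (lintegral_ofReal_ne_top_iff_integrable hmeas.aestronglyMeasurable ?_).1 hne
    filter_upwards [ae_restrict_mem (measurableSet_ball.inter hA)] with x hx
    have := mem_ball_zero_iff.1 hx.1
    exact inv_nonneg.2 (by linarith)
  have h2 : IntegrableOn (fun x : Eu n => (Set.Ioi R).indicator (fun t : ℝ => (1 - t)⁻¹) ‖x‖)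
      (Metric.ball 0 1) := by
    have e : (fun x : Eu n => (Set.Ioi R).indicator (fun t : ℝ => (1 - t)⁻¹) ‖x‖) =
        {x : Eu n | R < ‖x‖}.indicator fun x => (1 - ‖x‖)⁻¹ := by
      ext x; simp only [Set.indicator, Set.mem_Ioi]; rfl
    rw [e, IntegrableOn, integrable_indicator_iff hA, IntegrableOn, Measure.restrict_restrict hA,
      Set.inter_comm]
    exact h1
  rw [integrableOn_fun_norm_addHaar] at h2
  have h3 : IntegrableOn (fun t : ℝ => (t - 1)⁻¹) (Set.Ioo R 1) := by
    have h4 := (h2.mono_set (Set.Ioo_subset_Ioo_left hR0.le)).const_mul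
      ((R ^ (Module.finrank ℝ (Eu n) - 1))⁻¹)
    refine Integrable.mono' h4 (by fun_prop) ?_
    filter_upwards [ae_restrict_mem measurableSet_Ioo] with t ht
    have ht1 : 0 < 1 - t := by linarith [ht.2]
    rw [Set.indicator_of_mem (Set.mem_Ioi.2 ht.1), norm_inv, Real.norm_eq_abs, abs_sub_comm,
      abs_of_pos ht1, smul_eq_mul, ← mul_assoc]
    -- The polar weight is at least `R^(n-1)` on `(R,1)`, so it can be divided out.
    refine le_mul_of_one_le_left (inv_nonneg.2 ht1.le) ?_
    rw [← div_eq_inv_mul, one_le_div (by positivity)]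
    exact pow_le_pow_left₀ hR0.le ht.1.le _
  rw [← intervalIntegrable_iff_integrableOn_Ioo_of_le hR.le, intervalIntegrable_sub_inv_iff] at h3
  rcases h3 with h3 | h3
  · exact hR.ne h3
  · exact h3 Set.right_mem_uIcc

/-- Test the supremum with the inward vector `-x`: the power increases in that direction while the
metric stays bounded. -/
lemma ofReal_le_coMetric_fderiv_defPow {α : ℝ} (hα : 0 ≤ α) {x : Eu n} (hx : ‖x‖ < 1)
    (hx2 : 1 / 2 < ‖x‖) :
    ENNReal.ofReal (α * (1 - ‖x‖ ^ 2) ^ (α - 1)) ≤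
      coMetric (berwald n) x (fderiv ℝ (defPow n α) x) := by
  have hx0 : -x ≠ 0 := neg_ne_zero.2 (norm_pos_iff.1 (by linarith))
  refine le_trans (ENNReal.ofReal_le_ofReal ?_) (le_coMetric _ _ _ hx0)
  have hc := one_sub_norm_sq_pos hx
  have hpow : 0 ≤ α * (1 - ‖x‖ ^ 2) ^ (α - 1) := mul_nonneg hα (Real.rpow_nonneg hc.le _)
  have hxp : 0 < ‖x‖ := by linarith
  rw [fderiv_defPow hx, inner_neg_right, real_inner_self_eq_norm_sq, berwald_neg_self hx]
  have e : -(2 * α * (1 - ‖x‖ ^ 2) ^ (α - 1) * -‖x‖ ^ 2) / (‖x‖ / (1 + ‖x‖) ^ 2) =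
      α * (1 - ‖x‖ ^ 2) ^ (α - 1) * (2 * ‖x‖ * (1 + ‖x‖) ^ 2) := by
    field_simp
  rw [e]
  exact le_mul_of_one_le_right hpow (by nlinarith)

/-- A test function vanishes near the sphere, so it cannot reduce the co-metric integral there, and
that integral diverges. Thus no test function is at finite distance. -/
lemma neg_negPowClass_notMem_sobolevSpace (hn : 0 < n) {p : ℝ} (hp : 1 < p)
    (hα : 0 ≤ 1 - 1 / p) :
    -negPowClass n hα ∉ sobolevSpace (unitBall n) (berwald n) p := by
  rintro ⟨ξ, hξ, v, hv, ht⟩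
  have hp0 : 0 < p := by linarith
  set α := 1 - 1 / p with hαdef
  have hα0 : 0 < α := by
    rw [hαdef, sub_pos, div_lt_one hp0]; exact hp
  have hw : (-negPowClass n hα : Eu n →ₘ[volume.restrict (unitBall n)] ℝ)
      =ᵐ[volume.restrict (unitBall n)] defPow n α := by
    filter_upwards [AEEqFun.coeFn_neg (negPowClass n hα), negPowClass_coe (n := n) hα] with x h1 h2
    rw [h1, Pi.neg_apply, h2, neg_neg]
  have hae := (hξ.congr hw).ae_eq Metric.isOpen_ball
    (hasWeakDifferential_of_contDiffOn Metric.isOpen_ball (contDiffOn_defPow α))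
  obtain ⟨k, hk⟩ := (ht.eventually (eventually_lt_nhds one_pos)).exists
  obtain ⟨R, hR, hsub⟩ := exists_lt_subset_ball (isClosed_tsupport (v k)) (hv k).tsupport_subset
  set R' := max R (1 / 2)
  have hR'1 : R' < 1 := max_lt hR (by norm_num)
  have hR'0 : 0 < R' := lt_of_lt_of_le (by norm_num) (le_max_right _ _)
  have hA : MeasurableSet (unitBall n ∩ {x : Eu n | R' < ‖x‖}) :=
    measurableSet_ball.inter (measurableSet_lt measurable_const measurable_norm)
  have htop : ∫⁻ x in unitBall n, coMetric (berwald n) x (ξ x - fderiv ℝ (v k) x) ^ p = ⊤ := by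
    rw [eq_top_iff]
    calc (⊤ : ℝ≥0∞) = ENNReal.ofReal (α ^ p / 2) *
          ∫⁻ x in unitBall n ∩ {x | R' < ‖x‖}, ENNReal.ofReal (1 - ‖x‖)⁻¹ := by
          rw [lintegral_inv_one_sub_norm_eq_top hn hR'0 hR'1, ENNReal.mul_top]
          have : 0 < α ^ p / 2 := by positivity
          exact (ENNReal.ofReal_pos.2 this).ne'
      _ = ∫⁻ x in unitBall n ∩ {x | R' < ‖x‖},
            ENNReal.ofReal (α ^ p / 2) * ENNReal.ofReal (1 - ‖x‖)⁻¹ :=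
          (lintegral_const_mul' _ _ ENNReal.ofReal_ne_top).symm
      _ ≤ ∫⁻ x in unitBall n ∩ {x | R' < ‖x‖},
            coMetric (berwald n) x (ξ x - fderiv ℝ (v k) x) ^ p := by
          refine setLIntegral_mono_ae' hA ?_
          filter_upwards [hae] with x hx hxA
          have hxU := mem_ball_zero_iff.1 hxA.1
          have hxR : R' < ‖x‖ := hxA.2
          have hx0 : fderiv ℝ (v k) x = 0 := fderiv_of_notMem_tsupport ℝ fun hm => by
            have h1 := mem_ball_zero_iff.1 (hsub hm)
            linarith [le_max_left R (1 / 2)]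
          have hc := one_sub_norm_sq_pos hxU
          have hc' : 0 < 1 - ‖x‖ := by linarith
          rw [hx hxA.1, hx0, sub_zero, ← ENNReal.ofReal_mul (by positivity)]
          refine le_trans ?_ (ENNReal.rpow_le_rpow (ofReal_le_coMetric_fderiv_defPow hα0.le hxU
            (lt_of_le_of_lt (le_max_right _ _) hxR)) hp0.le)
          have hpow : 0 < (1 - ‖x‖ ^ 2) ^ (α - 1) := Real.rpow_pos_of_pos hc _
          rw [ENNReal.ofReal_rpow_of_nonneg (by positivity) hp0.le]
          refine ENNReal.ofReal_le_ofReal ?_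
          rw [Real.mul_rpow hα0.le hpow.le, ← Real.rpow_mul hc.le]
          -- The exponent `α = 1 - 1/p` is chosen to make this the borderline non-integrable power.
          have e : (α - 1) * p = -1 := by rw [hαdef]; field_simp; ring
          rw [e, Real.rpow_neg_one, div_mul_eq_mul_div, mul_div_assoc]
          gcongr
          -- The constant `1/2` in front comes from `1 - |x|² ≤ 2(1 - |x|)`.
          rw [inv_eq_one_div, inv_eq_one_div, div_div, div_le_div_iff₀ (by positivity) hc]
          nlinarith
      _ ≤ _ := lintegral_mono_set Set.inter_subset_left
  rw [sobolevNorm, htop, ENNReal.top_rpow_of_pos (by positivity), add_top] at hk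
  exact absurd hk (by simp)

theorem not_exists_submodule_eq_sobolevSpace (hn : 0 < n) {p : ℝ} (hp : 1 < p) :
    ¬ ∃ S : Submodule ℝ (Eu n →ₘ[volume.restrict (unitBall n)] ℝ),
      (S : Set (Eu n →ₘ[volume.restrict (unitBall n)] ℝ)) =
        sobolevSpace (unitBall n) (berwald n) p := by
  rintro ⟨S, hS⟩
  have hα : 0 < 1 - 1 / p := by
    rw [sub_pos, div_lt_one (by linarith)]; exact hp
  have hα1 : 1 - 1 / p ≤ 1 := by
    have : 0 < 1 / p := by positivity
    linarith
  refine neg_negPowClass_notMem_sobolevSpace hn hp hα.le ?_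
  rw [← hS]
  refine S.neg_mem ?_
  change _ ∈ (S : Set (Eu n →ₘ[volume.restrict (unitBall n)] ℝ))
  rw [hS]
  exact negPowClass_mem_sobolevSpace hα hα1 (by linarith)

end Finsler

end

/-! ### The theorem -/

theorem theorem1p1 (n : ℕ) (hn : 2 ≤ n) :
    Finsler.IsCartanHadamard (Finsler.unitBall n) (Finsler.berwald n) ∧
    Finsler.IsFlat (Finsler.unitBall n) (Finsler.berwald n) ∧
    -- (i) infinite reversibility, no isometric embedding into a Minkowski space
    (Finsler.reversibility (Finsler.unitBall n) (Finsler.berwald n) = ⊤ ∧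
      ∀ (V : Type*) [NormedAddCommGroup V] [NormedSpace ℝ V] [FiniteDimensional ℝ V] (φ : V → ℝ),
        Finsler.IsMinkowskiNorm φ →
          ¬ ∃ f, Finsler.IsIsometricEmbedding (Finsler.unitBall n) (Finsler.berwald n) φ f) ∧
    -- (ii) the Sobolev space is not a vector space
    (∀ p : ℝ, 1 < p →
      ¬ ∃ S : Submodule ℝ (Finsler.Eu n →ₘ[volume.restrict (Finsler.unitBall n)] ℝ),
        (S : Set (Finsler.Eu n →ₘ[volume.restrict (Finsler.unitBall n)] ℝ)) =
          Finsler.sobolevSpace (Finsler.unitBall n) (Finsler.berwald n) p) ∧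
    -- (iii) the Hardy quotient is well-defined and has infimum zero
    (∀ p : ℝ, 1 < p → p < n →
      (∀ f, Finsler.IsTestFunction (Finsler.unitBall n) f → f ≠ 0 →
        Finsler.energy (Finsler.unitBall n) (Finsler.berwald n) p f < ⊤ ∧
        0 < Finsler.weighted (Finsler.unitBall n) (Finsler.berwald n) p (-p) f ∧
        Finsler.weighted (Finsler.unitBall n) (Finsler.berwald n) p (-p) f < ⊤) ∧
      (⨅ (f : Finsler.Eu n → ℝ) (_ : Finsler.IsTestFunction (Finsler.unitBall n) f) (_ : f ≠ 0),
        Finsler.energy (Finsler.unitBall n) (Finsler.berwald n) p f /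
          Finsler.weighted (Finsler.unitBall n) (Finsler.berwald n) p (-p) f) = 0) ∧
    -- (iv) the uncertainty quotient is well-defined and has infimum zero
    (∀ p s : ℝ, -p + 1 < s → s ≤ 1 → 1 < p → p < n →
      (∀ f, Finsler.IsTestFunction (Finsler.unitBall n) f → f ≠ 0 →
        Finsler.energy (Finsler.unitBall n) (Finsler.berwald n) p f < ⊤ ∧
        Finsler.weighted (Finsler.unitBall n) (Finsler.berwald n) p
          (Real.conjExponent p * s) f < ⊤ ∧
        0 < Finsler.weighted (Finsler.unitBall n) (Finsler.berwald n) p (s - 1) f ∧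
        Finsler.weighted (Finsler.unitBall n) (Finsler.berwald n) p (s - 1) f < ⊤) ∧
      (⨅ (f : Finsler.Eu n → ℝ) (_ : Finsler.IsTestFunction (Finsler.unitBall n) f) (_ : f ≠ 0),
        Finsler.energy (Finsler.unitBall n) (Finsler.berwald n) p f ^ (1 / p) *
            Finsler.weighted (Finsler.unitBall n) (Finsler.berwald n) p
              (Real.conjExponent p * s) f ^ (1 / Real.conjExponent p) /
          Finsler.weighted (Finsler.unitBall n) (Finsler.berwald n) p (s - 1) f) = 0) := by
  have hn0 : 0 < n := by omega
  refine ⟨Finsler.isCartanHadamard_berwald, Finsler.isFlat_berwald,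
    ⟨Finsler.reversibility_berwald hn0, fun V _ _ _ φ hφ =>
      Finsler.not_exists_isIsometricEmbedding hn0 hφ⟩,
    fun p hp => Finsler.not_exists_submodule_eq_sobolevSpace hn0 hp,
    fun p hp hpn => ⟨fun f hf hf0 => ?_, Finsler.iInf_hardy_quotient_eq_zero hp⟩,
    fun p s hs hs1 hp hpn => ⟨fun f hf hf0 => ?_,
      Finsler.iInf_uncertainty_quotient_eq_zero hn0 hp hpn hs hs1⟩⟩
  · exact ⟨Finsler.energy_berwald_lt_top (by linarith) hf,
      Finsler.weighted_berwald_pos (by linarith) (by linarith) hf hf0,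
      Finsler.weighted_berwald_lt_top hn0 (by linarith) (by linarith) hf⟩
  -- Both weights are integrable at the origin: `p's > -p > -n` and `s - 1 > -p > -n`.
  · refine ⟨Finsler.energy_berwald_lt_top (by linarith) hf,
      Finsler.weighted_berwald_lt_top hn0 (by linarith)
        (lt_trans (neg_lt_neg hpn) (Finsler.neg_lt_conjExponent_mul hp hs)) hf,
      Finsler.weighted_berwald_pos (by linarith) (by linarith) hf hf0,
      Finsler.weighted_berwald_lt_top hn0 (by linarith) (by linarith) hf⟩
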